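/- An SW-category (subtractive Waldhausen category) is a small category $\mathcal C$ with an initial object $\emptyset$, subcategories of cofibrations ($\hookrightarrow$), of fibrations and of weak equivalences, each containing all isomorphisms, and a class of subtraction sequences $X\hookrightarrow Y\xleftarrow{\circ}Y\smallsetminus X$ (a cofibration and a fibration), such that: cofibrations and fibrations have pullbacks along all maps and are stable under them; pushouts of pairs of cofibrations exist, consist of cofibrations and are Cartesian; every cofibration is part of a subtraction sequence, and either map of a subtraction sequence determines the other up to unique isomorphism; $X=X\leftarrow\emptyset$ and $\emptyset\to X=X$ are subtraction sequences; subtraction sequences are stable under base change; a Cartesian square of cofibrations induces a unique compatible map on complements, which is a cofibration; weak equivalences can be glued along pushouts of cofibrations; and in a map of subtraction sequences that is a weak equivalence on $X$ and on $Y$ the map on $Y\smallsetminus X$ is a weak equivalence. Its $K$-theory is $K^{SW}(\mathcal C)=\Omega_\emptyset|N_\bullet w\tilde S_\bullet\mathcal C|$, where $w\tilde S_n\mathcal C$ is the category of functors $X\colon\{(i,j)\in[n]^{op}\times[n]: i\le j\}\to\mathcal C$ with $X_{i,i}\cong\emptyset$ such that $X_{i,j}\hookrightarrow X_{i,k}\xleftarrow{\circ}X_{j,k}$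 is a subtraction sequence for all $i\le j\le k$, and of natural transformations that are componentwise weak equivalences. Let $\mathcal C$ be an SW-category in which all cofibrations are monomorphisms and which satisfies $(*)$ if $X\hookrightarrow Y\xleftarrow{\circ}Y\smallsetminus X$ is a subtraction sequence and $Z\to Y$ a map such that $X\times_YZ\to X$ and $(Y\smallsetminus X)\times_YZ\to Y\smallsetminus X$ are weak equivalences, then $Z\to Y$ is a weak equivalence. Let $\mathcal C'$ be the associated squares category (double category): its horizontal maps are the cofibrations, its vertical maps are all maps of $\mathcal C$, its basepoint $O$ is $\emptyset$, and its distinguished squares are the commutative squares with horizontal maps $A\hookrightarrow B$, $C\hookrightarrow D$ and vertical maps $A\to C$, $B\to D$ such that $A\to B\times_DC$ is a weak equivalence, and such that $B\to D$ induces a map $B\smallsetminus A\to D\smallsetminus C$ that is a weak equivalence. Its $K$-theory is $K^\square(\mathcal C')=\Omega_O|N_\bullet T_\bullet\mathcal C'|$, where $T_n\mathcal C'$ is the category of functors from $[n]$ to the horizontal category, and of vertical transformations all of whose squares are distinguished. Then there is a homotopy equivalence $K^{SW}(\mathcal C)\simeq K^\square(\mathcal C')$. If moreover coproducts of subtraction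 sequences are subtraction sequences, so that coproducts define $\Gamma$-spaces (infinite loop space structures) on both sides, then these $\Gamma$-spaces are equivalent. Here the $\Gamma$-spaces send a finite set $S$ to the $K$-theory of the category of sum diagrams (functors $A$ from the subsets of $S$ to $\mathcal C$ with $A(\emptyset)$ initial and $A(U\sqcup V)=A(U)\sqcup A(V)$) with the pointwise structures, and equivalent means: connected by a zigzag of natural transformations that are homotopy equivalences on every finite set $S$. -/

import Mathlib

open CategoryTheory CategoryTheory.Limits Opposite
open scoped Simplicial ContinuousMap

universe v u

noncomputable section

namespace SquaresK

/-! ## Squares categories -/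

/-- A squares category: a small double category whose 2-cells are determined by their boundary
(the distinguished squares), with an object `O` that is initial both for the horizontal
category `M` and for the vertical category `E`. The square
`dist f f' g g'` has top edge `f`, bottom edge `f'`, left edge `g` and right edge `g'`. -/
structure SquaresCategory where
  Ob : Type u
  E : Category.{v} Ob
  M : Category.{v} Ob
  dist : ∀ {A B C D : Ob}, M.Hom A B → M.Hom C D → E.Hom A C → E.Hom B D → Prop
  dist_vcomp : ∀ {A B C D X Y : Ob} {f : M.Hom A B} {f' : M.Hom C D} {f'' : M.Hom X Y}
    {g : E.Hom A C} {g' : E.Hom B D} {h : E.Hom C X} {h' : E.Hom D Y},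
    dist f f' g g' → dist f' f'' h h' → dist f f'' (E.comp g h) (E.comp g' h')
  dist_hcomp : ∀ {A B C X Y Z : Ob} {f : M.Hom A B} {k : M.Hom B C} {f' : M.Hom X Y}
    {k' : M.Hom Y Z} {g : E.Hom A X} {g' : E.Hom B Y} {g'' : E.Hom C Z},
    dist f f' g g' → dist k k' g' g'' → dist (M.comp f k) (M.comp f' k') g g''
  dist_vid : ∀ {A B : Ob} (f : M.Hom A B), dist f f (E.id A) (E.id B)
  dist_hid : ∀ {A B : Ob} (g : E.Hom A B), dist (M.id A) (M.id B) g g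
  O : Ob
  initial_M : ∀ X : Ob, Nonempty (Unique (M.Hom O X))
  initial_E : ∀ X : Ob, Nonempty (Unique (E.Hom O X))

namespace SquaresCategory

/-- The horizontal category `M` of a squares category. -/
def Hor (S : SquaresCategory.{v, u}) : Type u := S.Ob

instance (S : SquaresCategory.{v, u}) : Category.{v} S.Hor := S.M

/-- The basepoint as an object of the horizontal category. -/
def horO (S : SquaresCategory.{v, u}) : S.Hor := S.O

/-- A functor of squares categories. -/
structure Hom (S T : SquaresCategory.{v, u}) where
  obj : S.Ob → T.Ob
  mapE : ∀ {A B : S.Ob}, S.E.Hom A B → T.E.Hom (obj A) (obj B)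
  mapM : ∀ {A B : S.Ob}, S.M.Hom A B → T.M.Hom (obj A) (obj B)
  mapE_id : ∀ A : S.Ob, mapE (S.E.id A) = T.E.id (obj A)
  mapM_id : ∀ A : S.Ob, mapM (S.M.id A) = T.M.id (obj A)
  mapE_comp : ∀ {A B C : S.Ob} (f : S.E.Hom A B) (g : S.E.Hom B C),
    mapE (S.E.comp f g) = T.E.comp (mapE f) (mapE g)
  mapM_comp : ∀ {A B C : S.Ob} (f : S.M.Hom A B) (g : S.M.Hom B C),
    mapM (S.M.comp f g) = T.M.comp (mapM f) (mapM g)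
  map_dist : ∀ {A B C D : S.Ob} {f : S.M.Hom A B} {f' : S.M.Hom C D} {g : S.E.Hom A C}
    {g' : S.E.Hom B D}, S.dist f f' g g' → T.dist (mapM f) (mapM f') (mapE g) (mapE g')
  obj_O : obj S.O = T.O

instance : Category SquaresCategory.{v, u} where
  Hom := Hom
  id S :=
    { obj := fun A => A
      mapE := fun f => f
      mapM := fun f => f
      mapE_id := fun _ => rfl
      mapM_id := fun _ => rfl
      mapE_comp := fun _ _ => rfl
      mapM_comp := fun _ _ => rfl
      map_dist := fun h => h
      obj_O := rfl }
  comp F G :=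
    { obj := fun A => G.obj (F.obj A)
      mapE := fun f => G.mapE (F.mapE f)
      mapM := fun f => G.mapM (F.mapM f)
      mapE_id := fun A => by rw [F.mapE_id, G.mapE_id]
      mapM_id := fun A => by rw [F.mapM_id, G.mapM_id]
      mapE_comp := fun f g => by rw [F.mapE_comp, G.mapE_comp]
      mapM_comp := fun f g => by rw [F.mapM_comp, G.mapM_comp]
      map_dist := fun h => G.map_dist (F.map_dist h)
      obj_O := by rw [F.obj_O, G.obj_O] }

/-- The underlying functor on horizontal categories. -/
def Hom.hor {S T : SquaresCategory.{v, u}} (F : S ⟶ T) : S.Hor ⥤ T.Hor where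
  obj A := Hom.obj F A
  map f := Hom.mapM F f
  map_id A := Hom.mapM_id F A
  map_comp f g := Hom.mapM_comp F f g

/-- A horizontal functor `D ⥤ S`. -/
structure HFun (D : Type) [Category.{0} D] (S : SquaresCategory.{v, u}) where
  fn : D ⥤ S.Hor

/-- A vertical distinguished transformation between horizontal functors. -/
@[ext]
structure VertTrans {D : Type} [Category.{0} D] {S : SquaresCategory.{v, u}}
    (F G : HFun D S) where
  app : ∀ d : D, S.E.Hom (F.fn.obj d) (G.fn.obj d)
  dist : ∀ {d d' : D} (f : d ⟶ d'), S.dist (F.fn.map f) (G.fn.map f) (app d) (app d')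

/-- The category of horizontal functors and vertical distinguished transformations. -/
instance (D : Type) [Category.{0} D] (S : SquaresCategory.{v, u}) : Category.{v} (HFun D S) where
  Hom F G := VertTrans F G
  id F := ⟨fun d => S.E.id (F.fn.obj d), fun f => S.dist_vid (F.fn.map f)⟩
  comp α β := ⟨fun d => S.E.comp (α.app d) (β.app d),
    fun f => S.dist_vcomp (α.dist f) (β.dist f)⟩
  id_comp α := VertTrans.ext (funext fun d => S.E.id_comp (α.app d))
  comp_id α := VertTrans.ext (funext fun d => S.E.comp_id (α.app d))
  assoc α β γ := VertTrans.ext (funext fun d => S.E.assoc (α.app d) (β.app d) (γ.app d))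

/-- Restriction of horizontal functors along a functor of index categories. -/
def HFun.precomp {D D' : Type} [Category.{0} D] [Category.{0} D'] (p : D ⥤ D')
    (S : SquaresCategory.{v, u}) : HFun D' S ⥤ HFun D S where
  obj F := ⟨p ⋙ F.fn⟩
  map α := ⟨fun d => VertTrans.app α (p.obj d), fun f => VertTrans.dist α (p.map f)⟩

/-- A functor of squares categories acts on horizontal functors. -/
def HFun.postcomp (D : Type) [Category.{0} D] {S T : SquaresCategory.{v, u}} (F : S ⟶ T) :
    HFun D S ⥤ HFun D T where
  obj X := ⟨X.fn ⋙ Hom.hor F⟩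
  map α := ⟨fun d => Hom.mapE F (VertTrans.app α d), fun f => Hom.map_dist F (VertTrans.dist α f)⟩
  map_id X := VertTrans.ext (funext fun d => Hom.mapE_id F (X.fn.obj d))
  map_comp α β := VertTrans.ext (funext fun d =>
    Hom.mapE_comp F (VertTrans.app α d) (VertTrans.app β d))

end SquaresCategory

/-- The functor `[m] ⥤ [n]` given by a morphism of the simplex category. -/
abbrev ordFunctor {m n : SimplexCategory} (f : m ⟶ n) : Fin (m.len + 1) ⥤ Fin (n.len + 1) :=
  f.toOrderHom.monotone.functor

open SquaresCategory in
/-- The simplicial category `T_• S`, where `T_n S` is the category of horizontal functors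
`[n] ⥤ S`. -/
def simplicialT (S : SquaresCategory.{v, u}) : SimplexCategoryᵒᵖ ⥤ Cat.{v, max u v} where
  obj n := Cat.of (HFun (Fin (n.unop.len + 1)) S)
  map f := (HFun.precomp (ordFunctor f.unop) S).toCatHom
  map_id _ := rfl
  map_comp _ _ := rfl

/-! ## Realizations and loop spaces -/

/-- A simplicial set with a chosen vertex. -/
structure PointedSSet where
  X : SSet.{u}
  pt : X.obj (op ⦋0⦌)

/-- A map of simplicial sets that preserves the chosen vertices. -/
@[ext]
structure PointedSSet.Hom (X Y : PointedSSet.{u}) where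
  map : X.X ⟶ Y.X
  map_pt : map.app (op ⦋0⦌) X.pt = Y.pt

instance : Category PointedSSet.{u} where
  Hom := PointedSSet.Hom
  id X := ⟨𝟙 X.X, rfl⟩
  comp f g := ⟨f.map ≫ g.map, by
    rw [← g.map_pt, ← f.map_pt]; rfl⟩

/-- The nerve of a simplicial category `X` is the bisimplicial set `N_m X_n`; this is its
diagonal simplicial set, whose geometric realization is the realization of the
bisimplicial set. -/
def diagNerve : (SimplexCategoryᵒᵖ ⥤ Cat.{v, u}) ⥤ SSet.{max u v} where
  obj X :=
    { obj := fun n => (nerve (X.obj n)).obj n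
      map := fun {m n} f => (nerve (X.obj m)).map f ≫ (nerveMap (X.map f).toFunctor).app n
      map_id := fun n => by
        rw [X.map_id]
        rfl
      map_comp := fun f g => by
        rw [X.map_comp]
        rfl }
  map {X Y} α :=
    { app := fun n => (nerveMap (α.app n).toFunctor).app n
      naturality := fun m n f => by
        ext x
        exact congrArg (fun F => (nerveMap (Cat.Hom.toFunctor F)).app n
          ((nerve (X.obj m)).map f x)) (α.naturality f) }
  map_id X := rfl
  map_comp α β := rfl

/-- The point of the geometric realization given by a vertex. -/
def realizationPoint (X : SSet.{u}) (x : X.obj (op ⦋0⦌)) : SSet.toTop.obj X :=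
  TopCat.toSSetObj₀Equiv ((sSetTopAdj.unit.app X).app (op ⦋0⦌) x)

lemma realizationPoint_map {X Y : SSet.{u}} (f : X ⟶ Y) (x : X.obj (op ⦋0⦌)) :
    SSet.toTop.map f (realizationPoint X x) = realizationPoint Y (f.app (op ⦋0⦌) x) := by
  have h := congrArg (fun t => t.app (op ⦋0⦌) x) (sSetTopAdj.unit.naturality f)
  exact congrArg TopCat.toSSetObj₀Equiv h.symm

/-- The loop space, at the chosen vertex, of the geometric realization of a pointed
simplicial set, with the compact-open topology. -/
def loopRealization : PointedSSet.{u} ⥤ TopCat.{u} where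
  obj X := TopCat.of (Path (realizationPoint X.X X.pt) (realizationPoint X.X X.pt))
  map {X Y} f := TopCat.ofHom
    { toFun := fun γ => (γ.map (SSet.toTop.map f.map).hom.continuous).cast
        (by rw [← f.map_pt]; exact (realizationPoint_map f.map X.pt).symm)
        (by rw [← f.map_pt]; exact (realizationPoint_map f.map X.pt).symm)
      continuous_toFun := by
        have h : Continuous fun γ : Path (realizationPoint X.X X.pt) (realizationPoint X.X X.pt) =>
            (SSet.toTop.map f.map).hom.comp γ.toContinuousMap :=
          (ContinuousMap.continuous_postcomp (SSet.toTop.map f.map).hom).comp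
            continuous_induced_dom
        exact continuous_induced_rng.2 h }
  map_id X := by
    ext γ t
    exact congrArg (fun g => g (γ t)) (SSet.toTop.map_id X.X)
  map_comp f g := by
    ext γ t
    exact congrArg (fun h => h (γ t)) (SSet.toTop.map_comp f.map g.map)

/-! ## `K`-theory of squares categories -/

open SquaresCategory in
/-- `|N_• T_• S|` as a simplicial set, pointed at `O ∈ N_0 T_0 S`. -/
def pointedT : SquaresCategory.{v, u} ⥤ PointedSSet.{max u v} where
  obj S :=
    { X := diagNerve.obj (simplicialT S)
      pt := ComposableArrows.mk₀
        (⟨(Functor.const _).obj S.horO⟩ : HFun (Fin (0 + 1)) S) }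
  map {S T} F :=
    { map := diagNerve.map
        { app := fun n => (HFun.postcomp (Fin (n.unop.len + 1)) F).toCatHom
          naturality := fun _ _ _ => rfl }
      map_pt := by
        refine ComposableArrows.ext₀ ?_
        have h : (Functor.const (Fin (0 + 1))).obj S.horO ⋙ SquaresCategory.Hom.hor F
            = (Functor.const (Fin (0 + 1))).obj T.horO := by
          have hO : T.horO = (SquaresCategory.Hom.hor F).obj S.horO :=
            (SquaresCategory.Hom.obj_O F).symm
          rw [hO]
          exact CategoryTheory.Functor.ext (fun _ => rfl)
            (fun _ _ _ => by
              have h : (SquaresCategory.Hom.hor F).map (𝟙 S.horO) =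
                  𝟙 _ ≫ 𝟙 _ ≫ 𝟙 _ := by
                rw [CategoryTheory.Functor.map_id, Category.id_comp, Category.id_comp]
              exact h)
        exact congrArg HFun.mk h }
  map_id S := rfl
  map_comp F G := rfl

/-- The `K`-theory space `Ω_O |N_• T_• S|` of a squares category. -/
def squaresK : SquaresCategory.{v, u} ⥤ TopCat.{max u v} :=
  pointedT ⋙ loopRealization

/-! ## Subtractive Waldhausen categories -/

/-- The data of a subtractive Waldhausen category: subcategories of cofibrations, of fibrations
(complement maps) and of weak equivalences, a class of subtraction sequences
`X ⟶ Y ⟵ U` (with `U = Y ∖ X`), and an object `O` (the initial object `∅`). -/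
structure SWData (C : Type u) [Category.{v} C] where
  cof : MorphismProperty C
  fib : MorphismProperty C
  weq : MorphismProperty C
  cof_mul : cof.IsMultiplicative
  fib_mul : fib.IsMultiplicative
  weq_mul : weq.IsMultiplicative
  sub : ∀ {X Y U : C}, (X ⟶ Y) → (U ⟶ Y) → Prop
  O : C
  -- the sequence `∅ = ∅ ⟵ ∅`, needed for the basepoint
  sub_O : sub (𝟙 O) (𝟙 O)

namespace SWData

variable {C : Type u} [Category.{v} C]

/-- The axioms of a subtractive category. -/
structure IsSubtractive (W : SWData C) : Prop where
  initial : Nonempty (IsInitial W.O)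
  cof_of_iso : MorphismProperty.isomorphisms C ≤ W.cof
  fib_of_iso : MorphismProperty.isomorphisms C ≤ W.fib
  -- pullbacks along cofibrations and fibrations
  cof_hasPullback : ∀ {X Y Z : C} (i : X ⟶ Y) (f : Z ⟶ Y), W.cof i → HasPullback f i
  fib_hasPullback : ∀ {U Y Z : C} (j : U ⟶ Y) (f : Z ⟶ Y), W.fib j → HasPullback f j
  cof_baseChange : W.cof.IsStableUnderBaseChange
  fib_baseChange : W.fib.IsStableUnderBaseChange
  -- pushouts of pairs of cofibrations
  cof_hasPushout : ∀ {X Y Z : C} (i : X ⟶ Y) (i' : X ⟶ Z), W.cof i → W.cof i' → HasPushout i i'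
  cof_pushout : ∀ {X Y Z P : C} {i : X ⟶ Y} {i' : X ⟶ Z} {k : Y ⟶ P} {k' : Z ⟶ P},
    IsPushout i i' k k' → W.cof i → W.cof i' → W.cof k ∧ W.cof k' ∧ IsPullback i i' k k'
  -- subtraction sequences consist of a cofibration and a fibration, and either of the two maps
  -- determines the other up to unique isomorphism
  sub_cof : ∀ {X Y U : C} {i : X ⟶ Y} {j : U ⟶ Y}, W.sub i j → W.cof i
  sub_fib : ∀ {X Y U : C} {i : X ⟶ Y} {j : U ⟶ Y}, W.sub i j → W.fib j
  exists_sub : ∀ {X Y : C} (i : X ⟶ Y), W.cof i → ∃ (U : C) (j : U ⟶ Y), W.sub i j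
  sub_unique : ∀ {X Y U U' : C} {i : X ⟶ Y} {j : U ⟶ Y} {j' : U' ⟶ Y},
    W.sub i j → W.sub i j' → ∃! e : U ≅ U', e.hom ≫ j' = j
  sub_unique' : ∀ {X X' Y U : C} {i : X ⟶ Y} {i' : X' ⟶ Y} {j : U ⟶ Y},
    W.sub i j → W.sub i' j → ∃! e : X ≅ X', e.hom ≫ i' = i
  sub_id : ∀ {X : C} (f : W.O ⟶ X), W.sub (𝟙 X) f
  sub_initial : ∀ {X : C} (f : W.O ⟶ X), W.sub f (𝟙 X)
  -- subtraction sequences are stable under base change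
  sub_baseChange : ∀ {X Y U Z X' U' : C} {i : X ⟶ Y} {j : U ⟶ Y} {f : Z ⟶ Y}
    {i' : X' ⟶ Z} {p : X' ⟶ X} {j' : U' ⟶ Z} {q : U' ⟶ U},
    W.sub i j → IsPullback p i' i f → IsPullback q j' j f → W.sub i' j'
  -- subtraction is functorial for Cartesian squares of cofibrations
  sub_cartesian : ∀ {X Y X' Y' U U' : C} {i : X ⟶ Y} {i' : X' ⟶ Y'} {a : X ⟶ X'} {b : Y ⟶ Y'}
    {j : U ⟶ Y} {j' : U' ⟶ Y'}, IsPullback i a b i' → W.cof a → W.cof b →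
    W.sub i j → W.sub i' j' →
    ∃ c : U ⟶ U', c ≫ j' = j ≫ b ∧ W.cof c ∧ ∀ c' : U ⟶ U', c' ≫ j' = j ≫ b → c' = c

/-- The axioms of an SW-category (subtractive Waldhausen category). -/
structure IsSW (W : SWData C) : Prop extends W.IsSubtractive where
  weq_of_iso : MorphismProperty.isomorphisms C ≤ W.weq
  -- gluing of weak equivalences along pushouts of cofibrations
  weq_gluing : ∀ {X Y Z P X' Y' Z' P' : C} {i : X ⟶ Y} {k : X ⟶ Z} {l : Y ⟶ P} {m : Z ⟶ P}
    {i' : X' ⟶ Y'} {k' : X' ⟶ Z'} {l' : Y' ⟶ P'} {m' : Z' ⟶ P'}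
    {a : X ⟶ X'} {b : Y ⟶ Y'} {c : Z ⟶ Z'} {d : P ⟶ P'},
    IsPushout i k l m → IsPushout i' k' l' m' → W.cof i → W.cof k → W.cof i' → W.cof k' →
    i ≫ b = a ≫ i' → k ≫ c = a ≫ k' → l ≫ d = b ≫ l' → m ≫ d = c ≫ m' →
    W.weq a → W.weq b → W.weq c → W.weq d
  -- subtraction of weak equivalences
  weq_subtraction : ∀ {X Y U X' Y' U' : C} {i : X ⟶ Y} {j : U ⟶ Y} {i' : X' ⟶ Y'} {j' : U' ⟶ Y'}
    {a : X ⟶ X'} {b : Y ⟶ Y'} {c : U ⟶ U'}, W.sub i j → W.sub i' j' →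
    i ≫ b = a ≫ i' → j ≫ b = c ≫ j' → W.weq a → W.weq b → W.weq c

/-- Condition `(*)`: weak equivalences over both parts of a subtraction sequence
`X ⟶ Y ⟵ Y ∖ X` can be glued, i.e. if `X ×_Y Z ⟶ X` and `(Y ∖ X) ×_Y Z ⟶ Y ∖ X` are weak
equivalences, then so is `Z ⟶ Y`. -/
def Star (W : SWData C) : Prop :=
  ∀ {X Y U Z X' U' : C} {i : X ⟶ Y} {j : U ⟶ Y} {f : Z ⟶ Y}
    {i' : X' ⟶ Z} {p : X' ⟶ X} {j' : U' ⟶ Z} {q : U' ⟶ U},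
    W.sub i j → IsPullback p i' i f → IsPullback q j' j f → W.weq p → W.weq q → W.weq f

/-- All cofibrations are monomorphisms. -/
def MonoCof (W : SWData C) : Prop :=
  ∀ {X Y : C} (i : X ⟶ Y), W.cof i → Mono i

/-- The distinguished squares of the associated squares category: commutative squares, with top
and bottom edges `f : A ⟶ B`, `f' : A' ⟶ B'` and vertical edges `g : A ⟶ A'`, `g' : B ⟶ B'`,
such that `A ⟶ B ×_{B'} A'` is a weak equivalence, and such that there is an induced map
`B ∖ A ⟶ B' ∖ A'` and it is a weak equivalence. -/
def Dist (W : SWData C) {A B A' B' : C} (f : A ⟶ B) (f' : A' ⟶ B') (g : A ⟶ A')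
    (g' : B ⟶ B') : Prop :=
  ∃ w : f ≫ g' = g ≫ f',
    (∃ (P : C) (p : P ⟶ B) (q : P ⟶ A') (h : IsPullback p q g' f'), W.weq (h.lift f g w)) ∧
    (∃ (U U' : C) (j : U ⟶ B) (j' : U' ⟶ B') (c : U ⟶ U'),
      W.sub f j ∧ W.sub f' j' ∧ c ≫ j' = j ≫ g' ∧ W.weq c)

section

variable {W : SWData C}

lemma weq_of_isIso (hW : W.IsSW) {X Y : C} (f : X ⟶ Y) [IsIso f] : W.weq f :=
  hW.weq_of_iso _ ((MorphismProperty.isomorphisms.iff _).2 inferInstance)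

lemma weq_comp (W : SWData C) {X Y Z : C} {f : X ⟶ Y} {g : Y ⟶ Z} (hf : W.weq f)
    (hg : W.weq g) : W.weq (f ≫ g) :=
  W.weq_mul.comp_mem f g hf hg

lemma cof_comp (W : SWData C) {X Y Z : C} {f : X ⟶ Y} {g : Y ⟶ Z} (hf : W.cof f)
    (hg : W.cof g) : W.cof (f ≫ g) :=
  W.cof_mul.comp_mem f g hf hg

/-- Subtraction sequences are invariant under isomorphism. -/
lemma sub_iso (hW : W.IsSubtractive) {X Y U X' U' : C} {i : X ⟶ Y} {j : U ⟶ Y}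
    (h : W.sub i j) (a : X' ≅ X) (b : U' ≅ U) : W.sub (a.hom ≫ i) (b.hom ≫ j) :=
  hW.sub_baseChange (f := 𝟙 Y) (p := a.hom) (q := b.hom) h
    (IsPullback.of_horiz_isIso ⟨by simp⟩) (IsPullback.of_horiz_isIso ⟨by simp⟩)

/-- The complement of an isomorphism is initial. -/
lemma iso_O_of_sub_isIso (hW : W.IsSubtractive) {X Y U : C} {i : X ⟶ Y} {j : U ⟶ Y} [IsIso i]
    (h : W.sub i j) : Nonempty (U ≅ W.O) := by
  obtain ⟨I⟩ := hW.initial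
  have h' := sub_iso hW h (asIso i).symm (Iso.refl U)
  simp only [Iso.symm_hom, asIso_inv, IsIso.inv_hom_id, Iso.refl_hom, Category.id_comp] at h'
  obtain ⟨e, -⟩ := hW.sub_unique h' (hW.sub_id (I.to Y))
  exact ⟨e⟩

/-- If the closed part is initial, then the open part is everything. -/
lemma isIso_of_sub_initial (hW : W.IsSubtractive) {X Y U : C} {i : X ⟶ Y} {j : U ⟶ Y}
    (h : W.sub i j) (e : X ≅ W.O) : IsIso j := by
  have h' := sub_iso hW h e.symm (Iso.refl U)
  simp only [Iso.refl_hom, Category.id_comp] at h'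
  obtain ⟨e, he, -⟩ := hW.sub_unique h' (hW.sub_initial _)
  have : j = e.hom := by simpa using he.symm
  rw [this]; infer_instance

/-- If the open part is initial, then the closed part is everything. -/
lemma isIso_of_sub_initial' (hW : W.IsSubtractive) {X Y U : C} {i : X ⟶ Y} {j : U ⟶ Y}
    (h : W.sub i j) (e : U ≅ W.O) : IsIso i := by
  have h' := sub_iso hW h (Iso.refl X) e.symm
  simp only [Iso.refl_hom, Category.id_comp] at h'
  obtain ⟨e, he, -⟩ := hW.sub_unique' h' (hW.sub_id _)
  have : i = e.hom := by simpa using he.symm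
  rw [this]; infer_instance

/-- The initial object is strict. -/
lemma iso_O_of_hom (hW : W.IsSubtractive) {R : C} (f : R ⟶ W.O) : Nonempty (R ≅ W.O) := by
  obtain ⟨I⟩ := hW.initial
  have h0 : W.sub (𝟙 W.O) (𝟙 W.O) := hW.sub_id _
  have h : W.sub (𝟙 R) (𝟙 R) := hW.sub_baseChange h0
    (IsPullback.of_vert_isIso (f := 𝟙 _) (fst := f) (snd := 𝟙 R) (g := f) ⟨by simp⟩)
    (IsPullback.of_vert_isIso (f := 𝟙 _) (fst := f) (snd := 𝟙 R) (g := f) ⟨by simp⟩)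
  exact iso_O_of_sub_isIso hW h

/-- The two parts of a subtraction sequence are disjoint. -/
lemma disjoint_of_sub (hW : W.IsSubtractive) (hm : W.MonoCof) {X Y U P : C} {i : X ⟶ Y}
    {j : U ⟶ Y} (h : W.sub i j) {p : P ⟶ X} {q : P ⟶ U} (hc : p ≫ i = q ≫ j) :
    Nonempty (P ≅ W.O) := by
  have := hm i (hW.sub_cof h)
  have := hW.fib_hasPullback j i (hW.sub_fib h)
  have h1 : W.sub (𝟙 X) (pullback.fst i j) := hW.sub_baseChange h
    (IsKernelPair.id_of_mono i) (IsPullback.of_hasPullback i j).flip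
  obtain ⟨e⟩ := iso_O_of_sub_isIso hW h1
  exact iso_O_of_hom hW (pullback.lift p q hc ≫ e.hom)

lemma mono_of_sub (hW : W.IsSubtractive) (hm : W.MonoCof) {X Y U : C} {i : X ⟶ Y}
    {j : U ⟶ Y} (h : W.sub i j) : Mono j := by
  have := hW.fib_hasPullback j j (hW.sub_fib h)
  have := hW.cof_hasPullback i j (hW.sub_cof h)
  have h1 : W.sub (pullback.fst j i) (pullback.fst j j) := hW.sub_baseChange h
    (IsPullback.of_hasPullback j i).flip (IsPullback.of_hasPullback j j).flip
  obtain ⟨e⟩ := disjoint_of_sub hW hm h (pullback.condition (f := j) (g := i)).symm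
  have h2 : IsIso (pullback.fst j j) := isIso_of_sub_initial hW h1 e
  have h3 : pullback.fst j j = pullback.snd j j := by
    have : pullback.diagonal j ≫ pullback.fst j j = 𝟙 U := pullback.diagonal_fst j
    have h4 : pullback.diagonal j = inv (pullback.fst j j) := by
      rw [← cancel_mono (pullback.fst j j), this, IsIso.inv_hom_id]
    have h5 : pullback.diagonal j ≫ pullback.snd j j = 𝟙 U := pullback.diagonal_snd j
    rw [h4, IsIso.inv_comp_eq, Category.comp_id] at h5
    exact h5.symm
  refine ⟨fun a b hab => ?_⟩
  rw [← pullback.lift_fst a b hab, h3, pullback.lift_snd]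

/-- In a distinguished square the map `A ⟶ B ×_{B'} A'` is even an isomorphism. -/
lemma Dist.isPullback (hW : W.IsSubtractive) (hm : W.MonoCof) {A B A' B' : C} {f : A ⟶ B}
    {f' : A' ⟶ B'} {g : A ⟶ A'} {g' : B ⟶ B'} (h : W.Dist f f' g g') :
    IsPullback f g g' f' := by
  obtain ⟨w, ⟨P, p, q, hP, -⟩, U, U', j, j', c, hj, hj', hc, -⟩ := h
  have := hm f (hW.sub_cof hj)
  have hp : W.cof p := hW.cof_baseChange.of_isPullback hP.flip (hW.sub_cof hj')
  have := hm p hp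
  set a := hP.lift f g w with ha
  have hap : a ≫ p = f := hP.lift_fst _ _ _
  have := hW.fib_hasPullback j p (hW.sub_fib hj)
  -- the complement of `a`
  have hsub : W.sub a (pullback.fst p j) := by
    refine hW.sub_baseChange (p := 𝟙 A) (f := p) hj ?_ (IsPullback.of_hasPullback p j).flip
    refine IsPullback.of_isLimit' ⟨by simp [hap]⟩ (PullbackCone.IsLimit.mk _
      (fun s => s.fst) (fun s => by simp) (fun s => ?_) (fun s m h1 _ => by simpa using h1))
    rw [← cancel_mono p, Category.assoc, hap]
    exact s.condition
  have hd : pullback.fst p j ≫ p ≫ g' = pullback.snd p j ≫ c ≫ j' := by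
    rw [hc, ← Category.assoc, pullback.condition, Category.assoc]
  obtain ⟨e⟩ := disjoint_of_sub hW hm hj' (p := pullback.fst p j ≫ q)
    (q := pullback.snd p j ≫ c) (by rw [Category.assoc, ← hP.w, hd, Category.assoc])
  have : IsIso a := isIso_of_sub_initial' hW hsub e
  exact hP.of_iso (asIso a).symm (Iso.refl _) (Iso.refl _) (Iso.refl _)
    (by simp [hap]) (by simp [ha]) (by simp) (by simp)

/-- In a distinguished square the induced map on complements is a weak equivalence, for any
choice of the complements. -/
lemma Dist.weq_snd (hW : W.IsSW) (hm : W.MonoCof) {A B A' B' : C} {f : A ⟶ B}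
    {f' : A' ⟶ B'} {g : A ⟶ A'} {g' : B ⟶ B'} (h : W.Dist f f' g g') {V K : C} {k : V ⟶ B'}
    {r : K ⟶ B} {s : K ⟶ V} (hk : W.sub f' k) (hK : IsPullback r s g' k) : W.weq s := by
  have hP := h.isPullback hW.toIsSubtractive hm
  obtain ⟨w, -, U, U', j, j', c, hj, hj', hc, hcw⟩ := h
  have hr : W.sub f r := hW.sub_baseChange hk hP.flip hK.flip
  obtain ⟨e, he, -⟩ := hW.sub_unique hr hj
  obtain ⟨e', he', -⟩ := hW.sub_unique hj' hk
  have := mono_of_sub hW.toIsSubtractive hm hk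
  have hs : s = e.hom ≫ c ≫ e'.hom := by
    rw [← cancel_mono k, ← hK.w, ← he]
    simp [he', hc]
  rw [hs]
  exact weq_comp W (weq_of_isIso hW _) (weq_comp W hcw (weq_of_isIso hW _))

lemma Dist.mk' (hW : W.IsSW) {A B A' B' V K : C} {f : A ⟶ B}
    {f' : A' ⟶ B'} {g : A ⟶ A'} {g' : B ⟶ B'} (hP : IsPullback f g g' f') {k : V ⟶ B'}
    {r : K ⟶ B} {s : K ⟶ V} (hk : W.sub f' k) (hK : IsPullback r s g' k) (hs : W.weq s) :
    W.Dist f f' g g' :=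
  ⟨hP.w, ⟨A, f, g, hP, by
    have : hP.lift f g hP.w = 𝟙 A := hP.hom_ext (by simp) (by simp)
    rw [this]; exact weq_of_isIso hW _⟩,
    K, V, r, k, s, hW.sub_baseChange hk hP.flip hK.flip, hk, hK.w.symm, hs⟩

lemma Dist.vcomp (hW : W.IsSW) (hm : W.MonoCof) {A B A' B' A'' B'' : C} {f : A ⟶ B}
    {f' : A' ⟶ B'} {f'' : A'' ⟶ B''} {g : A ⟶ A'} {g' : B ⟶ B'} {h : A' ⟶ A''} {h' : B' ⟶ B''}
    (h₁ : W.Dist f f' g g') (h₂ : W.Dist f' f'' h h') : W.Dist f f'' (g ≫ h) (g' ≫ h') := by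
  have hP₁ := h₁.isPullback hW.toIsSubtractive hm
  have hP₂ := h₂.isPullback hW.toIsSubtractive hm
  obtain ⟨V, k, hk⟩ : ∃ (V : C) (k : V ⟶ B''), W.sub f'' k := by
    obtain ⟨-, -, -, V, -, k, -, -, hk, -⟩ := h₂
    exact ⟨V, k, hk⟩
  have := hW.fib_hasPullback k h' (hW.sub_fib hk)
  have hK₂ := IsPullback.of_hasPullback h' k
  have hk₂ : W.sub f' (pullback.fst h' k) := hW.sub_baseChange hk hP₂.flip hK₂.flip
  have := hW.fib_hasPullback _ g' (hW.sub_fib hk₂)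
  have hK₁ := IsPullback.of_hasPullback g' (pullback.fst h' k)
  exact Dist.mk' hW (hP₁.paste_vert hP₂) hk (hK₁.paste_vert hK₂)
    (weq_comp W (h₁.weq_snd hW hm hk₂ hK₁) (h₂.weq_snd hW hm hk hK₂))

lemma Dist.hcomp (hW : W.IsSW) (hm : W.MonoCof) (hs : W.Star) {A B D A' B' D' : C} {f : A ⟶ B}
    {k : B ⟶ D} {f' : A' ⟶ B'} {k' : B' ⟶ D'} {g : A ⟶ A'} {g' : B ⟶ B'} {g'' : D ⟶ D'}
    (h₁ : W.Dist f f' g g') (h₂ : W.Dist k k' g' g'') :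
    W.Dist (f ≫ k) (f' ≫ k') g g'' := by
  have hS := hW.toIsSubtractive
  have hP₁ := h₁.isPullback hS hm
  have hP₂ := h₂.isPullback hS hm
  obtain ⟨V, v, hv⟩ : ∃ (V : C) (v : V ⟶ B'), W.sub f' v := by
    obtain ⟨-, -, -, V, -, v, -, -, hv, -⟩ := h₁
    exact ⟨V, v, hv⟩
  obtain ⟨T, t, ht⟩ : ∃ (T : C) (t : T ⟶ D'), W.sub k' t := by
    obtain ⟨-, -, -, T, -, t, -, -, ht, -⟩ := h₂
    exact ⟨T, t, ht⟩
  have hk' := hm k' (hW.sub_cof ht)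
  obtain ⟨L, l, hl⟩ := hW.exists_sub (f' ≫ k') (cof_comp W (hW.sub_cof hv) (hW.sub_cof ht))
  have hlm := mono_of_sub hS hm hl
  have htm := mono_of_sub hS hm ht
  have := hW.fib_hasPullback l g'' (hW.sub_fib hl)
  have := hW.fib_hasPullback l k' (hW.sub_fib hl)
  have := hW.fib_hasPullback l t (hW.sub_fib hl)
  have hP : IsPullback (f ≫ k) g g'' (f' ≫ k') := hP₁.paste_horiz hP₂
  have hK := IsPullback.of_hasPullback g'' l
  -- `V' = B' ×_{D'} L` is a complement of `A' ⟶ B'`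
  have hV := IsPullback.of_hasPullback k' l
  have hV' : W.sub f' (pullback.fst k' l) := by
    refine hW.sub_baseChange (p := 𝟙 A') hl ?_ hV.flip
    refine IsPullback.of_isLimit' ⟨by simp⟩ (PullbackCone.IsLimit.mk _
      (fun s => s.fst) (fun s => by simp) (fun s => ?_) (fun s m h1 _ => by simpa using h1))
    rw [← cancel_mono k', Category.assoc]
    exact s.condition
  -- `T' = T ×_{D'} L` is `T`
  have hT := IsPullback.of_hasPullback t l
  have hT' : IsIso (pullback.fst t l) := by
    have := hW.cof_hasPullback (f' ≫ k') t (hW.sub_cof hl)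
    have h0 : W.sub (pullback.fst t (f' ≫ k')) (pullback.fst t l) :=
      hW.sub_baseChange hl (IsPullback.of_hasPullback t (f' ≫ k')).flip hT.flip
    obtain ⟨e⟩ := disjoint_of_sub hS hm ht (p := pullback.snd t (f' ≫ k') ≫ f')
      (q := pullback.fst t (f' ≫ k')) (by rw [pullback.condition, Category.assoc])
    exact isIso_of_sub_initial hS h0 e
  have hsub : W.sub (pullback.snd k' l) (pullback.snd t l) := hW.sub_baseChange ht hV hT
  have ht' : W.sub k' (pullback.snd t l ≫ l) := by
    have := sub_iso hS ht (Iso.refl _) (asIso (pullback.fst t l))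
    simpa [pullback.condition] using this
  refine Dist.mk' hW hP hl hK ?_
  have := hW.cof_hasPullback _ (pullback.snd g'' l) (hW.sub_cof hsub)
  have := hW.fib_hasPullback _ (pullback.snd g'' l) (hW.sub_fib hsub)
  have hX := IsPullback.of_hasPullback (pullback.snd g'' l) (pullback.snd k' l)
  have hY := IsPullback.of_hasPullback (pullback.snd g'' l) (pullback.snd t l)
  refine hs hsub hX.flip hY.flip ?_ ?_
  · -- `X = B ×_{B'} V'`
    have hX' := hX.paste_horiz hK
    rw [← pullback.condition (f := k') (g := l)] at hX'
    exact h₁.weq_snd hW hm hV' (hX'.of_right' hP₂)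
  · exact h₂.weq_snd hW hm ht' (hY.paste_horiz hK)

lemma Dist.vid (hW : W.IsSW) {A B : C} {f : A ⟶ B} (hf : W.cof f) :
    W.Dist f f (𝟙 A) (𝟙 B) := by
  obtain ⟨V, k, hk⟩ := hW.exists_sub f hf
  exact Dist.mk' hW (IsPullback.of_vert_isIso ⟨by simp⟩) hk
    (IsPullback.of_vert_isIso (fst := k) (snd := 𝟙 V) (f := 𝟙 B) (g := k) ⟨by simp⟩)
    (weq_of_isIso hW _)

lemma Dist.hid (hW : W.IsSW) {A B : C} (g : A ⟶ B) : W.Dist (𝟙 A) (𝟙 B) g g := by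
  obtain ⟨I⟩ := hW.initial
  have hP : IsPullback (𝟙 A) g g (𝟙 B) := IsPullback.of_horiz_isIso ⟨by simp⟩
  refine ⟨by simp, ⟨A, 𝟙 A, g, hP, ?_⟩, W.O, W.O, I.to A, I.to B, 𝟙 _, hW.sub_id _,
    hW.sub_id _, I.hom_ext _ _, weq_of_isIso hW _⟩
  have : hP.lift (𝟙 A) g (by simp) = 𝟙 A :=
    (Category.comp_id _).symm.trans (hP.lift_fst (𝟙 A) g (by simp))
  rw [this]
  exact weq_of_isIso hW _

end

/-- The category of cofibrations. -/
abbrev cofCategory (W : SWData C) : Category.{v} C where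
  Hom A B := { f : A ⟶ B // W.cof f }
  id A := ⟨𝟙 A, W.cof_mul.id_mem A⟩
  comp f g := ⟨f.1 ≫ g.1, W.cof_mul.comp_mem _ _ f.2 g.2⟩
  id_comp f := Subtype.ext (Category.id_comp f.1)
  comp_id f := Subtype.ext (Category.comp_id f.1)
  assoc f g h := Subtype.ext (Category.assoc f.1 g.1 h.1)

/-- The squares category associated to an SW-category whose cofibrations are monomorphisms and
which satisfies `(*)`: horizontal maps are the cofibrations, vertical maps are all maps. -/
def squares (W : SWData C) (hW : W.IsSW) (hm : W.MonoCof) (hs : W.Star) :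
    SquaresCategory.{v, u} where
  Ob := C
  E := inferInstance
  M := W.cofCategory
  dist f f' g g' := W.Dist f.1 f'.1 g g'
  dist_vcomp h₁ h₂ := Dist.vcomp hW hm h₁ h₂
  dist_hcomp h₁ h₂ := Dist.hcomp hW hm hs h₁ h₂
  dist_vid f := Dist.vid hW f.2
  dist_hid g := Dist.hid hW g
  O := W.O
  initial_M X := by
    obtain ⟨I⟩ := hW.initial
    exact ⟨{ default := ⟨I.to X, hW.sub_cof (hW.sub_initial _)⟩
             uniq := fun f => Subtype.ext (I.hom_ext _ _) }⟩
  initial_E X := by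
    obtain ⟨I⟩ := hW.initial
    exact ⟨{ default := I.to X
             uniq := fun f => I.hom_ext _ _ }⟩

end SWData

/-! ## The `K`-theory of SW-categories -/

/-- The category `Ar~[n]`: the full subcategory of `[n]ᵒᵖ × [n]` on the pairs `(i, j)` with
`i ≤ j`, regarded as a partial order. -/
structure ArTilde (n : ℕ) where
  i : Fin (n + 1)
  j : Fin (n + 1)
  le : i ≤ j

namespace ArTilde

instance (n : ℕ) : Preorder (ArTilde n) where
  le a b := b.i ≤ a.i ∧ a.j ≤ b.j
  le_refl _ := ⟨le_rfl, le_rfl⟩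
  le_trans _ _ _ h h' := ⟨h'.1.trans h.1, h.2.trans h'.2⟩

/-- A morphism `[m] ⟶ [n]` induces a functor `Ar~[m] ⥤ Ar~[n]`. -/
def map {m n : SimplexCategory} (f : m ⟶ n) : ArTilde m.len ⥤ ArTilde n.len :=
  Monotone.functor (f := fun a : ArTilde m.len =>
    (⟨f.toOrderHom a.i, f.toOrderHom a.j, f.toOrderHom.monotone a.le⟩ : ArTilde n.len))
    (fun _ _ h => ⟨f.toOrderHom.monotone h.1, f.toOrderHom.monotone h.2⟩)

/-- The map `(i, j) ⟶ (i, k)` for `i ≤ j ≤ k`. -/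
def right {n : ℕ} {i j k : Fin (n + 1)} (h : i ≤ j) (h' : j ≤ k) :
    (⟨i, j, h⟩ : ArTilde n) ⟶ ⟨i, k, h.trans h'⟩ :=
  homOfLE ⟨le_rfl, h'⟩

/-- The map `(j, k) ⟶ (i, k)` for `i ≤ j ≤ k`. -/
def left {n : ℕ} {i j k : Fin (n + 1)} (h : i ≤ j) (h' : j ≤ k) :
    (⟨j, k, h'⟩ : ArTilde n) ⟶ ⟨i, k, h.trans h'⟩ :=
  homOfLE ⟨h, le_rfl⟩

end ArTilde

/-- A category with the data of an SW-category. -/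
structure BundledSW where
  C : Type u
  cat : Category.{v} C
  W : SWData C

instance (B : BundledSW.{v, u}) : Category.{v} B.C := B.cat

/-- A functor that preserves subtraction sequences, weak equivalences and the object `O`. -/
structure BundledSW.Hom (B D : BundledSW.{v, u}) where
  fn : B.C ⥤ D.C
  map_sub : ∀ {X Y U : B.C} {i : X ⟶ Y} {j : U ⟶ Y}, B.W.sub i j → D.W.sub (fn.map i) (fn.map j)
  map_weq : ∀ {X Y : B.C} {f : X ⟶ Y}, B.W.weq f → D.W.weq (fn.map f)
  obj_O : fn.obj B.W.O = D.W.O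

instance : Category BundledSW.{v, u} where
  Hom := BundledSW.Hom
  id B := ⟨𝟭 B.C, fun h => h, fun h => h, rfl⟩
  comp F G := ⟨F.fn ⋙ G.fn, fun h => G.map_sub (F.map_sub h), fun h => G.map_weq (F.map_weq h), by
    rw [← G.obj_O, ← F.obj_O]; rfl⟩

/-- The objects of `S~_n`: functors `X : Ar~[n] ⥤ C` with `X_{i,i} = ∅` such that
`X_{i,j} ⟶ X_{i,k} ⟵ X_{j,k}` is a subtraction sequence for all `i ≤ j ≤ k`. -/
structure STilde (B : BundledSW.{v, u}) (n : ℕ) where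
  fn : ArTilde n ⥤ B.C
  diag : ∀ i : Fin (n + 1), Nonempty (fn.obj ⟨i, i, le_rfl⟩ ≅ B.W.O)
  sub : ∀ {i j k : Fin (n + 1)} (h : i ≤ j) (h' : j ≤ k),
    B.W.sub (fn.map (ArTilde.right h h')) (fn.map (ArTilde.left h h'))

/-- The morphisms of `wS~_n`: natural transformations all of whose components are weak
equivalences. -/
@[ext]
structure STilde.Hom {B : BundledSW.{v, u}} {n : ℕ} (X Y : STilde B n) where
  nat : X.fn ⟶ Y.fn
  weq : ∀ a : ArTilde n, B.W.weq (nat.app a)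

/-- The category `wS~_n`. -/
instance (B : BundledSW.{v, u}) (n : ℕ) : Category.{v} (STilde B n) where
  Hom X Y := STilde.Hom X Y
  id X := ⟨𝟙 X.fn, fun _ => B.W.weq_mul.id_mem _⟩
  comp f g := ⟨f.nat ≫ g.nat, fun a => B.W.weq_mul.comp_mem _ _ (f.weq a) (g.weq a)⟩

/-- The simplicial category `wS~_•`. -/
def simplicialS (B : BundledSW.{v, u}) : SimplexCategoryᵒᵖ ⥤ Cat.{v, max u v} where
  obj n := Cat.of (STilde B n.unop.len)
  map {m n} f := Functor.toCatHom
    { obj := fun X => (⟨ArTilde.map f.unop ⋙ X.fn, fun i => X.diag _, fun h h' =>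
        X.sub (f.unop.toOrderHom.monotone h) (f.unop.toOrderHom.monotone h')⟩ :
          STilde B n.unop.len)
      map := fun α => ⟨Functor.whiskerLeft (ArTilde.map f.unop) (STilde.Hom.nat α),
        fun a => STilde.Hom.weq α _⟩ }
  map_id _ := rfl
  map_comp _ _ := rfl

/-- The action of a functor on `wS~_n`. -/
def STilde.postcomp {B D : BundledSW.{v, u}} (F : B ⟶ D) (n : ℕ) : STilde B n ⥤ STilde D n where
  obj X := ⟨X.fn ⋙ BundledSW.Hom.fn F, fun i => by
    obtain ⟨e⟩ := X.diag i
    exact ⟨(BundledSW.Hom.fn F).mapIso e ≪≫ eqToIso (BundledSW.Hom.obj_O F)⟩,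
    fun h h' => BundledSW.Hom.map_sub F (X.sub h h')⟩
  map α := ⟨Functor.whiskerRight (STilde.Hom.nat α) (BundledSW.Hom.fn F),
    fun a => BundledSW.Hom.map_weq F (STilde.Hom.weq α a)⟩
  map_id X := by
    have h : Functor.whiskerRight (𝟙 X.fn) (BundledSW.Hom.fn F) =
      𝟙 (X.fn ⋙ BundledSW.Hom.fn F) := by simp
    exact STilde.Hom.ext h
  map_comp α β := STilde.Hom.ext
    (Functor.whiskerRight_comp (STilde.Hom.nat α) (STilde.Hom.nat β) (BundledSW.Hom.fn F))

/-- The basepoint of `wS~_0`. -/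
def STilde.base (B : BundledSW.{v, u}) : STilde B 0 :=
  ⟨(Functor.const _).obj B.W.O, fun _ => ⟨Iso.refl _⟩, fun _ _ => B.W.sub_O⟩

/-- `|N_• wS~_•|` as a simplicial set, pointed at `∅`. -/
def pointedS : BundledSW.{v, u} ⥤ PointedSSet.{max u v} where
  obj B :=
    { X := diagNerve.obj (simplicialS B)
      pt := ComposableArrows.mk₀ (STilde.base B) }
  map {B D} F :=
    { map := diagNerve.map
        { app := fun n => (STilde.postcomp F n.unop.len).toCatHom
          naturality := fun _ _ _ => rfl }
      map_pt := by
        refine ComposableArrows.ext₀ ?_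
        have h : (Functor.const (ArTilde 0)).obj B.W.O ⋙ BundledSW.Hom.fn F
            = (Functor.const (ArTilde 0)).obj D.W.O := by
          rw [← BundledSW.Hom.obj_O F]
          exact CategoryTheory.Functor.ext (fun _ => rfl)
            (fun _ _ _ => by simp)
        have h' : ∀ X Y : STilde D 0, X.fn = Y.fn → X = Y := by
          rintro ⟨_, _, _⟩ ⟨_, _, _⟩ rfl
          rfl
        exact h' ((STilde.postcomp F 0).obj (STilde.base B)) (STilde.base D) h }
  map_id B := rfl
  map_comp F G := rfl

/-- The `K`-theory space `Ω |N_• wS~_• C|` of an SW-category. -/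
def swK : BundledSW.{v, u} ⥤ TopCat.{max u v} :=
  pointedS ⋙ loopRealization

/-- The `K`-theory space of the SW-category given by `W`. -/
def SWData.K {C : Type u} [Category.{v} C] (W : SWData C) : TopCat.{max u v} :=
  swK.obj ⟨C, inferInstance, W⟩

/-! ## Infinite loop space structures

Following Segal, the infinite loop space structures given by coproducts are encoded by
`Γ`-spaces, i.e. functors on the category of finite pointed sets. The latter is described as
the category of finite sets and partial functions. -/

/-- The category of finite sets and partial functions (equivalently: finite pointed sets). -/
abbrev FinPart := ObjectProperty.FullSubcategory (fun X : PartialFun.{0} => Finite X)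

/-- An operation on subsets that preserves the empty set and disjoint unions. -/
@[ext]
structure SetMap (S T : Type) where
  fn : Set T → Set S
  mono : Monotone fn
  empty : fn ∅ = ∅
  union : ∀ U V : Set T, fn (U ∪ V) = fn U ∪ fn V
  disjoint : ∀ {U V : Set T}, Disjoint U V → Disjoint (fn U) (fn V)

/-- Preimages under a partial function. -/
def SetMap.ofPFun {S T : Type} (φ : S →. T) : SetMap S T where
  fn := φ.preimage
  mono _ _ h := φ.preimage_mono h
  empty := by ext x; simp [PFun.mem_preimage]
  union U V := φ.preimage_union U V
  disjoint {U V} h := by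
    rw [Set.disjoint_left] at h ⊢
    rintro x ⟨y, hy, hxy⟩ ⟨z, hz, hxz⟩
    exact h hy (Part.mem_unique hxz hxy ▸ hz)

/-- The identity operation. -/
def SetMap.id (S : Type) : SetMap S S :=
  ⟨fun U => U, fun _ _ h => h, rfl, fun _ _ => rfl, fun h => h⟩

lemma SetMap.preimage_id (S : Type) (U : Set S) : (PFun.id S).preimage U = U := by
  ext x
  simp [PFun.mem_preimage]

/-- Composition of operations. -/
def SetMap.comp {S T R : Type} (m : SetMap S T) (m' : SetMap T R) : SetMap S R :=
  ⟨fun U => m.fn (m'.fn U), fun _ _ h => m.mono (m'.mono h), by rw [m'.empty, m.empty],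
    fun U V => by rw [m'.union, m.union], fun h => m.disjoint (m'.disjoint h)⟩

/-- A sum diagram: objects `A(U)` for all `U ⊆ S`, functorial for inclusions, such that
`A(∅)` is initial and `A(U ∪ V)` is the coproduct of `A(U)` and `A(V)` for disjoint `U`, `V`. -/
structure SumDiag (C : Type u) [Category.{v} C] (S : Type) where
  fn : Set S ⥤ C
  empty : ∀ {U : Set S}, U = ∅ → Nonempty (IsInitial (fn.obj U))
  sum : ∀ {U V X : Set S} (hU : U ≤ X) (hV : V ≤ X), Disjoint U V → U ∪ V = X →
    Nonempty (IsColimit (BinaryCofan.mk (fn.map (homOfLE hU)) (fn.map (homOfLE hV))))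

namespace SumDiag

variable {C : Type u} [Category.{v} C]

instance (S : Type) : Category.{v} (SumDiag C S) where
  Hom A B := A.fn ⟶ B.fn
  id A := 𝟙 A.fn
  comp f g := NatTrans.vcomp f g

/-- The component of a morphism of sum diagrams. -/
def app {S : Type} {A B : SumDiag C S} (f : A ⟶ B) (U : Set S) : A.fn.obj U ⟶ B.fn.obj U :=
  NatTrans.app f U

/-- Reindexing of sum diagrams. -/
def pull {S T : Type} (m : SetMap S T) : SumDiag C S ⥤ SumDiag C T where
  obj A := ⟨m.mono.functor ⋙ A.fn, fun h => A.empty (h ▸ m.empty),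
    fun hU hV h h' => A.sum (m.mono hU) (m.mono hV) (m.disjoint h) (h' ▸ (m.union _ _).symm)⟩
  map f := Functor.whiskerLeft m.mono.functor f

/-- The constant sum diagram on an initial object. -/
def const (S : Type) (X : C) (hX : Nonempty (IsInitial X)) : SumDiag C S where
  fn := (Functor.const _).obj X
  empty _ := hX
  sum _ _ _ _ := by
    obtain ⟨I⟩ := hX
    exact ⟨BinaryCofan.isColimitMk (fun s => I.to s.pt) (fun _ => I.hom_ext _ _)
      (fun _ => I.hom_ext _ _) (fun _ _ _ _ => I.hom_ext _ _)⟩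

end SumDiag

namespace SWData

variable {C : Type u} [Category.{v} C]

/-- The category of sum diagrams, with the pointwise structure of an SW-category. -/
def sums (W : SWData C) (hO : Nonempty (IsInitial W.O)) (S : Type) :
    BundledSW.{v, max u v} where
  C := SumDiag C S
  cat := inferInstance
  W :=
    { cof := fun _ _ f => ∀ U, W.cof (SumDiag.app f U)
      fib := fun _ _ f => ∀ U, W.fib (SumDiag.app f U)
      weq := fun _ _ f => ∀ U, W.weq (SumDiag.app f U)
      cof_mul :=
        { id_mem := fun _ _ => W.cof_mul.id_mem _
          comp_mem := fun _ _ h h' U => W.cof_mul.comp_mem _ _ (h U) (h' U) }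
      fib_mul :=
        { id_mem := fun _ _ => W.fib_mul.id_mem _
          comp_mem := fun _ _ h h' U => W.fib_mul.comp_mem _ _ (h U) (h' U) }
      weq_mul :=
        { id_mem := fun _ _ => W.weq_mul.id_mem _
          comp_mem := fun _ _ h h' U => W.weq_mul.comp_mem _ _ (h U) (h' U) }
      sub := fun i j => ∀ U, W.sub (SumDiag.app i U) (SumDiag.app j U)
      O := SumDiag.const S W.O hO
      sub_O := fun _ => W.sub_O }

/-- Reindexing, as a functor that preserves the pointwise structures. -/
def sumsMap (W : SWData C) (hO : Nonempty (IsInitial W.O)) {S T : Type} (m : SetMap S T) :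
    W.sums hO S ⟶ W.sums hO T where
  fn := SumDiag.pull m
  map_sub h U := h (m.fn U)
  map_weq h U := h (m.fn U)
  obj_O := rfl

/-- The `Γ`-space of the `K`-theory of an SW-category, given by coproducts. -/
def swKGamma (W : SWData C) (hO : Nonempty (IsInitial W.O)) : FinPart ⥤ TopCat.{max u v} :=
  Functor.comp
    { obj := fun S => W.sums hO S.obj
      map := fun φ => W.sumsMap hO (SetMap.ofPFun φ.hom)
      map_id := fun S => by
        have h : SetMap.ofPFun (𝟙 S : S ⟶ S).hom = SetMap.id S.obj :=
          SetMap.ext (funext fun U => SetMap.preimage_id S.obj U)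
        rw [h]
        rfl
      map_comp := fun {S T R} φ ψ => by
        have h : SetMap.ofPFun (φ ≫ ψ).hom =
            (SetMap.ofPFun φ.hom).comp (SetMap.ofPFun ψ.hom) :=
          SetMap.ext (funext fun U => PFun.preimage_comp _ _ U)
        rw [h]
        rfl }
    swK

/-- The squares category of sum diagrams, with horizontal maps and distinguished squares defined
pointwise in the associated squares category. -/
def sumSquares (W : SWData C) (hW : W.IsSW) (hm : W.MonoCof) (hs : W.Star) (S : Type) :
    SquaresCategory.{v, max u v} where
  Ob := SumDiag C S
  E := inferInstance
  M := (W.sums hW.initial S).W.cofCategory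
  dist f f' g g' := ∀ U, W.Dist (SumDiag.app f.1 U) (SumDiag.app f'.1 U) (SumDiag.app g U)
    (SumDiag.app g' U)
  dist_vcomp h₁ h₂ U := Dist.vcomp hW hm (h₁ U) (h₂ U)
  dist_hcomp h₁ h₂ U := Dist.hcomp hW hm hs (h₁ U) (h₂ U)
  dist_vid f U := Dist.vid hW (f.2 U)
  dist_hid g U := Dist.hid hW (SumDiag.app g U)
  O := SumDiag.const S W.O hW.initial
  initial_M A := by
    obtain ⟨I⟩ := hW.initial
    exact ⟨{ default := ⟨{ app := fun U => I.to (A.fn.obj U)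
                           naturality := fun _ _ _ => I.hom_ext _ _ },
               fun U => hW.sub_cof (hW.sub_initial _)⟩
             uniq := fun f => Subtype.ext (NatTrans.ext (funext fun U => I.hom_ext _ _)) }⟩
  initial_E A := by
    obtain ⟨I⟩ := hW.initial
    exact ⟨{ default :=
               { app := fun U => I.to (A.fn.obj U)
                 naturality := fun _ _ _ => I.hom_ext _ _ }
             uniq := fun f => NatTrans.ext (funext fun U => I.hom_ext _ _) }⟩

/-- Reindexing, as a functor of squares categories. -/
def sumSquaresMap (W : SWData C) (hW : W.IsSW) (hm : W.MonoCof) (hs : W.Star) {S T : Type}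
    (m : SetMap S T) : W.sumSquares hW hm hs S ⟶ W.sumSquares hW hm hs T where
  obj A := (SumDiag.pull m).obj A
  mapE f := (SumDiag.pull m).map f
  mapM f := ⟨(SumDiag.pull m).map f.1, fun U => f.2 (m.fn U)⟩
  mapE_id _ := rfl
  mapM_id _ := rfl
  mapE_comp _ _ := rfl
  mapM_comp _ _ := rfl
  map_dist h U := h (m.fn U)
  obj_O := rfl

/-- The `Γ`-space of the `K`-theory of the associated squares category, given by coproducts. -/
def squaresKGamma (W : SWData C) (hW : W.IsSW) (hm : W.MonoCof) (hs : W.Star) :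
    FinPart ⥤ TopCat.{max u v} :=
  Functor.comp
    { obj := fun S => W.sumSquares hW hm hs S.obj
      map := fun φ => W.sumSquaresMap hW hm hs (SetMap.ofPFun φ.hom)
      map_id := fun S => by
        have h : SetMap.ofPFun (𝟙 S : S ⟶ S).hom = SetMap.id S.obj :=
          SetMap.ext (funext fun U => SetMap.preimage_id S.obj U)
        rw [h]
        rfl
      map_comp := fun {S T R} φ ψ => by
        have h : SetMap.ofPFun (φ ≫ ψ).hom =
            (SetMap.ofPFun φ.hom).comp (SetMap.ofPFun ψ.hom) :=
          SetMap.ext (funext fun U => PFun.preimage_comp _ _ U)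
        rw [h]
        rfl }
    squaresK

/-- Coproducts of subtraction sequences are subtraction sequences. -/
def SumsSubtractive (W : SWData C) : Prop :=
  ∀ {X₁ X₂ X Y₁ Y₂ Y U₁ U₂ U : C} {x₁ : X₁ ⟶ X} {x₂ : X₂ ⟶ X} {y₁ : Y₁ ⟶ Y} {y₂ : Y₂ ⟶ Y}
    {u₁ : U₁ ⟶ U} {u₂ : U₂ ⟶ U} {i₁ : X₁ ⟶ Y₁} {i₂ : X₂ ⟶ Y₂} {i : X ⟶ Y} {j₁ : U₁ ⟶ Y₁}
    {j₂ : U₂ ⟶ Y₂} {j : U ⟶ Y},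
    Nonempty (IsColimit (BinaryCofan.mk x₁ x₂)) → Nonempty (IsColimit (BinaryCofan.mk y₁ y₂)) →
    Nonempty (IsColimit (BinaryCofan.mk u₁ u₂)) → i₁ ≫ y₁ = x₁ ≫ i → i₂ ≫ y₂ = x₂ ≫ i →
    j₁ ≫ y₁ = u₁ ≫ j → j₂ ≫ y₂ = u₂ ≫ j → W.sub i₁ j₁ → W.sub i₂ j₂ → W.sub i j

end SWData

/-- Equivalence of `Γ`-spaces: a zigzag of natural transformations all of whose components are
homotopy equivalences. -/
def GammaEquiv (F G : FinPart ⥤ TopCat.{u}) : Prop :=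
  Relation.EqvGen (fun F G : FinPart ⥤ TopCat.{u} => ∃ α : F ⟶ G, ∀ S : FinPart,
    ∃ e : F.obj S ≃ₕ G.obj S, e.toFun = (α.app S).hom) F G

end SquaresK

end

/-! A chain A_0 ↪ … ↪ A_n determines its complements A_j ∖ A_i, which form an object of S~_n. A
distinguished square induces a weak equivalence on complements, so this defines a map of simplicial
categories T_• → wS~_•, namely `complTrans`. Since S~_n forgets A_0, an inverse is not sought level
by level. It exists up to homotopy after edgewise subdivision: (sd Y)_k = Y_{2k+1}, with [2k+1] read
as [k]ᵒᵖ * [k], lo a = k - a and hi a = k + 1 + a.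

A (2k+1)-simplex X_0 → … → X_{2k+1} of the diagonal nerve of wS~_• gives a grid with entry (X_{hi
a})_{lo a, hi i} in row a and column i. Along a row the right endpoint grows, through cofibrations.
Between rows one passes to a later X and then decreases the left endpoint. The complement of column
i in column j is (X_{hi a})_{hi i, hi j}, which does not involve lo a, so the squares are
distinguished. This is `windowSSet`, a map sd S~ → T.

Followed by complements, it is homotopic to the last vertex map of S~ by comparing (X_{hi a})_{hi i,
hi j} with the chosen complement (`unitHomotopy`). Preceded by complements, it is homotopic to the
last vertex map of T by the inclusions A_{hi i} ∖ A_{lo a} → A_{hi i} (`counitHomotopy`). Last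
vertex maps realize to homotopy equivalences (`isHEquiv_lastVertex`), so two-out-of-six for |sd T| →
|sd S~| → |T| → |S~| gives `isHEquiv_complTrans`, and loop spaces follow by `IsHEquiv.loopMap`.

The facts on realizations rest on one description: points of the realized nerve of a finite poset
are the probability distributions supported on chains (`chainsHomeo`). For [n] × [1] such a
distribution is a monotone coupling of its marginals, which triangulates prisms and realizes
simplicial homotopies. For the poset of intervals in [n] it is determined by the mean of its two
endpoint distributions, which identifies |sd Y| with |Y|.

The comparison uses only the properties collected in `ComplementModel`. Sum diagrams have them too:
complements are taken pointwise, and `SumsSubtractive` makes the result a sum diagram. Pointwise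
choices render the comparison strictly natural in the finite set, so a single natural transformation
relates the two Γ-spaces. -/

noncomputable section
namespace SquaresK

/-! ## Homotopy equivalences and loop spaces -/

section HomotopyEquivalences

open ContinuousMap

variable {X Y Z T : Type*} [TopologicalSpace X] [TopologicalSpace Y] [TopologicalSpace Z]
  [TopologicalSpace T]

/-- A continuous map that is a homotopy equivalence. -/
def IsHEquiv (f : C(X, Y)) : Prop := ∃ e : X ≃ₕ Y, e.toFun = f

/-- Left and right inverses up to homotopy agree: g' ≃ (g f) g' = g (f g') ≃ g. -/
lemma IsHEquiv.of_inverses {f : C(X, Y)} {g g' : C(Y, X)} (h : (g.comp f).Homotopic (.id X))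
    (h' : (f.comp g').Homotopic (.id Y)) : IsHEquiv f := by
  refine ⟨⟨f, g', ?_, h'⟩, rfl⟩
  have h₁ : ((g.comp f).comp g').Homotopic ((ContinuousMap.id X).comp g') :=
    h.comp (Homotopic.refl g')
  have h₂ : (g.comp (f.comp g')).Homotopic (g.comp (.id Y)) := (Homotopic.refl g).comp h'
  have h₃ : g'.Homotopic g := by
    have := h₁.symm.trans h₂
    simpa using this
  exact (h₃.comp (Homotopic.refl f)).trans h

lemma IsHEquiv.exists_inverse {f : C(X, Y)} (h : IsHEquiv f) :
    ∃ g : C(Y, X), (g.comp f).Homotopic (.id X) ∧ (f.comp g).Homotopic (.id Y) := by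
  obtain ⟨e, rfl⟩ := h
  exact ⟨e.invFun, e.left_inv, e.right_inv⟩

lemma IsHEquiv.of_homotopic {f f' : C(X, Y)} (h : IsHEquiv f) (hf : f.Homotopic f') :
    IsHEquiv f' := by
  obtain ⟨g, h₁, h₂⟩ := h.exists_inverse
  exact .of_inverses (((Homotopic.refl g).comp hf.symm).trans h₁)
    ((hf.symm.comp (Homotopic.refl g)).trans h₂)

lemma isHEquiv_homeomorph (e : X ≃ₜ Y) : IsHEquiv (e : C(X, Y)) :=
  ⟨e.toHomotopyEquiv, rfl⟩

lemma IsHEquiv.of_comp_left {f : C(X, Y)} {g : C(Y, Z)} (hg : IsHEquiv g)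
    (hgf : IsHEquiv (g.comp f)) : IsHEquiv f := by
  obtain ⟨a, ha, ha'⟩ := hgf.exists_inverse
  obtain ⟨b, hb, hb'⟩ := hg.exists_inverse
  refine .of_inverses (g := a.comp g) (g' := a.comp g) ha ?_
  have h₁ : ((b.comp g).comp (f.comp (a.comp g))).Homotopic (f.comp (a.comp g)) :=
    hb.comp (Homotopic.refl _)
  have h₂ : (b.comp (((g.comp f).comp a).comp g)).Homotopic (b.comp g) :=
    (Homotopic.refl b).comp (ha'.comp (Homotopic.refl g))
  exact (h₁.symm.trans h₂).trans hb

lemma IsHEquiv.of_comp_right {f : C(X, Y)} {g : C(Y, Z)} (hf : IsHEquiv f)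
    (hgf : IsHEquiv (g.comp f)) : IsHEquiv g := by
  obtain ⟨a, ha, ha'⟩ := hgf.exists_inverse
  obtain ⟨b, hb, hb'⟩ := hf.exists_inverse
  refine .of_inverses (g := f.comp a) (g' := f.comp a) ?_ ha'
  have h₁ : ((f.comp (a.comp g)).comp (f.comp b)).Homotopic (f.comp (a.comp g)) :=
    (Homotopic.refl _).comp hb'
  have h₂ : ((f.comp (a.comp (g.comp f))).comp b).Homotopic (f.comp b) :=
    Homotopic.comp ((Homotopic.refl f).comp ha) (Homotopic.refl b)
  exact (h₁.symm.trans h₂).trans hb'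

/-- The two-out-of-six property. -/
lemma IsHEquiv.two_of_six {f : C(X, Y)} {g : C(Y, Z)} {h : C(Z, T)} (hgf : IsHEquiv (g.comp f))
    (hhg : IsHEquiv (h.comp g)) : IsHEquiv g := by
  obtain ⟨a, ha, ha'⟩ := hgf.exists_inverse
  obtain ⟨b, hb, hb'⟩ := hhg.exists_inverse
  exact .of_inverses (g := b.comp h) (g' := f.comp a) hb ha'

end HomotopyEquivalences

section Loops

open unitInterval ContinuousMap

variable {X Y Z : Type*} [TopologicalSpace X] [TopologicalSpace Y] [TopologicalSpace Z]

/-- The map on loop spaces induced by a continuous map. -/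
def loopMap (f : C(X, Y)) (x : X) : C(Path x x, Path (f x) (f x)) where
  toFun p := p.map f.continuous
  continuous_toFun := by
    rw [Path.continuous_uncurry_iff.symm]
    exact f.continuous.comp continuous_eval

/-- Conjugation of loops by a path. -/
def conjLoop {x y : X} (γ : Path x y) : C(Path y y, Path x x) where
  toFun p := (γ.trans p).trans γ.symm
  continuous_toFun :=
    (continuous_const.path_trans continuous_id).path_trans continuous_const

/-- The two constant pieces are shrunk one after the other, first the final and then the initial
one. -/
lemma conjLoop_refl_homotopic (x : X) : (conjLoop (Path.refl x)).Homotopic (.id _) := by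
  have h₁ : (conjLoop (Path.refl x)).Homotopic
      ⟨fun p : Path x x => (Path.refl x).trans p, continuous_const.path_trans continuous_id⟩ :=
    ⟨{ toFun := fun z => Path.delayReflRight z.1 ((Path.refl x).trans z.2)
       continuous_toFun := Path.continuous_delayReflRight.comp
        (continuous_fst.prodMk (continuous_const.path_trans continuous_snd))
       map_zero_left := fun p => Path.delayReflRight_zero _
       map_one_left := fun p => Path.delayReflRight_one _ }⟩
  exact h₁.trans
    ⟨{ toFun := fun z => Path.delayReflLeft z.1 z.2
       continuous_toFun := Path.continuous_delayReflLeft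
       map_zero_left := fun p => Path.delayReflLeft_zero _
       map_one_left := fun p => Path.delayReflLeft_one _ }⟩

/-- A family of loops whose base point moves along a path is homotopic to the conjugate. -/
lemma homotopic_conjLoop {x y : X} (γ : Path x y) (q : ∀ s : I, Z → Path (γ s) (γ s))
    (hq : Continuous fun z : (I × Z) × I => q z.1.1 z.1.2 z.2)
    (a : C(Z, Path x x)) (b : C(Z, Path y y)) (ha : ∀ z t, a z t = q 0 z t)
    (hb : ∀ z t, b z t = q 1 z t) : a.Homotopic ((conjLoop γ).comp b) := by
  -- δ s follows γ from x to γ s. At time s the homotopy goes out along δ s, around q s and back, so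
  -- every stage is based at x. At s = 0 it is conjugation by a constant path, which the preceding
  -- lemma removes.
  let δ : ∀ s : I, Path x (γ s) := fun s =>
    { toFun := fun t => γ (s * t)
      continuous_toFun := by fun_prop
      source' := by simp
      target' := by simp }
  have hδ : Continuous fun z : (I × Z) × I => δ z.1.1 z.2 := by
    change Continuous fun z : (I × Z) × I => γ (z.1.1 * z.2)
    fun_prop
  refine (Homotopic.comp (conjLoop_refl_homotopic x).symm (Homotopic.refl a)).trans ?_
  refine ⟨{ toFun := fun z => ((δ z.1).trans (q z.1 z.2)).trans (δ z.1).symm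
            continuous_toFun := ?_
            map_zero_left := fun z => ?_
            map_one_left := fun z => ?_ }⟩
  · rw [Path.continuous_uncurry_iff.symm]
    exact Path.trans_continuous_family _ (Path.trans_continuous_family (fun z : I × Z => δ z.1) hδ
      (fun z => q z.1 z.2) hq) _ (Path.symm_continuous_family (fun z : I × Z => δ z.1) hδ)
  · ext t
    have h0 : ∀ t, δ 0 t = x := fun t => by simp [δ]
    simp [conjLoop, Path.trans_apply, h0, ha]
  · ext t
    have h1 : ∀ t, δ 1 t = γ t := fun t => by simp [δ]
    simp [conjLoop, Path.trans_apply, h1, hb]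

/-- Conjugating a loop at x by the reversed initial piece of γ gives loops at γ s, to which
`homotopic_conjLoop` applies. The family starts with conjugation by a constant path and ends with
`conjLoop γ.symm`. -/
lemma conjLoop_comp_symm_homotopic {x y : X} (γ : Path x y) :
    ((conjLoop γ).comp (conjLoop γ.symm)).Homotopic (.id _) := by
  let δ : ∀ s : I, Path (γ s) x := fun s =>
    { toFun := fun t => γ (s * σ t)
      continuous_toFun := by fun_prop
      source' := by simp
      target' := by simp }
  have hδ : Continuous fun z : (I × Path x x) × I => δ z.1.1 z.2 := by
    change Continuous fun z : (I × Path x x) × I => γ (z.1.1 * σ z.2)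
    fun_prop
  have h := homotopic_conjLoop γ (Z := Path x x)
    (fun s p => ((δ s).trans p).trans (δ s).symm) ?_ (conjLoop (Path.refl x)) (conjLoop γ.symm)
    (fun p t => ?_) (fun p t => ?_)
  · exact h.symm.trans (conjLoop_refl_homotopic x)
  · exact Path.trans_continuous_family _ (Path.trans_continuous_family
      (fun z : I × Path x x => δ z.1) hδ (fun z => z.2) (by fun_prop)) _
      (Path.symm_continuous_family (fun z : I × Path x x => δ z.1) hδ)
  · have h0 : ∀ t, δ 0 t = x := fun t => by simp [δ]
    simp [conjLoop, Path.trans_apply, h0]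
  · have h1 : ∀ t, δ 1 t = γ (σ t) := fun t => by simp [δ]
    simp [conjLoop, Path.trans_apply, h1]

lemma isHEquiv_conjLoop {x y : X} (γ : Path x y) : IsHEquiv (conjLoop γ) := by
  refine .of_inverses (g := conjLoop γ.symm) ?_ (conjLoop_comp_symm_homotopic γ)
  simpa using conjLoop_comp_symm_homotopic γ.symm

/-- The homotopy drags the base point along `H.evalAt x`, which accounts for the conjugation. -/
lemma loopMap_homotopic {f g : C(X, Y)} (H : f.Homotopy g) (x : X) :
    (loopMap f x).Homotopic ((conjLoop (H.evalAt x)).comp (loopMap g x)) := by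
  refine homotopic_conjLoop (H.evalAt x)
    (fun s p => p.map (f := fun x' => H (s, x')) (by fun_prop)) ?_ _ _ (fun p t => ?_)
    (fun p t => ?_)
  · change Continuous fun z : (I × Path x x) × I => H (z.1.1, z.1.2 z.2)
    fun_prop
  · exact (H.apply_zero (p t)).symm
  · exact (H.apply_one (p t)).symm

lemma isHEquiv_loopMap_of_homotopic_id {f : C(X, X)} (h : f.Homotopic (.id X)) (x : X) :
    IsHEquiv (loopMap f x) := by
  obtain ⟨H⟩ := h
  exact (isHEquiv_conjLoop (H.evalAt x)).of_homotopic (loopMap_homotopic H x).symm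

/-- A homotopy equivalence induces homotopy equivalences of loop spaces. -/
lemma IsHEquiv.loopMap {f : C(X, Y)} (h : IsHEquiv f) (x : X) :
    IsHEquiv (SquaresK.loopMap f x) := by
  obtain ⟨g, h₁, h₂⟩ := h.exists_inverse
  have h₃ : IsHEquiv ((SquaresK.loopMap g (f x)).comp (SquaresK.loopMap f x)) :=
    isHEquiv_loopMap_of_homotopic_id h₁ x
  have h₄ : IsHEquiv ((SquaresK.loopMap f (g (f x))).comp (SquaresK.loopMap g (f x))) :=
    isHEquiv_loopMap_of_homotopic_id h₂ (f x)
  -- A homotopy inverse need not preserve base points, so Ωf, Ωg, Ωf are taken at x, f x and g (f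
  -- x). Two-out-of-six handles the middle map, and the first follows.
  exact (h₃.two_of_six h₄).of_comp_left h₃

end Loops

/-! ## Points of geometric realizations -/

section Points

variable {X Y : SSet.{u}}

/-- The topological standard simplex. -/
abbrev TSimplex (n : SimplexCategory) : Type := stdSimplex ℝ (Fin (n.len + 1))

/-- The characteristic map of a simplex. -/
def charMap {n : SimplexCategory} (x : X.obj (op n)) : C(TSimplex n, SSet.toTop.obj X) :=
  TopCat.toSSetObjEquiv _ (op n) ((sSetTopAdj.unit.app X).app (op n) x)

lemma toTop_map_charMap (f : X ⟶ Y) {n : SimplexCategory} (x : X.obj (op n)) (t : TSimplex n) :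
    SSet.toTop.map f (charMap x t) = charMap (f.app (op n) x) t := by
  have h := congrArg (fun a => a.app (op n) x) (sSetTopAdj.unit.naturality f)
  exact congrArg (fun a => TopCat.toSSetObjEquiv _ (op n) a t) h.symm

lemma charMap_map {m n : SimplexCategory} (θ : m ⟶ n) (x : X.obj (op n)) (t : TSimplex m) :
    charMap (X.map θ.op x) t = charMap x (stdSimplex.map θ t) := by
  have h := congrArg (fun a => a x) ((sSetTopAdj.unit.app X).naturality θ.op)
  exact congrArg (fun a => TopCat.toSSetObjEquiv _ (op m) a t) h

/-- The continuous map out of a realization that is given by a compatible family of maps on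
topological simplices. -/
def realizationDesc {Z : Type u} [TopologicalSpace Z]
    (g : ∀ (n : SimplexCategory), X.obj (op n) → C(TSimplex n, Z))
    (hg : ∀ {m n : SimplexCategory} (θ : m ⟶ n) (x : X.obj (op n)) (t : TSimplex m),
      g m (X.map θ.op x) t = g n x (stdSimplex.map θ t)) :
    C(SSet.toTop.obj X, Z) :=
  ((sSetTopAdj.homEquiv X (TopCat.of Z)).symm
    { app := fun n => TypeCat.ofHom (fun x => ((TopCat.of Z).toSSetObjEquiv n).symm (g n.unop x))
      naturality := fun n m θ => by
        ext x
        apply ((TopCat.of Z).toSSetObjEquiv m).injective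
        ext t
        exact (Equiv.apply_symm_apply ((TopCat.of Z).toSSetObjEquiv m) _ ▸
          hg θ.unop x t) }).hom

lemma homEquiv_symm_charMap {Z : TopCat.{u}} (f : X ⟶ TopCat.toSSet.obj Z) {n : SimplexCategory}
    (x : X.obj (op n)) (t : TSimplex n) :
    (sSetTopAdj.homEquiv X Z).symm f (charMap x t) =
      TopCat.toSSetObjEquiv _ (op n) (f.app (op n) x) t := by
  obtain ⟨g, rfl⟩ := (sSetTopAdj.homEquiv X Z).surjective f
  rw [Equiv.symm_apply_apply, Adjunction.homEquiv_unit]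
  rfl

lemma realizationDesc_charMap {Z : Type u} [TopologicalSpace Z]
    (g : ∀ (n : SimplexCategory), X.obj (op n) → C(TSimplex n, Z))
    (hg : ∀ {m n : SimplexCategory} (θ : m ⟶ n) (x : X.obj (op n)) (t : TSimplex m),
      g m (X.map θ.op x) t = g n x (stdSimplex.map θ t)) {n : SimplexCategory}
    (x : X.obj (op n)) (t : TSimplex n) :
    realizationDesc g hg (charMap x t) = g n x t := by
  refine (homEquiv_symm_charMap _ x t).trans ?_
  exact congrArg (fun a : C(TSimplex n, Z) => a t)
    (Equiv.apply_symm_apply ((TopCat.of Z).toSSetObjEquiv (op n)) _)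

lemma toTop_hom_ext {Z : TopCat.{u}} {f g : SSet.toTop.obj X ⟶ Z}
    (h : ∀ (n : SimplexCategory) (x : X.obj (op n)) (t : TSimplex n),
      f (charMap x t) = g (charMap x t)) : f = g := by
  apply (sSetTopAdj.homEquiv X Z).injective
  ext n x
  apply (TopCat.toSSetObjEquiv Z n).injective
  ext t
  rw [Adjunction.homEquiv_unit, Adjunction.homEquiv_unit]
  exact h n.unop x t

/-- Maps out of a realization are determined by the characteristic maps. Into the indiscrete space
of propositions, the indicator of the union of their images and the constant `True` are both
continuous, and they agree on every simplex. -/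
lemma charMap_jointly_surjective (z : SSet.toTop.obj X) :
    ∃ (n : SimplexCategory) (x : X.obj (op n)) (t : TSimplex n), charMap x t = z := by
  let : TopologicalSpace (ULift.{u} Prop) := ⊤
  let f : SSet.toTop.obj X ⟶ TopCat.of (ULift.{u} Prop) := TopCat.ofHom
    ⟨fun z => ⟨∃ (n : SimplexCategory) (x : X.obj (op n)) (t : TSimplex n), charMap x t = z⟩,
      continuous_top⟩
  let g : SSet.toTop.obj X ⟶ TopCat.of (ULift.{u} Prop) := TopCat.ofHom
    ⟨fun z => ⟨True⟩, continuous_top⟩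
  have h : f = g := toTop_hom_ext (fun n x t =>
    congrArg ULift.up (eq_true ⟨n, x, t, rfl⟩))
  have h' : f z = g z := by rw [h]
  exact of_eq_true (congrArg ULift.down h')

end Points

/-! ### Barycentric coordinates on nerves of finite partially ordered sets -/

section PosetModels

lemma stdSimplex_map_apply {α β : Type*} [Fintype α] [Fintype β] [DecidableEq β] (f : α → β)
    (t : stdSimplex ℝ α) (b : β) : stdSimplex.map f t b = ∑ a with f a = b, t a := by
  rw [stdSimplex.map_coe, FunOnFinite.linearMap_apply_apply]

lemma stdSimplex_map_eq_self {α : Type*} [Fintype α] {f : α → α} {t : stdSimplex ℝ α}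
    (h : ∀ a, t a ≠ 0 → f a = a) : stdSimplex.map f t = t := by
  classical
  ext b
  rw [stdSimplex_map_apply]
  by_cases hb : t b = 0
  · rw [hb]
    refine Finset.sum_eq_zero fun a ha => ?_
    by_contra h0
    rw [Finset.mem_filter, h a h0] at ha
    exact h0 (ha.2 ▸ hb)
  · refine (Finset.sum_subset (s₁ := {b}) (fun a ha => ?_) (fun a ha ha' => ?_)).symm.trans
      (Finset.sum_singleton _ _)
    · rw [Finset.mem_singleton.1 ha]
      simpa using h b hb
    · by_contra h0
      rw [Finset.mem_filter, h a h0] at ha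
      exact ha' (Finset.mem_singleton.2 ha.2)

/-- An identification of the simplices of a simplicial set with the finite chains (with
repetitions) in a partially ordered set. -/
structure PosetModel (X : SSet.{u}) (P : Type) [PartialOrder P] where
  equiv : ∀ n : SimplexCategory, X.obj (op n) ≃ (Fin (n.len + 1) →o P)
  nat : ∀ {m n : SimplexCategory} (θ : m ⟶ n) (x : X.obj (op n)),
    equiv m (X.map θ.op x) = (equiv n x).comp θ.toOrderHom

namespace PosetModel

variable {X : SSet.{u}} {P : Type} [PartialOrder P] [Fintype P] (M : PosetModel X P)

/-- The barycentric coordinates of a point of the realization. -/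
def coord {n : SimplexCategory} (x : X.obj (op n)) (t : TSimplex n) : stdSimplex ℝ P :=
  stdSimplex.map (M.equiv n x) t

lemma coord_map {m n : SimplexCategory} (θ : m ⟶ n) (x : X.obj (op n)) (t : TSimplex m) :
    M.coord (X.map θ.op x) t = M.coord x (stdSimplex.map θ t) := by
  rw [coord, coord, M.nat, stdSimplex.map_comp_apply]
  rfl

/-- This permits two moves without changing the point: dropping a vertex of weight zero (η ≫ θ fixes
t) and merging two equal vertices (η ≫ θ fixes the chain). -/
lemma reduce {m n : SimplexCategory} (θ : m ⟶ n) (η : n ⟶ m) (x : X.obj (op n)) (t : TSimplex n)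
    (h : stdSimplex.map (η ≫ θ) t = t ∨ (M.equiv n x).comp (η ≫ θ).toOrderHom = M.equiv n x) :
    charMap (X.map θ.op x) (stdSimplex.map η t) = charMap x t ∧
      M.coord (X.map θ.op x) (stdSimplex.map η t) = M.coord x t := by
  have h₁ : stdSimplex.map θ (stdSimplex.map η t) = stdSimplex.map (η ≫ θ) t :=
    stdSimplex.map_comp_apply _ _ _
  rw [M.coord_map, charMap_map, h₁]
  obtain h | h := h
  · rw [h]
    exact ⟨rfl, rfl⟩
  · rw [← charMap_map, ← M.coord_map]
    have : X.map (η ≫ θ).op x = x := (M.equiv n).injective (by rw [M.nat, h])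
    rw [this]
    exact ⟨rfl, rfl⟩

/-- Induction on the dimension: a simplex that is not reduced has two equal consecutive vertices or
a vanishing coordinate, and in either case `reduce` lowers the dimension. -/
lemma exists_reduced_aux (k : ℕ) : ∀ (x : X.obj (op ⦋k⦌)) (t : TSimplex ⦋k⦌),
    ∃ (l : ℕ) (x' : X.obj (op ⦋l⦌)) (t' : TSimplex ⦋l⦌), charMap x' t' = charMap x t ∧
      M.coord x' t' = M.coord x t ∧ StrictMono (M.equiv _ x') ∧ ∀ i, 0 < t' i := by
  induction k with
  | zero =>
    intro x t
    refine ⟨0, x, t, rfl, rfl, ?_, ?_⟩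
    · intro a b hab
      exact absurd hab (by rw [Subsingleton.elim (α := Fin 1) a b]; exact lt_irrefl _)
    · intro i
      have : t i = 1 := stdSimplex.eq_one_of_unique (X := Fin 1) t i
      rw [this]
      exact one_pos
  | succ k ih =>
    intro x t
    have key : ∀ (θ : (⦋k⦌ : SimplexCategory) ⟶ ⦋k + 1⦌) (η : (⦋k + 1⦌ : SimplexCategory) ⟶ ⦋k⦌),
        (stdSimplex.map (η ≫ θ) t = t ∨
          (M.equiv _ x).comp (η ≫ θ).toOrderHom = M.equiv _ x) →
        ∃ (l : ℕ) (x' : X.obj (op ⦋l⦌)) (t' : TSimplex ⦋l⦌), charMap x' t' = charMap x t ∧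
          M.coord x' t' = M.coord x t ∧ StrictMono (M.equiv _ x') ∧ ∀ i, 0 < t' i := by
      intro θ η h
      obtain ⟨l, x', t', h₁, h₂, h₃⟩ := ih (X.map θ.op x) (stdSimplex.map η t)
      obtain ⟨h₄, h₅⟩ := M.reduce θ η x t h
      exact ⟨l, x', t', h₁.trans h₄, h₂.trans h₅, h₃⟩
    by_cases hpos : ∀ i, 0 < t i
    · by_cases hs : StrictMono (M.equiv _ x)
      · exact ⟨k + 1, x, t, rfl, rfl, hs, hpos⟩
      · obtain ⟨i, hi⟩ : ∃ i : Fin (k + 1), M.equiv _ x i.castSucc = M.equiv _ x i.succ := by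
          by_contra! h
          exact hs (Fin.strictMono_iff_lt_succ.2 fun i =>
            lt_of_le_of_ne ((M.equiv _ x).monotone (Fin.castSucc_lt_succ).le) (h i))
        refine key (SimplexCategory.δ i.succ) (SimplexCategory.σ i) (Or.inr ?_)
        ext j
        change M.equiv _ x (i.succ.succAbove (i.predAbove j)) = M.equiv _ x j
        by_cases hj : j = i.succ
        · subst hj
          rw [Fin.predAbove_succ_self, Fin.succAbove_of_castSucc_lt _ _ Fin.castSucc_lt_succ, hi]
        · rw [Fin.succ_succAbove_predAbove hj]
    · push Not at hpos
      obtain ⟨i, hi⟩ := hpos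
      have hi : t i = 0 := le_antisymm hi (stdSimplex.zero_le t i)
      -- The degeneracy at p retracts onto the i-th face in both forms of i. The first form is
      -- needed only for i = 0, which is not a successor.
      obtain ⟨p, hp⟩ : ∃ p : Fin (k + 1), i = p.castSucc ∨ i = p.succ := by
        induction i using Fin.cases with
        | zero => exact ⟨0, Or.inl rfl⟩
        | succ p => exact ⟨p, Or.inr rfl⟩
      refine key (SimplexCategory.δ i) (SimplexCategory.σ p)
        (Or.inl (stdSimplex_map_eq_self fun j hj => ?_))
      change i.succAbove (p.predAbove j) = j
      have hj : j ≠ i := fun h => hj (h ▸ hi)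
      obtain rfl | rfl := hp
      · exact Fin.succAbove_predAbove hj
      · exact Fin.succ_succAbove_predAbove hj

/-- Every point lies in the interior of a nondegenerate simplex. -/
lemma exists_reduced {n : SimplexCategory} (x : X.obj (op n)) (t : TSimplex n) :
    ∃ (l : ℕ) (x' : X.obj (op ⦋l⦌)) (t' : TSimplex ⦋l⦌), charMap x' t' = charMap x t ∧
      M.coord x' t' = M.coord x t ∧ StrictMono (M.equiv _ x') ∧ ∀ i, 0 < t' i :=
  M.exists_reduced_aux n.len x t

lemma coord_apply_of_injective {n : SimplexCategory} (x : X.obj (op n)) (t : TSimplex n)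
    (h : Function.Injective (M.equiv n x)) (i : Fin (n.len + 1)) :
    M.coord x t (M.equiv n x i) = t i := by
  classical
  rw [coord, stdSimplex_map_apply]
  simp [h.eq_iff, Finset.filter_eq']

lemma range_of_reduced {n : SimplexCategory} (x : X.obj (op n)) (t : TSimplex n)
    (h : Function.Injective (M.equiv n x)) (ht : ∀ i, 0 < t i) :
    Set.range (M.equiv n x) = {p | M.coord x t p ≠ 0} := by
  classical
  ext p
  constructor
  · rintro ⟨i, rfl⟩
    rw [Set.mem_ofPred_eq, M.coord_apply_of_injective x t h]
    exact (ht i).ne'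
  · intro hp
    rw [Set.mem_ofPred_eq, coord, stdSimplex_map_apply] at hp
    obtain ⟨a, ha, -⟩ := Finset.exists_ne_zero_of_sum_ne_zero hp
    exact ⟨a, (Finset.mem_filter.1 ha).2⟩

/-- Points are determined by their barycentric coordinates. -/
lemma charMap_eq_of_coord_eq {m n : SimplexCategory} {x : X.obj (op m)} {t : TSimplex m}
    {y : X.obj (op n)} {s : TSimplex n} (h : M.coord x t = M.coord y s) :
    charMap x t = charMap y s := by
  obtain ⟨k, x', t', h₁, h₂, h₃, h₄⟩ := M.exists_reduced x t
  obtain ⟨l, y', s', h₁', h₂', h₃', h₄'⟩ := M.exists_reduced y s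
  rw [← h₁, ← h₁']
  rw [← h₂, ← h₂'] at h
  -- The vertices of a reduced simplex are the support of its coordinates. A strict chain is
  -- determined by its range, so the two reduced simplices coincide, and then so do their weights.
  have hr : Set.range (M.equiv _ x') = Set.range (M.equiv _ y') := by
    rw [M.range_of_reduced x' t' h₃.injective h₄, M.range_of_reduced y' s' h₃'.injective h₄', h]
  have hkl : k = l := by
    have h := congrArg Set.ncard hr
    rw [Set.ncard_range_of_injective h₃.injective, Set.ncard_range_of_injective h₃'.injective] at h
    simpa using h
  subst hkl
  have hc : M.equiv _ x' = M.equiv _ y' := DFunLike.coe_injective ((h₃.range_inj h₃').1 hr)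
  obtain rfl := (M.equiv _).injective hc
  have : t' = s' := by
    ext i
    rw [← M.coord_apply_of_injective x' t' h₃.injective, h,
      M.coord_apply_of_injective x' s' h₃.injective]
  rw [this]

/-- Reduced simplices are strict chains and have at most `Fintype.card P` vertices, so finitely many
closed simplices cover the realization. -/
lemma compactSpace (M : PosetModel X P) : CompactSpace (SSet.toTop.obj X) := by
  classical
  have hfin : ∀ n : SimplexCategory, Finite (X.obj (op n)) := fun n =>
    have : Finite (Fin (n.len + 1) →o P) := Finite.of_injective _ DFunLike.coe_injective
    Finite.of_equiv _ (M.equiv n).symm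
  have h : (Set.univ : Set (SSet.toTop.obj X)) =
      ⋃ l ∈ Finset.range (Fintype.card P), ⋃ x : X.obj (op ⦋l⦌), Set.range (charMap x) := by
    refine (Set.eq_univ_of_forall fun z => ?_).symm
    obtain ⟨n, x, t, rfl⟩ := charMap_jointly_surjective z
    obtain ⟨l, x', t', h₁, -, h₃, -⟩ := M.exists_reduced x t
    have hl : l < Fintype.card P := by
      have := Fintype.card_le_of_injective _ h₃.injective
      simpa using this
    simp only [Set.mem_iUnion]
    exact ⟨l, Finset.mem_range.2 hl, x', t', h₁⟩
  refine ⟨?_⟩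
  rw [h]
  refine Finset.isCompact_biUnion _ fun l _ => ?_
  have := hfin ⦋l⦌
  exact isCompact_iUnion fun x => isCompact_range (charMap x).continuous

end PosetModel
end PosetModels

/-! ## Monotone couplings of distributions -/

section Couplings

open Finset

/-- A distribution is supported on a chain. -/
def ChainSupported {P : Type*} [PartialOrder P] [Fintype P] (f : stdSimplex ℝ P) : Prop :=
  ∀ p q, f p ≠ 0 → f q ≠ 0 → p ≤ q ∨ q ≤ p

lemma chainSupported_map {P : Type*} [PartialOrder P] [Fintype P] {n : ℕ} (c : Fin n →o P)
    (t : stdSimplex ℝ (Fin n)) : ChainSupported (stdSimplex.map c t) := by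
  classical
  intro p q hp hq
  rw [stdSimplex_map_apply] at hp hq
  obtain ⟨a, ha, -⟩ := exists_ne_zero_of_sum_ne_zero hp
  obtain ⟨b, hb, -⟩ := exists_ne_zero_of_sum_ne_zero hq
  rw [← (mem_filter.1 ha).2, ← (mem_filter.1 hb).2]
  exact (le_total a b).imp (fun h => c.monotone h) (fun h => c.monotone h)

/-- A distribution that is supported on a chain is the image of a distribution on a simplex. -/
lemma ChainSupported.exists_map_eq {P : Type*} [PartialOrder P] [Fintype P] {f : stdSimplex ℝ P}
    (hf : ChainSupported f) :
    ∃ (n : ℕ) (c : Fin (n + 1) →o P) (t : stdSimplex ℝ (Fin (n + 1))),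
      stdSimplex.map c t = f ∧ ∀ i, f (c i) ≠ 0 := by
  classical
  -- The support is a finite linear order; its increasing enumeration is the chain and the values of
  -- f are the weights.
  let S := { p : P // f p ≠ 0 }
  let _ : LinearOrder S :=
    { (inferInstance : PartialOrder S) with
      le_total := fun p q => hf p q p.2 q.2
      toDecidableLE := Classical.decRel _ }
  have hsum : ∑ s : S, f s = 1 := by
    rw [← stdSimplex.sum_eq_one f, ← sum_filter_ne_zero (s := univ) (f := f)]
    exact (sum_subtype _ (fun p => by simp) _).symm
  have hS : Nonempty S := by
    by_contra h
    rw [not_nonempty_iff] at h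
    simp at hsum
  obtain ⟨n, hn⟩ : ∃ n, Fintype.card S = n + 1 :=
    Nat.exists_eq_succ_of_ne_zero Fintype.card_ne_zero
  let e : Fin (n + 1) ≃o S := Fintype.orderIsoFinOfCardEq S hn
  refine ⟨n, ⟨fun i => e i, fun i j h => e.monotone h⟩,
    ⟨fun i => f (e i), fun i => stdSimplex.zero_le f _, ?_⟩, ?_, fun i => (e i).2⟩
  · rw [← hsum]
    exact Equiv.sum_comp e.toEquiv (fun s : S => f s)
  · ext p
    rw [stdSimplex_map_apply]
    by_cases hp : f p = 0
    · rw [hp]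
      refine sum_eq_zero fun i hi => ?_
      have h : ((e i : S) : P) = p := (mem_filter.1 hi).2
      exact absurd (by rw [h]; exact hp) (e i).2
    · refine (sum_eq_single (e.symm ⟨p, hp⟩) (fun i hi h => ?_) (fun h => ?_)).trans ?_
      · refine absurd ?_ h
        rw [OrderIso.eq_symm_apply]
        exact Subtype.ext (mem_filter.1 hi).2
      · refine absurd (mem_filter.2 ⟨mem_univ _, ?_⟩) h
        change ((e (e.symm ⟨p, hp⟩) : S) : P) = p
        simp
      · change f (e (e.symm ⟨p, hp⟩)) = f p
        simp

/-- The summands are the increments of g between consecutive partial sums of r; the induction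
removes the largest index. -/
lemma telescope {α : Type*} [LinearOrder α] (r : α → ℝ) (g : ℝ → ℝ) (s : Finset α) :
    ∑ j ∈ s, (g (∑ i ∈ s with i ≤ j, r i) - g (∑ i ∈ s with i < j, r i)) =
      g (∑ i ∈ s, r i) - g 0 := by
  induction s using Finset.induction_on_max with
  | empty => simp
  | insert a s ha ih =>
    have has : a ∉ s := fun h => lt_irrefl _ (ha a h)
    rw [sum_insert has, sum_insert has]
    have h₁ : (insert a s).filter (fun i => i ≤ a) = insert a s :=
      filter_true_of_mem fun i hi => (mem_insert.1 hi).elim (fun h => h.le) (fun h => (ha i h).le)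
    have h₂ : (insert a s).filter (fun i => i < a) = s := by
      rw [filter_insert, if_neg (lt_irrefl a)]
      exact filter_true_of_mem fun i hi => ha i hi
    have h₃ : ∀ j ∈ s, (insert a s).filter (fun i => i ≤ j) = s.filter (fun i => i ≤ j) := by
      intro j hj
      rw [filter_insert, if_neg (not_le.2 (ha j hj))]
    have h₄ : ∀ j ∈ s, (insert a s).filter (fun i => i < j) = s.filter (fun i => i < j) := by
      intro j hj
      rw [filter_insert, if_neg (not_lt.2 (ha j hj).le)]
    have h₅ : ∑ j ∈ s, (g (∑ i ∈ insert a s with i ≤ j, r i) -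
        g (∑ i ∈ insert a s with i < j, r i)) = g (∑ i ∈ s, r i) - g 0 :=
      (sum_congr rfl fun j hj => by rw [h₃ j hj, h₄ j hj]).trans ih
    rw [h₁, h₂, h₅, sum_insert has]
    ring

lemma sum_map_filter {α β : Type*} [Fintype α] [Fintype β] [DecidableEq β] (g : α → β)
    (f : stdSimplex ℝ α) (p : β → Prop) [DecidablePred p] :
    ∑ i with p i, stdSimplex.map g f i = ∑ x with p (g x), f x := by
  simp_rw [stdSimplex_map_apply]
  rw [sum_filter, sum_filter, ← sum_fiberwise (g := g) univ]
  refine sum_congr rfl fun i _ => ?_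
  split_ifs with h
  · exact sum_congr rfl fun x hx => by rw [if_pos ((mem_filter.1 hx).2 ▸ h)]
  · exact (sum_eq_zero fun x hx => by rw [if_neg ((mem_filter.1 hx).2 ▸ h)]).symm

variable {α β : Type*} [LinearOrder α] [Fintype α] [LinearOrder β] [Fintype β]

/-- The cumulative distribution function. -/
def cumLE (t : stdSimplex ℝ α) (i : α) : ℝ := ∑ j with j ≤ i, t j

/-- The left-continuous cumulative distribution function. -/
def cumLT (t : stdSimplex ℝ α) (i : α) : ℝ := ∑ j with j < i, t j

lemma cumLE_eq (t : stdSimplex ℝ α) (i : α) : cumLE t i = cumLT t i + t i := by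
  have : univ.filter (fun j => j ≤ i) = insert i (univ.filter fun j => j < i) := by
    ext j
    simp [le_iff_eq_or_lt]
  rw [cumLE, this, sum_insert (by simp), add_comm]
  rfl

lemma cumLE_le_cumLT (t : stdSimplex ℝ α) {i j : α} (h : i < j) : cumLE t i ≤ cumLT t j :=
  sum_le_sum_of_subset_of_nonneg
    (fun k hk => by simp only [mem_filter, mem_univ, true_and] at hk ⊢; exact hk.trans_lt h)
    (fun k _ _ => stdSimplex.zero_le t k)

lemma cumLT_nonneg (t : stdSimplex ℝ α) (i : α) : 0 ≤ cumLT t i :=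
  sum_nonneg fun _ _ => stdSimplex.zero_le t _

lemma cumLE_le_one (t : stdSimplex ℝ α) (i : α) : cumLE t i ≤ 1 := by
  rw [← stdSimplex.sum_eq_one t]
  exact sum_le_sum_of_subset_of_nonneg (filter_subset _ _) (fun k _ _ => stdSimplex.zero_le t k)

lemma sum_cum_sub (t : stdSimplex ℝ α) (g : ℝ → ℝ) :
    ∑ i, (g (cumLE t i) - g (cumLT t i)) = g 1 - g 0 := by
  have := telescope t g univ
  rwa [stdSimplex.sum_eq_one] at this

/-- Once the values strictly below p agree, the sum over q ≤ p isolates the value at p. -/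
lemma eq_of_sum_le_eq {P : Type*} [PartialOrder P] [Fintype P] [DecidableLE P] {f g : P → ℝ}
    (h : ∀ p, ∑ q with q ≤ p, f q = ∑ q with q ≤ p, g q) : f = g := by
  classical
  ext p
  induction p using WellFoundedLT.induction with
  | ind p ih =>
    have h' := h p
    have : univ.filter (fun q => q ≤ p) = insert p (univ.filter fun q => q < p) := by
      ext q
      simp [le_iff_eq_or_lt]
    rw [this, sum_insert (by simp), sum_insert (by simp),
      sum_congr rfl (fun q hq => ih q (mem_filter.1 hq).2)] at h'
    exact add_right_cancel h'

/-- Suppose some support point x has x.1 ≤ p.1 and p.2 < x.2. Comparability puts every support point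
y with y.2 ≤ p.2 below x, so y.1 ≤ p.1 is automatic and the second marginal gives the sum. If there
is no such x, the condition on the second coordinate is automatic and the first marginal gives it.
-/
lemma ChainSupported.sum_le_eq_min {f : stdSimplex ℝ (α × β)} (hf : ChainSupported f)
    (p : α × β) : ∑ q with q ≤ p, f q =
      min (cumLE (stdSimplex.map Prod.fst f) p.1) (cumLE (stdSimplex.map Prod.snd f) p.2) := by
  classical
  rw [cumLE, cumLE, sum_map_filter Prod.fst f (fun i => i ≤ p.1),
    sum_map_filter Prod.snd f (fun i => i ≤ p.2)]
  have h₁ : ∑ q with q ≤ p, f q ≤ ∑ x with x.1 ≤ p.1, f x :=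
    sum_le_sum_of_subset_of_nonneg
      (fun k hk => by simp only [mem_filter, mem_univ, true_and] at hk ⊢; exact hk.1)
      (fun k _ _ => stdSimplex.zero_le f k)
  have h₂ : ∑ q with q ≤ p, f q ≤ ∑ x with x.2 ≤ p.2, f x :=
    sum_le_sum_of_subset_of_nonneg
      (fun k hk => by simp only [mem_filter, mem_univ, true_and] at hk ⊢; exact hk.2)
      (fun k _ _ => stdSimplex.zero_le f k)
  refine le_antisymm (le_min h₁ h₂) (min_le_iff.2 ?_)
  by_cases h : ∃ x, f x ≠ 0 ∧ x.1 ≤ p.1 ∧ p.2 < x.2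
  · right
    obtain ⟨x, hx, hx₁, hx₂⟩ := h
    refine le_of_eq (sum_subset_zero_on_sdiff ?_ ?_ (fun _ _ => rfl)).symm
    · exact fun k hk => by simp only [mem_filter, mem_univ, true_and] at hk ⊢; exact hk.2
    · intro y hy
      simp only [mem_sdiff, mem_filter, mem_univ, true_and] at hy
      by_contra hy0
      refine hy.2 ⟨?_, hy.1⟩
      rcases hf x y hx hy0 with hxy | hxy
      · exact absurd (hx₂.trans_le (hxy.2.trans hy.1)) (lt_irrefl _)
      · exact hxy.1.trans hx₁
  · left
    push Not at h
    refine le_of_eq (sum_subset_zero_on_sdiff ?_ ?_ (fun _ _ => rfl)).symm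
    · exact fun k hk => by simp only [mem_filter, mem_univ, true_and] at hk ⊢; exact hk.1
    · intro y hy
      simp only [mem_sdiff, mem_filter, mem_univ, true_and] at hy
      by_contra hy0
      exact hy.2 ⟨hy.1, h y hy0 hy.1⟩

/-- A monotone coupling is determined by its marginals. -/
lemma ChainSupported.eq_of_marginals {f g : stdSimplex ℝ (α × β)} (hf : ChainSupported f)
    (hg : ChainSupported g) (h₁ : stdSimplex.map Prod.fst f = stdSimplex.map Prod.fst g)
    (h₂ : stdSimplex.map Prod.snd f = stdSimplex.map Prod.snd g) : f = g := by
  classical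
  refine stdSimplex.ext (eq_of_sum_le_eq fun p => ?_)
  have := hf.sum_le_eq_min p
  rw [h₁, h₂, ← hg.sum_le_eq_min p] at this
  exact this

/-- The left side is the length of the overlap of [a, b] and [c, d]. The right side is the increment
of x ↦ max a (min b x) from c to d, which telescopes when [c, d] runs through consecutive intervals.
-/
lemma overlap_eq {a b c d : ℝ} (h : a ≤ b) (h' : c ≤ d) :
    max 0 (min b d - max a c) = max a (min b d) - max a (min b c) := by
  rcases le_total b d with h₁ | h₁ <;> rcases le_total a c with h₂ | h₂ <;>
    rcases le_total b c with h₃ | h₃ <;> rcases le_total a d with h₄ | h₄ <;>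
    simp_all <;> grind

/-- Existence of monotone couplings. -/
lemma exists_coupling (a : stdSimplex ℝ α) (b : stdSimplex ℝ β) :
    ∃ f : stdSimplex ℝ (α × β), ChainSupported f ∧ stdSimplex.map Prod.fst f = a ∧
      stdSimplex.map Prod.snd f = b := by
  classical
  have ha : ∀ i, cumLT a i ≤ cumLE a i := fun i => by
    rw [cumLE_eq]
    linarith [stdSimplex.zero_le a i]
  have hb : ∀ i, cumLT b i ≤ cumLE b i := fun i => by
    rw [cumLE_eq]
    linarith [stdSimplex.zero_le b i]
  -- Each distribution cuts [0, 1] into consecutive intervals of lengths a i, respectively b j. The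
  -- weight of (i, j) is the length of the overlap of the two corresponding intervals.
  let F : α × β → ℝ := fun p =>
    max 0 (min (cumLE a p.1) (cumLE b p.2) - max (cumLT a p.1) (cumLT b p.2))
  have h₁ : ∀ i, ∑ j, F (i, j) = a i := fun i => by
    have := sum_cum_sub b (fun x => max (cumLT a i) (min (cumLE a i) x))
    rw [sum_congr rfl fun j _ => overlap_eq (ha i) (hb j), this,
      min_eq_left (cumLE_le_one a i), max_eq_right (ha i),
      min_eq_right ((cumLT_nonneg a i).trans (ha i)), max_eq_left (cumLT_nonneg a i), cumLE_eq]
    ring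
  have h₂ : ∀ j, ∑ i, F (i, j) = b j := fun j => by
    have := sum_cum_sub a (fun x => max (cumLT b j) (min (cumLE b j) x))
    rw [sum_congr rfl fun i _ => (show F (i, j) = max (cumLT b j) (min (cumLE b j) (cumLE a i)) -
        max (cumLT b j) (min (cumLE b j) (cumLT a i)) by
        rw [← overlap_eq (hb j) (ha i), min_comm, max_comm (cumLT b j)]), this,
      min_eq_left (cumLE_le_one b j), max_eq_right (hb j),
      min_eq_right ((cumLT_nonneg b j).trans (hb j)), max_eq_left (cumLT_nonneg b j), cumLE_eq]
    ring
  let f : stdSimplex ℝ (α × β) := ⟨F, fun p => le_max_left _ _, by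
    rw [Fintype.sum_prod_type, sum_congr rfl fun i _ => h₁ i, stdSimplex.sum_eq_one]⟩
  have hF : ∀ p, F p ≠ 0 → cumLT a p.1 < cumLE b p.2 ∧ cumLT b p.2 < cumLE a p.1 := by
    intro p hp
    by_contra h
    refine hp (max_eq_left ?_)
    rw [not_and_or, not_lt, not_lt] at h
    rcases h with h | h
    · linarith [min_le_right (cumLE a p.1) (cumLE b p.2), le_max_left (cumLT a p.1) (cumLT b p.2)]
    · linarith [min_le_left (cumLE a p.1) (cumLE b p.2), le_max_right (cumLT a p.1) (cumLT b p.2)]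
  -- If p.1 < q.1 and q.2 < p.2, both overlaps being nonempty would give cumLT b p.2 < cumLE a p.1 ≤
  -- cumLT a q.1 < cumLE b q.2 ≤ cumLT b p.2.
  have key : ∀ p q, F p ≠ 0 → F q ≠ 0 → p.1 < q.1 → p.2 ≤ q.2 := by
    intro p q hp hq h
    by_contra! h'
    linarith [cumLE_le_cumLT a h, cumLE_le_cumLT b h', (hF p hp).2, (hF q hq).1]
  refine ⟨f, fun p q hp hq => ?_, ?_, ?_⟩
  · rcases lt_trichotomy p.1 q.1 with h | h | h
    · exact Or.inl ⟨h.le, key p q hp hq h⟩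
    · exact (le_total p.2 q.2).imp (fun h' => ⟨h.le, h'⟩) (fun h' => ⟨h.ge, h'⟩)
    · exact Or.inr ⟨h.le, key q p hq hp h⟩
  · ext i
    rw [← h₁ i, stdSimplex_map_apply]
    refine sum_bij' (fun x _ => x.2) (fun j _ => (i, j)) ?_ ?_ ?_ ?_ ?_
    · simp
    · simp
    · simp +contextual [Prod.ext_iff]
    · simp
    · rintro ⟨x, y⟩ hx
      obtain rfl : x = i := (mem_filter.1 hx).2
      rfl
  · ext j
    rw [← h₂ j, stdSimplex_map_apply]
    refine sum_bij' (fun x _ => x.1) (fun i _ => (i, j)) ?_ ?_ ?_ ?_ ?_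
    · simp
    · simp
    · simp +contextual [Prod.ext_iff]
    · simp
    · rintro ⟨x, y⟩ hx
      obtain rfl : y = j := (mem_filter.1 hx).2
      rfl

end Couplings

/-! ## Realizations of partially ordered sets -/

section Chains

/-- The nerve of a partially ordered set. -/
def chains (P : Type) [PartialOrder P] : SSet.{u} where
  obj n := ULift.{u} (Fin (n.unop.len + 1) →o P)
  map θ := TypeCat.ofHom fun c => ⟨c.down.comp θ.unop.toOrderHom⟩
  map_id _ := rfl
  map_comp _ _ := rfl

/-- The simplex of the nerve given by a chain. -/
def chain {P : Type} [PartialOrder P] {n : SimplexCategory} (c : Fin (n.len + 1) →o P) :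
    (chains.{u} P).obj (op n) := ULift.up c

variable (P : Type) [PartialOrder P] [Fintype P]

/-- The tautological model of the nerve. -/
def chainsModel : PosetModel (chains.{u} P) P where
  equiv _ := Equiv.ulift
  nat _ _ := rfl

/-- Barycentric coordinates on the realization of a nerve. -/
def chainsCoord : C(SSet.toTop.obj (chains.{u} P), ULift.{u} (stdSimplex ℝ P)) :=
  realizationDesc
    (fun _ c => ⟨fun t => ⟨(chainsModel P).coord c t⟩,
      continuous_uliftUp.comp (stdSimplex.continuous_map _)⟩)
    (fun θ x t => congrArg ULift.up ((chainsModel P).coord_map θ x t))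

variable {P}

lemma chainsCoord_charMap {n : SimplexCategory} (c : Fin (n.len + 1) →o P) (t : TSimplex n) :
    chainsCoord P (charMap (chain c) t) = ⟨stdSimplex.map c t⟩ :=
  realizationDesc_charMap _ (fun θ x t => congrArg ULift.up ((chainsModel P).coord_map θ x t)) _ _

/-- A map out of a simplex that restricts to a bijection on the distributions that are supported
on a chain. -/
structure ChainBijective {Z : Type} (g : stdSimplex ℝ P → Z) : Prop where
  inj : ∀ f f', ChainSupported f → ChainSupported f' → g f = g f' → f = f'
  surj : ∀ z, ∃ (n : ℕ) (c : Fin (n + 1) →o P) (t : stdSimplex ℝ (Fin (n + 1))),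
    g (stdSimplex.map c t) = z

/-- A point of the realization is the same as a chain-supported distribution: its coordinates are
one, and they determine the point by `charMap_eq_of_coord_eq`. -/
lemma ChainBijective.bijective {Z : Type} {g : stdSimplex ℝ P → Z} (hg : ChainBijective g) :
    Function.Bijective fun x : SSet.toTop.obj (chains.{u} P) => g (chainsCoord P x).down := by
  constructor
  · intro x y h
    obtain ⟨n, ⟨c⟩, t, rfl⟩ := charMap_jointly_surjective x
    obtain ⟨m, ⟨d⟩, s, rfl⟩ := charMap_jointly_surjective y
    refine (chainsModel P).charMap_eq_of_coord_eq ?_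
    refine hg.inj _ _ (chainSupported_map _ _) (chainSupported_map _ _) ?_
    have h₁ := congrArg (fun x => g (ULift.down x)) (chainsCoord_charMap.{u} c t)
    have h₂ := congrArg (fun x => g (ULift.down x)) (chainsCoord_charMap.{u} d s)
    exact h₁.symm.trans (h.trans h₂)
  · intro z
    obtain ⟨n, c, t, h⟩ := hg.surj z
    refine ⟨charMap (n := ⦋n⦌) (chain c) t, Eq.trans ?_ h⟩
    exact congrArg (fun x => g (ULift.down x)) (chainsCoord_charMap.{u} (n := ⦋n⦌) c t)

variable {Z : Type} [TopologicalSpace Z] [T2Space Z] {g : stdSimplex ℝ P → Z}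

/-- A space that is parametrized by the chain-supported distributions on `P` is homeomorphic to
the realization of the nerve of `P`. -/
def chainsHomeo (hg : ChainBijective g) (hc : Continuous g) :
    SSet.toTop.obj (chains.{u} P) ≃ₜ Z :=
  have := (chainsModel.{u} P).compactSpace
  Continuous.homeoOfEquivCompactToT2 (f := Equiv.ofBijective _ hg.bijective)
    (hc.comp (continuous_uliftDown.comp (chainsCoord P).continuous))

lemma chainsHomeo_symm (hg : ChainBijective g) (hc : Continuous g) {n : SimplexCategory}
    (c : Fin (n.len + 1) →o P) (t : TSimplex n) :
    (chainsHomeo.{u} hg hc).symm (g (stdSimplex.map c t)) = charMap (chain c) t := by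
  rw [Homeomorph.symm_apply_eq]
  exact (congrArg (fun x => g (ULift.down x)) (chainsCoord_charMap c t)).symm

end Chains

/-! ## Simplicial homotopies -/

section Homotopies

lemma stdSimplex_map_const {α β : Type*} [Fintype α] [Fintype β] [DecidableEq β] (b : β)
    (t : stdSimplex ℝ α) : stdSimplex.map (fun _ => b) t = stdSimplex.vertex b := by
  ext b'
  rw [stdSimplex_map_apply, stdSimplex.vertex_coe]
  by_cases h : b = b'
  · subst h
    simp
  · simp [h, Ne.symm h]

/-- The marginals of a distribution. -/
def marginals (α β : Type) [Fintype α] [Fintype β] (f : stdSimplex ℝ (α × β)) :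
    stdSimplex ℝ α × stdSimplex ℝ β :=
  (stdSimplex.map Prod.fst f, stdSimplex.map Prod.snd f)

lemma continuous_marginals (α β : Type) [Fintype α] [Fintype β] :
    Continuous (marginals α β) :=
  (stdSimplex.continuous_map _).prodMk (stdSimplex.continuous_map _)

lemma chainBijective_marginals (α β : Type) [Fintype α] [Fintype β] [LinearOrder α]
    [LinearOrder β] : ChainBijective (marginals α β) where
  inj _ _ hf hf' h := hf.eq_of_marginals hf' (congrArg Prod.fst h) (congrArg Prod.snd h)
  surj z := by
    obtain ⟨f, hf, h₁, h₂⟩ := exists_coupling z.1 z.2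
    obtain ⟨n, c, t, rfl, -⟩ := hf.exists_map_eq
    exact ⟨n, c, t, Prod.ext h₁ h₂⟩

/-- The triangulation of prisms. -/
def prism (n : SimplexCategory) :
    C(TSimplex n × stdSimplex ℝ (Fin 2), SSet.toTop.obj (chains.{u} (Fin (n.len + 1) × Fin 2))) :=
  
  ⟨(chainsHomeo (chainBijective_marginals (Fin (n.len + 1)) (Fin 2))
    (continuous_marginals _ _)).symm, Homeomorph.continuous _⟩

lemma prism_map {k n : SimplexCategory} (c : Fin (k.len + 1) →o Fin (n.len + 1))
    (χ : Fin (k.len + 1) →o Fin 2) (t : TSimplex k) :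
    prism.{u} n (stdSimplex.map c t, stdSimplex.map χ t) = charMap (chain (c.prod χ)) t := by
  refine Eq.trans ?_ (chainsHomeo_symm (chainBijective_marginals _ _) (continuous_marginals _ _)
    (c.prod χ) t)
  refine congrArg (chainsHomeo.{u} (chainBijective_marginals (Fin (n.len + 1)) (Fin 2))
    (continuous_marginals _ _)).symm ?_
  rw [marginals, stdSimplex.map_comp_apply, stdSimplex.map_comp_apply]
  rfl

/-- Since every point of the prism lies in a simplex of the triangulation, identities of maps out of
prisms need only be checked there, where `prism_map` computes them. -/
lemma prism_exists (n : SimplexCategory) (t : TSimplex n) (s : stdSimplex ℝ (Fin 2)) :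
    ∃ (k : SimplexCategory) (c : Fin (k.len + 1) →o Fin (n.len + 1))
      (χ : Fin (k.len + 1) →o Fin 2) (t' : TSimplex k), stdSimplex.map c t' = t ∧
        stdSimplex.map χ t' = s := by
  obtain ⟨k, c, t', h⟩ := (chainBijective_marginals (Fin (n.len + 1)) (Fin 2)).surj (t, s)
  refine ⟨⦋k⦌, OrderHom.fst.comp c, OrderHom.snd.comp c, t', ?_, ?_⟩
  · have h' := (Prod.ext_iff.1 h).1
    rw [marginals, stdSimplex.map_comp_apply, stdSimplex.map_comp_apply] at h'
    exact h'
  · have h' := (Prod.ext_iff.1 h).2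
    rw [marginals, stdSimplex.map_comp_apply, stdSimplex.map_comp_apply] at h'
    exact h'

/-- A monotone map as a morphism of the simplex category. -/
def ordHom {m n : SimplexCategory} (c : Fin (m.len + 1) →o Fin (n.len + 1)) : m ⟶ n :=
  SimplexCategory.Hom.mk c

/-- Homotopies of maps of simplicial sets. -/
structure SHomotopy {X Y : SSet.{u}} (f g : X ⟶ Y) where
  h : ∀ {n : SimplexCategory}, X.obj (op n) → (Fin (n.len + 1) →o Fin 2) → Y.obj (op n)
  nat : ∀ {m n : SimplexCategory} (θ : m ⟶ n) (x : X.obj (op n)) (χ : Fin (n.len + 1) →o Fin 2),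
    Y.map θ.op (h x χ) = h (X.map θ.op x) (χ.comp θ.toOrderHom)
  zero : ∀ {n : SimplexCategory} (x : X.obj (op n)), h x (OrderHom.const _ 0) = f.app (op n) x
  one : ∀ {n : SimplexCategory} (x : X.obj (op n)), h x (OrderHom.const _ 1) = g.app (op n) x

variable {X Y : SSet.{u}} {f g : X ⟶ Y}

namespace SHomotopy

variable (H : SHomotopy f g)

/-- The homotopy on a single simplex. -/
def cyl {n : SimplexCategory} (x : X.obj (op n)) : chains.{u} (Fin (n.len + 1) × Fin 2) ⟶ Y where
  app k := TypeCat.ofHom fun c => H.h (X.map (ordHom (m := k.unop) (n := n)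
    (OrderHom.fst.comp c.down)).op x) (OrderHom.snd.comp c.down)
  naturality k l θ := by
    ext ⟨c⟩
    refine Eq.trans ?_ (H.nat θ.unop _ _).symm
    refine congrArg (fun z => H.h z _) ?_
    exact congrArg (fun a => a x) (X.map_comp (ordHom (m := k.unop) (n := n)
      (OrderHom.fst.comp c)).op θ)

lemma cyl_chain {k n : SimplexCategory} (x : X.obj (op n)) (c : k ⟶ n)
    (χ : Fin (k.len + 1) →o Fin 2) :
    (H.cyl x).app (op k) (chain (c.toOrderHom.prod χ)) = H.h (X.map c.op x) χ := by
  change H.h (X.map (ordHom (m := k) (n := n)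
    (OrderHom.fst.comp (c.toOrderHom.prod χ))).op x)
    (OrderHom.snd.comp (c.toOrderHom.prod χ)) = _
  have h₁ : ordHom (m := k) (n := n) (OrderHom.fst.comp (c.toOrderHom.prod χ)) = c :=
    SimplexCategory.Hom.ext _ _
      ((SimplexCategory.Hom.toOrderHom_mk _).trans (OrderHom.ext _ _ rfl))
  rw [h₁]
  rfl

/-- The realization of a homotopy on a single simplex. -/
def toTopAux {n : SimplexCategory} (x : X.obj (op n)) :
    C(TSimplex n × stdSimplex ℝ (Fin 2), SSet.toTop.obj Y) :=
  (SSet.toTop.map (H.cyl x)).hom.comp (prism n)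

lemma toTopAux_apply {k n : SimplexCategory} (x : X.obj (op n)) (c : k ⟶ n)
    (χ : Fin (k.len + 1) →o Fin 2) (t : TSimplex k) :
    H.toTopAux x (stdSimplex.map c t, stdSimplex.map χ t) =
      charMap (H.h (X.map c.op x) χ) t := by
  have h := prism_map.{u} (n := n) c.toOrderHom χ t
  rw [← H.cyl_chain, ← toTop_map_charMap]
  exact congrArg (SSet.toTop.map (H.cyl x)) h

/-- On a simplex (c, χ) of the prism both sides are the characteristic map of the simplex `H.h
(X.map (ordHom c ≫ θ).op x) χ`. -/
lemma toTopAux_map {m n : SimplexCategory} (θ : m ⟶ n) (x : X.obj (op n)) (t : TSimplex m)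
    (s : stdSimplex ℝ (Fin 2)) :
    H.toTopAux (X.map θ.op x) (t, s) = H.toTopAux x (stdSimplex.map θ t, s) := by
  obtain ⟨k, c, χ, t', rfl, rfl⟩ := prism_exists m t s
  have h₁ := H.toTopAux_apply (X.map θ.op x) (ordHom c) χ t'
  have h₂ := H.toTopAux_apply x (ordHom c ≫ θ) χ t'
  have h₃ : X.map (ordHom c ≫ θ).op x =
      X.map (ordHom c).op (X.map θ.op x) :=
    congrArg (fun a => a x) (X.map_comp θ.op (ordHom c).op)
  rw [h₃] at h₂
  refine h₁.trans (h₂.symm.trans ?_)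
  rw [stdSimplex.map_comp_apply]
  rfl

/-- The realization of a homotopy. -/
def toTop : C(SSet.toTop.obj X, C(stdSimplex ℝ (Fin 2), SSet.toTop.obj Y)) :=
  -- Currying is needed because `realizationDesc` describes maps out of a realization, not out of
  -- its product with an interval.
  realizationDesc (fun _ x => (H.toTopAux x).curry)
    (fun θ x t => ContinuousMap.ext fun s => H.toTopAux_map θ x t s)

lemma toTop_charMap {n : SimplexCategory} (x : X.obj (op n)) (t : TSimplex n)
    (s : stdSimplex ℝ (Fin 2)) : H.toTop (charMap x t) s = H.toTopAux x (t, s) :=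
  congrArg (fun a : C(stdSimplex ℝ (Fin 2), SSet.toTop.obj Y) => a s)
    (realizationDesc_charMap _
      (fun θ x t => ContinuousMap.ext fun s => H.toTopAux_map θ x t s) x t)

lemma toTop_vertex (i : Fin 2) (f' : X ⟶ Y)
    (hf : ∀ {n : SimplexCategory} (x : X.obj (op n)),
      H.h x (OrderHom.const _ i) = f'.app (op n) x) (z : SSet.toTop.obj X) :
    H.toTop z (stdSimplex.vertex i) = SSet.toTop.map f' z := by
  obtain ⟨n, x, t, rfl⟩ := charMap_jointly_surjective z
  rw [toTop_charMap, toTop_map_charMap, ← hf]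
  have h := H.toTopAux_apply x (𝟙 n) (OrderHom.const _ i) t
  have h₁ : X.map (𝟙 n).op x = x := congrArg (fun a => a x) (X.map_id (op n))
  have h₂ : stdSimplex.map (⇑(OrderHom.const (Fin (n.len + 1)) i)) t = stdSimplex.vertex i :=
    stdSimplex_map_const i t
  have h₃ : stdSimplex.map (⇑(ConcreteCategory.hom (𝟙 n))) t = t := stdSimplex.map_id_apply t
  rw [h₁, h₂, h₃] at h
  exact h

/-- Homotopic maps have homotopic realizations. -/
lemma homotopic (H : SHomotopy f g) :
    (SSet.toTop.map f).hom.Homotopic (SSet.toTop.map g).hom := by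
  let e := stdSimplexHomeomorphUnitInterval
  have h₀ : e.symm 0 = stdSimplex.vertex 0 := by
    rw [Homeomorph.symm_apply_eq]
    rfl
  have h₁ : e.symm 1 = stdSimplex.vertex 1 := by
    rw [Homeomorph.symm_apply_eq]
    rfl
  exact ⟨{
    toFun := fun p => H.toTop p.2 (e.symm p.1)
    continuous_toFun := (H.toTop.continuous.comp continuous_snd).eval
      (e.symm.continuous.comp continuous_fst)
    map_zero_left := fun z => by
      dsimp only
      rw [h₀]
      exact H.toTop_vertex 0 f H.zero z
    map_one_left := fun z => by
      dsimp only
      rw [h₁]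
      exact H.toTop_vertex 1 g H.one z }⟩

end SHomotopy

end Homotopies

/-! ## Edgewise subdivision -/

section Subdivision

/-- The partially ordered set of intervals, ordered by inclusion. -/
abbrev Intervals (Q : Type) [PartialOrder Q] : Type :=
  { p : Qᵒᵈ × Q // OrderDual.ofDual p.1 ≤ p.2 }

/-- The chain in `Q` given by the endpoints of a chain of intervals. -/
def unfoldChain {Q : Type} [PartialOrder Q] {k : ℕ} (c : Fin (k + 1) →o Intervals Q) :
    Fin (2 * k + 1 + 1) →o Q where
  -- The first k + 1 entries are the left endpoints in reverse order, the remaining k + 1 are the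
  -- right endpoints. They form a chain because the intervals are nested.
  toFun x := if h : x.1 ≤ k then OrderDual.ofDual (c ⟨k - x.1, by omega⟩).1.1
    else (c ⟨x.1 - k - 1, by omega⟩).1.2
  monotone' x y hxy := by
    have hxy : x.1 ≤ y.1 := hxy
    dsimp only
    split_ifs with hx hy hy
    · exact (c.monotone (a := ⟨k - y.1, by omega⟩) (b := ⟨k - x.1, by omega⟩)
        (Fin.mk_le_mk.2 (by omega))).1
    · refine le_trans (c.monotone (a := 0) (b := ⟨k - x.1, by omega⟩) (Fin.zero_le _)).1
        (le_trans (c 0).2 (c.monotone (Fin.zero_le _)).2)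
    · omega
    · exact (c.monotone (a := ⟨x.1 - k - 1, by omega⟩) (b := ⟨y.1 - k - 1, by omega⟩)
        (Fin.mk_le_mk.2 (by omega))).2

/-- The nested intervals in `[2k+1]` that are symmetric about the centre. -/
def centred (k : ℕ) : Fin (k + 1) →o Intervals (Fin (2 * k + 1 + 1)) where
  toFun a := ⟨(OrderDual.toDual ⟨k - a.1, by omega⟩, ⟨k + 1 + a.1, by omega⟩), by
    change k - a.1 ≤ k + 1 + a.1
    omega⟩
  monotone' a b hab := by
    have hab : a.1 ≤ b.1 := hab
    constructor
    · change k - b.1 ≤ k - a.1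
      omega
    · change k + 1 + a.1 ≤ k + 1 + b.1
      omega

/-- The left endpoints. -/
abbrev lo {k : ℕ} (a : Fin (k + 1)) : Fin (2 * k + 1 + 1) := OrderDual.ofDual (centred k a).1.1

/-- The right endpoints. -/
abbrev hi {k : ℕ} (a : Fin (k + 1)) : Fin (2 * k + 1 + 1) := (centred k a).1.2

lemma lo_antitone {k : ℕ} {a b : Fin (k + 1)} (h : a ≤ b) : lo b ≤ lo a :=
  ((centred k).monotone h).1

lemma hi_monotone {k : ℕ} {a b : Fin (k + 1)} (h : a ≤ b) : hi a ≤ hi b :=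
  ((centred k).monotone h).2

lemma lo_le_hi {k : ℕ} (a b : Fin (k + 1)) : lo a ≤ hi b := by
  change k - a.1 ≤ k + 1 + b.1
  omega

variable {Q : Type} [PartialOrder Q]

lemma unfoldChain_lo {k : ℕ} (c : Fin (k + 1) →o Intervals Q) (a : Fin (k + 1)) :
    unfoldChain c (lo a) = OrderDual.ofDual (c a).1.1 := by
  have h : (lo a).1 = k - a.1 := rfl
  change dite _ _ _ = _
  rw [dif_pos (by omega)]
  congr 4
  ext
  change k - (lo a).1 = a.1
  omega

lemma unfoldChain_hi {k : ℕ} (c : Fin (k + 1) →o Intervals Q) (a : Fin (k + 1)) :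
    unfoldChain c (hi a) = (c a).1.2 := by
  have h : (hi a).1 = k + 1 + a.1 := rfl
  change dite _ _ _ = _
  rw [dif_neg (by omega)]
  congr 3
  ext
  change (hi a).1 - k - 1 = a.1
  omega

lemma lo_or_hi {k : ℕ} (x : Fin (2 * k + 1 + 1)) : (∃ a, lo a = x) ∨ ∃ a, hi a = x := by
  by_cases h : x.1 ≤ k
  · left
    refine ⟨⟨k - x.1, by omega⟩, Fin.ext ?_⟩
    change k - (k - x.1) = x.1
    omega
  · right
    refine ⟨⟨x.1 - k - 1, by omega⟩, Fin.ext ?_⟩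
    change k + 1 + (x.1 - k - 1) = x.1
    omega

lemma ext_lo_hi {k : ℕ} {f g : Fin (2 * k + 1 + 1) →o Q}
    (h₁ : ∀ a : Fin (k + 1), f (lo a) = g (lo a))
    (h₂ : ∀ a : Fin (k + 1), f (hi a) = g (hi a)) : f = g := by
  ext x
  obtain ⟨a, rfl⟩ | ⟨a, rfl⟩ := lo_or_hi x
  exacts [h₁ a, h₂ a]

/-- The monotone map `[k]ᵒᵖ * [k] ⟶ [l]ᵒᵖ * [l]` induced by a monotone map `[k] ⟶ [l]`. -/
def doubleHom {k l : ℕ} (θ : Fin (k + 1) →o Fin (l + 1)) :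
    Fin (2 * k + 1 + 1) →o Fin (2 * l + 1 + 1) :=
  unfoldChain ((centred l).comp θ)

lemma doubleHom_lo {k l : ℕ} (θ : Fin (k + 1) →o Fin (l + 1)) (a : Fin (k + 1)) :
    doubleHom θ (lo a) = lo (θ a) :=
  unfoldChain_lo _ a

lemma doubleHom_hi {k l : ℕ} (θ : Fin (k + 1) →o Fin (l + 1)) (a : Fin (k + 1)) :
    doubleHom θ (hi a) = hi (θ a) :=
  unfoldChain_hi _ a

/-- The functor `[k] ↦ [k]ᵒᵖ * [k]`. -/
def doubling : SimplexCategory ⥤ SimplexCategory where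
  obj k := ⦋2 * k.len + 1⦌
  map {k l} θ := ordHom (m := ⦋2 * k.len + 1⦌) (n := ⦋2 * l.len + 1⦌) (doubleHom θ.toOrderHom)
  map_id k := SimplexCategory.Hom.ext _ _
    (ext_lo_hi (fun a => doubleHom_lo _ a) (fun a => doubleHom_hi _ a))
  map_comp {k l m} θ η := SimplexCategory.Hom.ext _ _ (by
    change doubleHom (η.toOrderHom.comp θ.toOrderHom) =
      (doubleHom η.toOrderHom).comp (doubleHom θ.toOrderHom)
    refine ext_lo_hi (fun a => ?_) (fun a => ?_)
    · rw [OrderHom.comp_coe, Function.comp_apply, doubleHom_lo, doubleHom_lo, doubleHom_lo]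
      rfl
    · rw [OrderHom.comp_coe, Function.comp_apply, doubleHom_hi, doubleHom_hi, doubleHom_hi]
      rfl)

lemma doubling_hi {k l : SimplexCategory} (θ : k ⟶ l) (a : Fin (k.len + 1)) :
    (doubling.map θ).toOrderHom (hi a) = hi (θ.toOrderHom a) :=
  unfoldChain_hi _ a

/-- The inclusion `[k] ⟶ [k]ᵒᵖ * [k]`. -/
def hiHom (k : SimplexCategory) : k ⟶ doubling.obj k :=
  ordHom (n := ⦋2 * k.len + 1⦌) ⟨hi, fun _ _ h => hi_monotone h⟩

lemma hiHom_naturality {k l : SimplexCategory} (θ : k ⟶ l) :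
    hiHom k ≫ doubling.map θ = θ ≫ hiHom l :=
  SimplexCategory.Hom.ext _ _ (OrderHom.ext _ _ (funext fun a => doubling_hi θ a))

/-- The edgewise subdivision of a simplicial set. -/
def subdivision (Y : SSet.{u}) : SSet.{u} := doubling.op ⋙ Y

/-- The last vertex map. -/
def lastVertex (Y : SSet.{u}) : subdivision Y ⟶ Y where
  app k := Y.map (hiHom k.unop).op
  naturality k l θ := by
    refine (Y.map_comp _ _).symm.trans (Eq.trans ?_ (Y.map_comp _ _))
    exact congrArg (fun a => Y.map (Quiver.Hom.op a)) (hiHom_naturality θ.unop)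

/-- The subdivision of a map. -/
def subdivisionMap {X Y : SSet.{u}} (f : X ⟶ Y) : subdivision X ⟶ subdivision Y :=
  Functor.whiskerLeft doubling.op f

end Subdivision

/-! ### Straight paths in simplices -/

section Segments

variable {α β : Type} [Fintype α] [Fintype β]

/-- The straight path between two distributions. -/
def seg (s t : stdSimplex ℝ α) (r : unitInterval) : stdSimplex ℝ α :=
  ⟨fun i => (1 - r) * s i + r * t i,
    fun i => add_nonneg (mul_nonneg (by linarith [r.2.2]) (stdSimplex.zero_le s i))
      (mul_nonneg r.2.1 (stdSimplex.zero_le t i)),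
    by rw [Finset.sum_add_distrib, ← Finset.mul_sum, ← Finset.mul_sum, stdSimplex.sum_eq_one,
      stdSimplex.sum_eq_one]; ring⟩

lemma seg_apply (s t : stdSimplex ℝ α) (r : unitInterval) (i : α) :
    seg s t r i = (1 - r) * s i + r * t i := rfl

lemma continuous_seg :
    Continuous fun p : (stdSimplex ℝ α × stdSimplex ℝ α) × unitInterval =>
      seg p.1.1 p.1.2 p.2 := by
  refine Continuous.subtype_mk (continuous_pi fun i => ?_) _
  have h : ∀ i, Continuous fun s : stdSimplex ℝ α => s i := fun i =>
    (continuous_apply i).comp continuous_subtype_val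
  have h₁ := (h i).comp ((continuous_fst (X := stdSimplex ℝ α) (Y := stdSimplex ℝ α)).comp
    (continuous_fst (Y := unitInterval)))
  have h₂ := (h i).comp ((continuous_snd (X := stdSimplex ℝ α) (Y := stdSimplex ℝ α)).comp
    (continuous_fst (Y := unitInterval)))
  have h₃ : Continuous fun p : (stdSimplex ℝ α × stdSimplex ℝ α) × unitInterval => (p.2 : ℝ) :=
    continuous_subtype_val.comp continuous_snd
  exact ((continuous_const.sub h₃).mul h₁).add (h₃.mul h₂)

lemma map_seg (f : α → β) (s t : stdSimplex ℝ α) (r : unitInterval) :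
    stdSimplex.map f (seg s t r) = seg (stdSimplex.map f s) (stdSimplex.map f t) r := by
  classical
  ext b
  rw [seg_apply, stdSimplex_map_apply, stdSimplex_map_apply, stdSimplex_map_apply,
    Finset.mul_sum, Finset.mul_sum, ← Finset.sum_add_distrib]
  rfl

lemma seg_one (s t : stdSimplex ℝ α) : seg s t 1 = t := by
  ext i
  simp [seg_apply]

/-- The midpoint. -/
abbrev half : unitInterval := ⟨1 / 2, by norm_num, by norm_num⟩

lemma seg_half (s t : stdSimplex ℝ α) (i : α) : 2 * seg s t half i = s i + t i := by
  rw [seg_apply]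
  change 2 * ((1 - 1 / 2) * s i + 1 / 2 * t i) = _
  ring

end Segments

/-! ### The midpoint homeomorphism between a simplicial set and its subdivision -/

section Folding

open Finset

/-- The midpoint of the two marginals of a distribution on intervals. -/
def endpointMean (n : ℕ) (f : stdSimplex ℝ (Intervals (Fin (n + 1)))) :
    stdSimplex ℝ (Fin (n + 1)) :=
  seg (stdSimplex.map (fun p => OrderDual.ofDual p.1.1) f) (stdSimplex.map (fun p => p.1.2) f) half

lemma continuous_endpointMean (n : ℕ) : Continuous (endpointMean n) :=
  continuous_seg.comp (((stdSimplex.continuous_map _).prodMk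
    (stdSimplex.continuous_map _)).prodMk continuous_const)

variable {n : ℕ}

lemma stdSimplex_map_injective {α β : Type*} [Fintype α] [Fintype β] {g : α → β}
    (hg : Function.Injective g) :
    Function.Injective (stdSimplex.map g : stdSimplex ℝ α → stdSimplex ℝ β) := by
  classical
  have key : ∀ (f : stdSimplex ℝ α) (p : α), stdSimplex.map g f (g p) = f p := by
    intro f p
    rw [stdSimplex_map_apply]
    refine sum_eq_single p (fun q hq hqp => ?_) (fun h => ?_)
    · exact absurd (hg (mem_filter.1 hq).2) hqp
    · exact (h (mem_filter.2 ⟨mem_univ p, rfl⟩)).elim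
  intro f f' h
  ext p
  rw [← key f, ← key f', h]

lemma endpointMean_apply (f : stdSimplex ℝ (Intervals (Fin (n + 1)))) (i : Fin (n + 1)) :
    2 * endpointMean n f i = stdSimplex.map (fun p => OrderDual.ofDual p.1.1) f i +
      stdSimplex.map (fun p => p.1.2) f i :=
  seg_half _ _ _

/-- In a chain of intervals every left endpoint precedes every right endpoint. If some left endpoint
exceeds i, then so do all right endpoints, and twice the mean is the left distribution alone.
Otherwise the left distribution has already reached 1 at i. -/
lemma cumLE_left {f : stdSimplex ℝ (Intervals (Fin (n + 1)))} (hf : ChainSupported f)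
    (i : Fin (n + 1)) :
    cumLE (stdSimplex.map (fun p => OrderDual.ofDual p.1.1) f) i =
      min 1 (2 * cumLE (endpointMean n f) i) := by
  classical
  have h₀ : 2 * cumLE (endpointMean n f) i =
      cumLE (stdSimplex.map (fun p => OrderDual.ofDual p.1.1) f) i +
        cumLE (stdSimplex.map (fun p => p.1.2) f) i := by
    rw [cumLE, mul_sum, cumLE, cumLE, ← sum_add_distrib]
    exact sum_congr rfl fun j _ => seg_half _ _ _
  have h₁ : 0 ≤ cumLE (stdSimplex.map (fun p => p.1.2) f) i :=
    sum_nonneg fun _ _ => stdSimplex.zero_le _ _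
  have h₂ := cumLE_le_one (stdSimplex.map (fun p => OrderDual.ofDual p.1.1) f) i
  rw [h₀]
  by_cases h : ∃ x, f x ≠ 0 ∧ i < OrderDual.ofDual x.1.1
  · obtain ⟨x, hx, hxi⟩ := h
    have h₃ : cumLE (stdSimplex.map (fun p => p.1.2) f) i = 0 := by
      rw [cumLE, sum_map_filter (fun p : Intervals (Fin (n + 1)) => p.1.2) f (fun j => j ≤ i)]
      refine sum_eq_zero fun y hy => ?_
      have hy : y.1.2 ≤ i := (mem_filter.1 hy).2
      by_contra hy0
      rcases hf x y hx hy0 with hxy | hxy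
      · have h₄ : x.1.2 ≤ y.1.2 := hxy.2
        exact absurd (hxi.trans_le (x.2.trans (h₄.trans hy))) (lt_irrefl _)
      · have h₄ : OrderDual.ofDual x.1.1 ≤ OrderDual.ofDual y.1.1 := hxy.1
        exact absurd (hxi.trans_le (h₄.trans (y.2.trans hy))) (lt_irrefl _)
    rw [h₃, add_zero, min_eq_right h₂]
  · push Not at h
    have h₃ : cumLE (stdSimplex.map (fun p => OrderDual.ofDual p.1.1) f) i = 1 := by
      rw [cumLE, sum_map_filter (fun p : Intervals (Fin (n + 1)) => OrderDual.ofDual p.1.1) f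
        (fun j => j ≤ i), ← stdSimplex.sum_eq_one f]
      refine sum_subset (filter_subset _ _) fun x _ hx => ?_
      by_contra hx0
      exact hx (mem_filter.2 ⟨mem_univ _, h x hx0⟩)
    rw [h₃, min_eq_left (by linarith)]

/-- By `cumLE_left` the mean determines the left marginal and hence the right one. Nested intervals
form a chain in the product of the order dual with the order, so the marginals determine the
distribution. -/
lemma endpointMean_injective {f g : stdSimplex ℝ (Intervals (Fin (n + 1)))}
    (hf : ChainSupported f) (hg : ChainSupported g) (h : endpointMean n f = endpointMean n g) :
    f = g := by
  classical
  have h₁ : stdSimplex.map (fun p => OrderDual.ofDual p.1.1) f =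
      stdSimplex.map (fun p => OrderDual.ofDual p.1.1) g := by
    refine stdSimplex.ext (eq_of_sum_le_eq fun i => ?_)
    have h₂ := cumLE_left hf i
    rw [h, ← cumLE_left hg] at h₂
    exact h₂
  have h₂ : stdSimplex.map (fun p => p.1.2) f = stdSimplex.map (fun p => p.1.2) g := by
    ext i
    have h₃ := endpointMean_apply f i
    rw [h, endpointMean_apply, h₁] at h₃
    exact (add_left_cancel h₃).symm
  have h₃ : ∀ f : stdSimplex ℝ (Intervals (Fin (n + 1))), ChainSupported f →
      ChainSupported (stdSimplex.map Subtype.val f) := by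
    intro f hf
    obtain ⟨k, c, t, rfl, -⟩ := hf.exists_map_eq
    rw [stdSimplex.map_comp_apply]
    exact chainSupported_map (P := (Fin (n + 1))ᵒᵈ × Fin (n + 1))
      ⟨fun a => (c a).1, fun _ _ h => c.monotone h⟩ t
  have h₄ : stdSimplex.map Subtype.val f = stdSimplex.map Subtype.val g := by
    refine (h₃ f hf).eq_of_marginals (h₃ g hg) ?_ ?_
    · rw [stdSimplex.map_comp_apply, stdSimplex.map_comp_apply]
      exact h₁
    · rw [stdSimplex.map_comp_apply, stdSimplex.map_comp_apply]
      exact h₂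
  exact stdSimplex_map_injective Subtype.val_injective h₄

/-- The lower half of the mass of τ, doubled, serves as left marginal, and the upper half, doubled,
as right marginal. Their mean is τ, and a monotone coupling supplies the chain. -/
lemma endpointMean_surjective (τ : stdSimplex ℝ (Fin (n + 1))) :
    ∃ (k : ℕ) (c : Fin (k + 1) →o Intervals (Fin (n + 1))) (t : stdSimplex ℝ (Fin (k + 1))),
      endpointMean n (stdSimplex.map c t) = τ := by
  classical
  let L : Fin (n + 1) → ℝ := fun i => min 1 (2 * cumLE τ i) - min 1 (2 * cumLT τ i)
  have hLT : ∀ i, cumLE τ i = cumLT τ i + τ i := cumLE_eq τ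
  have hτ : ∀ i, 0 ≤ τ i := stdSimplex.zero_le τ
  have hL₀ : ∀ i, 0 ≤ L i := fun i =>
    sub_nonneg.2 (min_le_min le_rfl (by linarith [hLT i, hτ i]))
  have hL₁ : ∀ i, L i ≤ 2 * τ i := fun i => by
    have h₁ : min 1 (2 * cumLE τ i) ≤ min 1 (2 * cumLT τ i) + 2 * τ i := by
      rw [min_add]
      exact le_min ((min_le_left _ _).trans (by linarith [hτ i]))
        ((min_le_right _ _).trans (by linarith [hLT i]))
    exact sub_le_iff_le_add'.2 h₁
  have hL : ∑ i, L i = 1 := by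
    refine (sum_cum_sub τ (fun x => min 1 (2 * x))).trans ?_
    norm_num
  -- The order dual makes the coupling pair decreasing left endpoints with increasing right
  -- endpoints.
  let a : stdSimplex ℝ (Fin (n + 1))ᵒᵈ := ⟨fun i => L (OrderDual.ofDual i), fun i => hL₀ _, hL⟩
  let b : stdSimplex ℝ (Fin (n + 1)) := ⟨fun i => 2 * τ i - L i,
    fun i => sub_nonneg.2 (hL₁ i), by
      rw [sum_sub_distrib, ← mul_sum, stdSimplex.sum_eq_one, hL]
      norm_num⟩
  obtain ⟨f, hf, h₁, h₂⟩ := exists_coupling a b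
  obtain ⟨k, c, t, rfl, hc⟩ := hf.exists_map_eq
  -- A left endpoint of positive weight has less than half of the mass strictly below it, and a
  -- right endpoint of positive weight has more than half at or below it; hence they are in the
  -- correct order.
  have hpos : ∀ x, OrderDual.ofDual (c x).1 ≤ (c x).2 := by
    intro x
    have h₃ : a (c x).1 ≠ 0 := by
      rw [← h₁, stdSimplex_map_apply]
      refine fun h => hc x ?_
      exact (sum_eq_zero_iff_of_nonneg fun _ _ => stdSimplex.zero_le _ _).1 h (c x)
        (mem_filter.2 ⟨mem_univ _, rfl⟩)
    have h₄ : b (c x).2 ≠ 0 := by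
      rw [← h₂, stdSimplex_map_apply]
      refine fun h => hc x ?_
      exact (sum_eq_zero_iff_of_nonneg fun _ _ => stdSimplex.zero_le _ _).1 h (c x)
        (mem_filter.2 ⟨mem_univ _, rfl⟩)
    by_contra! hlt
    have h₅ := cumLE_le_cumLT τ hlt
    have h₇ := hLT (OrderDual.ofDual (c x).1)
    have h₈ := hτ (OrderDual.ofDual (c x).1)
    rcases le_total 1 (2 * cumLT τ (OrderDual.ofDual (c x).1)) with h₆ | h₆
    · refine h₃ (Eq.trans (b := L (OrderDual.ofDual (c x).1)) rfl ?_)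
      simp only [L]
      rw [min_eq_left h₆, min_eq_left (by linarith), sub_self]
    · refine h₄ (Eq.trans (b := 2 * τ (c x).2 - L (c x).2) rfl ?_)
      simp only [L]
      have h₉ := hLT (c x).2
      have h₁₀ := hτ (c x).2
      rw [min_eq_right (by linarith), min_eq_right (by linarith), hLT]
      ring
  let c' : Fin (k + 1) →o Intervals (Fin (n + 1)) :=
    ⟨fun x => ⟨c x, hpos x⟩, fun _ _ h => c.monotone h⟩
  refine ⟨k, c', t, ?_⟩
  ext i
  have h₃ : stdSimplex.map (fun p => OrderDual.ofDual p.1.1) (stdSimplex.map c' t) i = L i := by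
    rw [stdSimplex.map_comp_apply]
    rw [stdSimplex.map_comp_apply] at h₁
    exact congrArg (fun a : stdSimplex ℝ (Fin (n + 1))ᵒᵈ => a (OrderDual.toDual i)) h₁
  have h₄ : stdSimplex.map (fun p => p.1.2) (stdSimplex.map c' t) i = 2 * τ i - L i := by
    rw [stdSimplex.map_comp_apply]
    rw [stdSimplex.map_comp_apply] at h₂
    exact congrArg (fun a : stdSimplex ℝ (Fin (n + 1)) => a i) h₂
  have h₅ := seg_half (stdSimplex.map (fun p => OrderDual.ofDual p.1.1) (stdSimplex.map c' t))
    (stdSimplex.map (fun p => p.1.2) (stdSimplex.map c' t)) i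
  rw [h₃, h₄] at h₅
  change seg _ _ half i = τ i
  linarith

lemma chainBijective_endpointMean (n : ℕ) : ChainBijective (endpointMean n) where
  inj _ _ hf hf' h := endpointMean_injective hf hf' h
  surj := endpointMean_surjective

/-- The triangulation of the subdivided simplex. -/
def subdividedSimplex (n : SimplexCategory) :
    C(TSimplex n, SSet.toTop.obj (chains.{u} (Intervals (Fin (n.len + 1))))) :=
  ⟨(chainsHomeo (chainBijective_endpointMean n.len) (continuous_endpointMean n.len)).symm,
    Homeomorph.continuous _⟩

lemma subdividedSimplex_mean {k n : SimplexCategory}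
    (c : Fin (k.len + 1) →o Intervals (Fin (n.len + 1))) (t : TSimplex k) :
    subdividedSimplex.{u} n (endpointMean n.len (stdSimplex.map c t)) = charMap (chain c) t :=
  chainsHomeo_symm (chainBijective_endpointMean n.len) (continuous_endpointMean n.len) c t

lemma endpointMean_map {k n : ℕ} (c : Fin (k + 1) →o Intervals (Fin (n + 1)))
    (t : stdSimplex ℝ (Fin (k + 1))) :
    endpointMean n (stdSimplex.map c t) =
      stdSimplex.map (unfoldChain c) (seg (stdSimplex.map lo t) (stdSimplex.map hi t) half) := by
  rw [endpointMean, map_seg, stdSimplex.map_comp_apply, stdSimplex.map_comp_apply,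
    stdSimplex.map_comp_apply, stdSimplex.map_comp_apply]
  have h₁ : (fun p : Intervals (Fin (n + 1)) => OrderDual.ofDual p.1.1) ∘ c =
      unfoldChain c ∘ lo := funext fun a => (unfoldChain_lo c a).symm
  have h₂ : (fun p : Intervals (Fin (n + 1)) => p.1.2) ∘ c = unfoldChain c ∘ hi :=
    funext fun a => (unfoldChain_hi c a).symm
  rw [h₁, h₂]

lemma map_doubleHom_seg {k l : ℕ} (θ : Fin (k + 1) →o Fin (l + 1))
    (t : stdSimplex ℝ (Fin (k + 1))) (r : unitInterval) :
    stdSimplex.map (doubleHom θ) (seg (stdSimplex.map lo t) (stdSimplex.map hi t) r) =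
      seg (stdSimplex.map lo (stdSimplex.map θ t)) (stdSimplex.map hi (stdSimplex.map θ t)) r := by
  rw [map_seg, stdSimplex.map_comp_apply, stdSimplex.map_comp_apply, stdSimplex.map_comp_apply,
    stdSimplex.map_comp_apply]
  have h₁ : doubleHom θ ∘ lo = lo ∘ θ := funext fun a => doubleHom_lo θ a
  have h₂ : doubleHom θ ∘ hi = hi ∘ θ := funext fun a => doubleHom_hi θ a
  rw [h₁, h₂]

lemma sset_map_map (Y : SSet.{u}) {l m n : SimplexCategory} (η : l ⟶ m) (θ : m ⟶ n)
    (y : Y.obj (op n)) : Y.map η.op (Y.map θ.op y) = Y.map (η ≫ θ).op y :=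
  congrArg (fun a => a y) (Y.map_comp θ.op η.op).symm

variable (Y : SSet.{u})

/-- The straight path from the reversed to the last vertex map on a single simplex. -/
def foldAux {k : SimplexCategory} (y : (subdivision Y).obj (op k)) :
    C(TSimplex k × unitInterval, SSet.toTop.obj Y) :=
  (charMap (X := Y) (n := doubling.obj k) y).comp
    ⟨fun p => seg (stdSimplex.map lo p.1) (stdSimplex.map hi p.1) p.2,
      continuous_seg.comp ((((stdSimplex.continuous_map _).comp continuous_fst).prodMk
        ((stdSimplex.continuous_map _).comp continuous_fst)).prodMk continuous_snd)⟩

lemma foldAux_map {k l : SimplexCategory} (θ : k ⟶ l) (y : (subdivision Y).obj (op l))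
    (t : TSimplex k) (r : unitInterval) :
    foldAux Y ((subdivision Y).map θ.op y) (t, r) = foldAux Y y (stdSimplex.map θ t, r) := by
  refine (charMap_map (X := Y) (doubling.map θ) y _).trans (congrArg (charMap (X := Y) y) ?_)
  exact map_doubleHom_seg θ.toOrderHom t r

/-- The straight path from the reversed to the last vertex map. -/
def foldPath : C(SSet.toTop.obj (subdivision Y), C(unitInterval, SSet.toTop.obj Y)) :=
  realizationDesc (fun _ y => (foldAux Y y).curry)
    (fun θ y t => ContinuousMap.ext fun r => foldAux_map Y θ y t r)

lemma foldPath_charMap {k : SimplexCategory} (y : (subdivision Y).obj (op k)) (t : TSimplex k)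
    (r : unitInterval) : foldPath Y (charMap y t) r = foldAux Y y (t, r) :=
  congrArg (fun a : C(unitInterval, SSet.toTop.obj Y) => a r)
    (realizationDesc_charMap _ (fun θ y t => ContinuousMap.ext fun r => foldAux_map Y θ y t r) y t)

/-- The map from the subdivision given by midpoints. -/
def foldMid : C(SSet.toTop.obj (subdivision Y), SSet.toTop.obj Y) :=
  ⟨fun z => foldPath Y z half, (foldPath Y).continuous.eval continuous_const⟩

lemma foldPath_one (z : SSet.toTop.obj (subdivision Y)) :
    foldPath Y z 1 = SSet.toTop.map (lastVertex Y) z := by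
  obtain ⟨k, y, t, rfl⟩ := charMap_jointly_surjective z
  rw [foldPath_charMap, toTop_map_charMap]
  refine Eq.trans ?_ (charMap_map (X := Y) (hiHom k) y t).symm
  exact congrArg (charMap (X := Y) (n := doubling.obj k) y) (seg_one _ _)

/-- Moving the parameter from 1/2 to 1 along each straight path carries the midpoint map to the last
vertex map. -/
lemma foldMid_homotopic : (foldMid Y).Homotopic (SSet.toTop.map (lastVertex Y)).hom :=
  have : PathConnectedSpace unitInterval :=
    isPathConnected_iff_pathConnectedSpace.1 ((convex_Icc (0 : ℝ) 1).isPathConnected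
      ⟨0, by norm_num⟩)
  let γ := PathConnectedSpace.somePath half (1 : unitInterval)
  ⟨{  toFun := fun p => foldPath Y p.2 (γ p.1)
      continuous_toFun := ((foldPath Y).continuous.comp continuous_snd).eval
        (γ.continuous.comp continuous_fst)
      map_zero_left := fun z => by
        rw [γ.source]
        rfl
      map_one_left := fun z => by
        rw [γ.target]
        exact foldPath_one Y z }⟩

/-- A simplex as a map from the subdivided standard simplex. -/
def subdivisionChar {n : SimplexCategory} (y : Y.obj (op n)) :
    chains.{u} (Intervals (Fin (n.len + 1))) ⟶ subdivision Y where
  app k := TypeCat.ofHom fun c => Y.map (ordHom (m := doubling.obj k.unop) (n := n)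
    (unfoldChain c.down)).op y
  naturality k l θ := by
    ext ⟨c⟩
    refine Eq.trans ?_ (congrArg (fun a => a y) (Y.map_comp (ordHom (m := doubling.obj k.unop)
      (n := n) (unfoldChain c)).op (doubling.map θ.unop).op))
    refine congrArg (fun a => Y.map (Quiver.Hom.op a) y) (SimplexCategory.Hom.ext _ _ ?_)
    refine ext_lo_hi (fun a => (unfoldChain_lo _ a).trans ?_)
      (fun a => (unfoldChain_hi _ a).trans ?_)
    · exact ((congrArg _ (doubleHom_lo θ.unop.toOrderHom a)).trans (unfoldChain_lo c _)).symm
    · exact ((congrArg _ (doubleHom_hi θ.unop.toOrderHom a)).trans (unfoldChain_hi c _)).symm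

/-- The inverse of the midpoint map on a single simplex. -/
def unfoldAux {n : SimplexCategory} (y : Y.obj (op n)) :
    C(TSimplex n, SSet.toTop.obj (subdivision Y)) :=
  (SSet.toTop.map (subdivisionChar Y y)).hom.comp (subdividedSimplex n)

lemma unfoldAux_mean {k n : SimplexCategory} (y : Y.obj (op n))
    (c : Fin (k.len + 1) →o Intervals (Fin (n.len + 1))) (t : TSimplex k) :
    unfoldAux Y y (endpointMean n.len (stdSimplex.map c t)) =
      charMap (X := subdivision Y) (n := k)
        (Y.map (ordHom (m := doubling.obj k) (n := n) (unfoldChain c)).op y) t :=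
  (congrArg (SSet.toTop.map (subdivisionChar Y y)) (subdividedSimplex_mean c t)).trans
    (toTop_map_charMap (subdivisionChar Y y) (chain c) t)

/-- The map of intervals induced by a monotone map. -/
def intervalsMap {m n : ℕ} (θ : Fin (m + 1) →o Fin (n + 1)) :
    Intervals (Fin (m + 1)) →o Intervals (Fin (n + 1)) where
  toFun p := ⟨(OrderDual.toDual (θ (OrderDual.ofDual p.1.1)), θ p.1.2), θ.monotone p.2⟩
  monotone' _ _ h := ⟨θ.monotone h.1, θ.monotone h.2⟩

lemma unfoldChain_intervalsMap {k m n : ℕ} (θ : Fin (m + 1) →o Fin (n + 1))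
    (c : Fin (k + 1) →o Intervals (Fin (m + 1))) :
    unfoldChain ((intervalsMap θ).comp c) = θ.comp (unfoldChain c) :=
  ext_lo_hi (fun a => (unfoldChain_lo _ a).trans (congrArg θ (unfoldChain_lo c a)).symm)
    (fun a => (unfoldChain_hi _ a).trans (congrArg θ (unfoldChain_hi c a)).symm)

/-- By surjectivity of the mean, t lies on a simplex c of the subdivided simplex. There both sides
are the characteristic map of the same simplex, because applying θ to the intervals applies it to
the unfolded chain. -/
lemma unfoldAux_map {m n : SimplexCategory} (θ : m ⟶ n) (y : Y.obj (op n)) (t : TSimplex m) :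
    unfoldAux Y (Y.map θ.op y) t = unfoldAux Y y (stdSimplex.map θ t) := by
  obtain ⟨k, c, t', rfl⟩ := endpointMean_surjective t
  have h : stdSimplex.map θ (endpointMean m.len (stdSimplex.map c t')) =
      endpointMean n.len (stdSimplex.map ((intervalsMap θ.toOrderHom).comp c) t') := by
    rw [endpointMean_map, endpointMean_map, unfoldChain_intervalsMap, stdSimplex.map_comp_apply]
    rfl
  rw [h]
  refine (unfoldAux_mean Y (k := ⦋k⦌) _ c t').trans
    (Eq.trans ?_ (unfoldAux_mean Y (k := ⦋k⦌) y _ t').symm)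
  refine congrArg (fun z => charMap (X := subdivision Y) (n := ⦋k⦌) z t') ?_
  refine (sset_map_map Y (ordHom (m := doubling.obj ⦋k⦌) (unfoldChain c)) θ y).trans ?_
  refine congrArg (fun a => Y.map (Quiver.Hom.op a) y) (SimplexCategory.Hom.ext _ _ ?_)
  exact (unfoldChain_intervalsMap θ.toOrderHom c).symm

/-- The inverse of the midpoint map. -/
def unfold : C(SSet.toTop.obj Y, SSet.toTop.obj (subdivision Y)) :=
  realizationDesc (fun _ y => unfoldAux Y y) (fun θ y t => unfoldAux_map Y θ y t)

lemma unfold_charMap {n : SimplexCategory} (y : Y.obj (op n)) (t : TSimplex n) :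
    unfold Y (charMap y t) = unfoldAux Y y t :=
  realizationDesc_charMap _ (fun θ y t => unfoldAux_map Y θ y t) y t

lemma foldMid_charMap {k : SimplexCategory} (y : (subdivision Y).obj (op k)) (t : TSimplex k) :
    foldMid Y (charMap y t) = charMap (X := Y) (n := doubling.obj k) y
      (seg (stdSimplex.map lo t) (stdSimplex.map hi t) half) :=
  foldPath_charMap Y y t half

lemma foldMid_unfold (z : SSet.toTop.obj Y) : foldMid Y (unfold Y z) = z := by
  obtain ⟨n, y, t, rfl⟩ := charMap_jointly_surjective z
  obtain ⟨k, c, t', rfl⟩ := endpointMean_surjective t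
  rw [unfold_charMap]
  refine (congrArg (foldMid Y) (unfoldAux_mean Y (k := ⦋k⦌) y c t')).trans ?_
  refine (foldMid_charMap Y (k := ⦋k⦌) _ t').trans ?_
  rw [endpointMean_map]
  exact charMap_map (X := Y) (ordHom (m := doubling.obj ⦋k⦌) (n := n) (unfoldChain c)) y _

lemma unfoldChain_centred (k : ℕ) : unfoldChain (centred k) = OrderHom.id :=
  ext_lo_hi (fun a => unfoldChain_lo _ a) (fun a => unfoldChain_hi _ a)

/-- A point of a simplex y of the subdivision folds to the mean of a distribution on the centred
intervals. These unfold to the identity chain, so unfolding returns y itself with the same weights.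
-/
lemma unfold_foldMid (z : SSet.toTop.obj (subdivision Y)) : unfold Y (foldMid Y z) = z := by
  obtain ⟨k, y, t, rfl⟩ := charMap_jointly_surjective z
  rw [foldMid_charMap]
  refine (unfold_charMap Y (n := doubling.obj k) y _).trans ?_
  have h : seg (stdSimplex.map lo t) (stdSimplex.map hi t) half =
      endpointMean (2 * k.len + 1) (stdSimplex.map (centred k.len) t) := by
    rw [endpointMean_map, unfoldChain_centred]
    exact (stdSimplex.map_id_apply _).symm
  refine (congrArg (unfoldAux Y (n := doubling.obj k) y) h).trans
    ((unfoldAux_mean Y (n := doubling.obj k) y (centred k.len) t).trans ?_)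
  refine congrArg (fun z => charMap (X := subdivision Y) (n := k) z t) ?_
  refine Eq.trans (congrArg (fun a => Y.map (Quiver.Hom.op a) y) (?_ : _ = 𝟙 (doubling.obj k)))
    (congrArg (fun a => a y) (Y.map_id _))
  exact SimplexCategory.Hom.ext _ _ (unfoldChain_centred k.len)

/-- The last vertex map of the edgewise subdivision is a homotopy equivalence. -/
lemma isHEquiv_lastVertex : IsHEquiv (SSet.toTop.map (lastVertex Y)).hom :=
  (isHEquiv_homeomorph
    { toFun := foldMid Y
      invFun := unfold Y
      left_inv := unfold_foldMid Y
      right_inv := foldMid_unfold Y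
      continuous_toFun := (foldMid Y).continuous
      continuous_invFun := (unfold Y).continuous }).of_homotopic (foldMid_homotopic Y)

end Folding

/-! ## Comparison of the two constructions -/

/-- Distinguished squares and functorial complements on a category with the data of an
SW-category, with the properties that are used in the comparison of the two versions of
`K`-theory. -/
structure ComplementModel (B : BundledSW.{v, u}) where
  dist : ∀ {X Y X' Y' : B.C}, (X ⟶ Y) → (X' ⟶ Y') → (X ⟶ X') → (Y ⟶ Y') → Prop
  dist_vcomp : ∀ {X Y X' Y' X'' Y'' : B.C} {f : X ⟶ Y} {f' : X' ⟶ Y'} {f'' : X'' ⟶ Y''}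
    {g : X ⟶ X'} {g' : Y ⟶ Y'} {h : X' ⟶ X''} {h' : Y' ⟶ Y''},
    dist f f' g g' → dist f' f'' h h' → dist f f'' (g ≫ h) (g' ≫ h')
  dist_hcomp : ∀ {X Y Z X' Y' Z' : B.C} {f : X ⟶ Y} {k : Y ⟶ Z} {f' : X' ⟶ Y'} {k' : Y' ⟶ Z'}
    {g : X ⟶ X'} {g' : Y ⟶ Y'} {g'' : Z ⟶ Z'},
    dist f f' g g' → dist k k' g' g'' → dist (f ≫ k) (f' ≫ k') g g''
  dist_comm : ∀ {X Y X' Y' : B.C} {f : X ⟶ Y} {f' : X' ⟶ Y'} {g : X ⟶ X'} {g' : Y ⟶ Y'},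
    dist f f' g g' → f ≫ g' = g ≫ f'
  dist_vid : ∀ {X Y : B.C} {f : X ⟶ Y}, B.W.cof f → dist f f (𝟙 X) (𝟙 Y)
  dist_hid : ∀ {X Y : B.C} (g : X ⟶ Y), dist (𝟙 X) (𝟙 Y) g g
  initial : Nonempty (IsInitial B.W.O)
  cof_initial : ∀ {X : B.C} (f : B.W.O ⟶ X), B.W.cof f
  sub_cof : ∀ {X Y U : B.C} {i : X ⟶ Y} {j : U ⟶ Y}, B.W.sub i j → B.W.cof i
  mono_of_sub : ∀ {X Y U : B.C} {i : X ⟶ Y} {j : U ⟶ Y}, B.W.sub i j → Mono j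
  compl : ∀ {X Y : B.C}, { f : X ⟶ Y // B.W.cof f } → B.C
  incl : ∀ {X Y : B.C} (f : { f : X ⟶ Y // B.W.cof f }), compl f ⟶ Y
  sub_incl : ∀ {X Y : B.C} (f : { f : X ⟶ Y // B.W.cof f }), B.W.sub f.1 (incl f)
  -- Uniqueness comes from `mono_of_sub`. The maps are nevertheless data, so that a pointwise choice
  -- for sum diagrams is preserved definitionally by reindexing.
  lift : ∀ {X Y X' Y' : B.C} (f : { f : X ⟶ Y // B.W.cof f }) (f' : { f : X' ⟶ Y' // B.W.cof f })
    (g : Y ⟶ Y'), (∃ c : compl f ⟶ compl f', c ≫ incl f' = incl f ≫ g) → (compl f ⟶ compl f')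
  lift_incl : ∀ {X Y X' Y' : B.C} (f : { f : X ⟶ Y // B.W.cof f })
    (f' : { f : X' ⟶ Y' // B.W.cof f }) (g : Y ⟶ Y')
    (h : ∃ c : compl f ⟶ compl f', c ≫ incl f' = incl f ≫ g),
    lift f f' g h ≫ incl f' = incl f ≫ g
  -- An equality rather than an isomorphism, because the comparison map has to preserve the base
  -- vertex strictly.
  compl_O : compl ⟨𝟙 B.W.O, B.W.cof_mul.id_mem _⟩ = B.W.O
  iso_O_of_sub_id : ∀ {X U : B.C} {j : U ⟶ X}, B.W.sub (𝟙 X) j → Nonempty (U ≅ B.W.O)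
  exists_weq : ∀ {X Y U X' Y' U' : B.C} {i : X ⟶ Y} {j : U ⟶ Y} {i' : X' ⟶ Y'} {j' : U' ⟶ Y'}
    {g : X ⟶ X'} {g' : Y ⟶ Y'}, dist i i' g g' → B.W.sub i j → B.W.sub i' j' →
    ∃ c : U ⟶ U', c ≫ j' = j ≫ g' ∧ B.W.weq c
  dist_of_sub : ∀ {X Y U X' Y' U' : B.C} {i : X ⟶ Y} {j : U ⟶ Y} {i' : X' ⟶ Y'} {j' : U' ⟶ Y'}
    {g : X ⟶ X'} {g' : Y ⟶ Y'} {c : U ⟶ U'}, B.W.sub i j → B.W.sub i' j' →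
    i ≫ g' = g ≫ i' → c ≫ j' = j ≫ g' → B.W.weq c → dist i i' g g'
  -- The subtraction sequence Y ∖ X → Z ∖ X ← Z ∖ Y, which is the condition defining S~.
  exists_sub_comp : ∀ {X Y Z U V K : B.C} {f : X ⟶ Y} {g : Y ⟶ Z} {j : U ⟶ Y} {l : V ⟶ Z}
    {k : K ⟶ Z}, B.W.sub f j → B.W.sub g l → B.W.sub (f ≫ g) k →
    ∃ (a : U ⟶ K) (b : V ⟶ K), a ≫ k = j ≫ g ∧ b ≫ k = l ∧ B.W.sub a b

namespace ComplementModel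

variable {B : BundledSW.{v, u}} (M : ComplementModel B)

/-- The squares category of a complement model. -/
def squares : SquaresCategory.{v, u} where
  Ob := B.C
  E := B.cat
  M := B.W.cofCategory
  dist f f' g g' := M.dist f.1 f'.1 g g'
  dist_vcomp h₁ h₂ := M.dist_vcomp h₁ h₂
  dist_hcomp h₁ h₂ := M.dist_hcomp h₁ h₂
  dist_vid f := M.dist_vid f.2
  dist_hid g := M.dist_hid g
  O := B.W.O
  initial_M X := by
    obtain ⟨I⟩ := M.initial
    exact ⟨{ default := ⟨I.to X, M.cof_initial _⟩
             uniq := fun f => Subtype.ext (I.hom_ext _ _) }⟩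
  initial_E X := by
    obtain ⟨I⟩ := M.initial
    exact ⟨{ default := I.to X
             uniq := fun f => I.hom_ext _ _ }⟩

open SquaresCategory

variable {n : ℕ}

/-- The objects of a horizontal functor. -/
abbrev vtx (A : HFun (Fin (n + 1)) M.squares) (i : Fin (n + 1)) : B.C := A.fn.obj i

/-- The cofibrations of a horizontal functor. -/
def edge (A : HFun (Fin (n + 1)) M.squares) {i j : Fin (n + 1)} (h : i ≤ j) :
    { f : M.vtx A i ⟶ M.vtx A j // B.W.cof f } :=
  A.fn.map (homOfLE h)

/-- The components of a vertical transformation. -/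
def comp {A A' : HFun (Fin (n + 1)) M.squares} (α : A ⟶ A') (i : Fin (n + 1)) :
    M.vtx A i ⟶ M.vtx A' i :=
  VertTrans.app α i

variable {M}

lemma edge_refl (A : HFun (Fin (n + 1)) M.squares) (i : Fin (n + 1)) :
    (M.edge A (le_refl i)).1 = 𝟙 _ :=
  congrArg Subtype.val (A.fn.map_id i)

lemma edge_trans (A : HFun (Fin (n + 1)) M.squares) {i j k : Fin (n + 1)} (h : i ≤ j)
    (h' : j ≤ k) : (M.edge A (h.trans h')).1 = (M.edge A h).1 ≫ (M.edge A h').1 :=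
  congrArg Subtype.val (A.fn.map_comp (homOfLE h) (homOfLE h'))

lemma comp_dist {A A' : HFun (Fin (n + 1)) M.squares} (α : A ⟶ A') {i j : Fin (n + 1)}
    (h : i ≤ j) : M.dist (M.edge A h).1 (M.edge A' h).1 (M.comp α i) (M.comp α j) :=
  VertTrans.dist α (homOfLE h)

lemma hom_ext {X Y : B.C} {f : { f : X ⟶ Y // B.W.cof f }} {Z : B.C} {a b : Z ⟶ M.compl f}
    (h : a ≫ M.incl f = b ≫ M.incl f) : a = b := by
  have := M.mono_of_sub (M.sub_incl f)
  exact (cancel_mono _).1 h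

lemma lift_unique {X Y X' Y' : B.C} {f : { f : X ⟶ Y // B.W.cof f }}
    {f' : { f : X' ⟶ Y' // B.W.cof f }} {g : Y ⟶ Y'} {c : M.compl f ⟶ M.compl f'}
    (h : c ≫ M.incl f' = M.incl f ≫ g) : M.lift f f' g ⟨c, h⟩ = c :=
  have := M.mono_of_sub (M.sub_incl f')
  (cancel_mono (M.incl f')).1 ((M.lift_incl f f' g ⟨c, h⟩).trans h.symm)

lemma lift_id {X Y : B.C} {f : { f : X ⟶ Y // B.W.cof f }}
    (h : ∃ c : M.compl f ⟶ M.compl f, c ≫ M.incl f = M.incl f ≫ 𝟙 Y) :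
    M.lift f f (𝟙 Y) h = 𝟙 _ :=
  lift_unique (by rw [Category.id_comp, Category.comp_id])

lemma lift_comp {X Y X' Y' X'' Y'' : B.C} {f : { f : X ⟶ Y // B.W.cof f }}
    {f' : { f : X' ⟶ Y' // B.W.cof f }} {f'' : { f : X'' ⟶ Y'' // B.W.cof f }} {g : Y ⟶ Y'}
    {g' : Y' ⟶ Y''} (h : ∃ c : M.compl f ⟶ M.compl f', c ≫ M.incl f' = M.incl f ≫ g)
    (h' : ∃ c : M.compl f' ⟶ M.compl f'', c ≫ M.incl f'' = M.incl f' ≫ g')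
    (h'' : ∃ c : M.compl f ⟶ M.compl f'', c ≫ M.incl f'' = M.incl f ≫ g ≫ g') :
    M.lift f f' g h ≫ M.lift f' f'' g' h' = M.lift f f'' (g ≫ g') h'' :=
  (lift_unique (by rw [Category.assoc, lift_incl, ← Category.assoc, lift_incl,
    Category.assoc])).symm

lemma lift_square {X Y X₁ Y₁ X₂ Y₂ X' Y' : B.C} {f : { f : X ⟶ Y // B.W.cof f }}
    {f₁ : { f : X₁ ⟶ Y₁ // B.W.cof f }} {f₂ : { f : X₂ ⟶ Y₂ // B.W.cof f }}
    {f' : { f : X' ⟶ Y' // B.W.cof f }} {g₁ : Y ⟶ Y₁} {g₁' : Y₁ ⟶ Y'} {g₂ : Y ⟶ Y₂}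
    {g₂' : Y₂ ⟶ Y'} (e : g₁ ≫ g₁' = g₂ ≫ g₂')
    {h₁ : ∃ c : M.compl f ⟶ M.compl f₁, c ≫ M.incl f₁ = M.incl f ≫ g₁}
    {h₁' : ∃ c : M.compl f₁ ⟶ M.compl f', c ≫ M.incl f' = M.incl f₁ ≫ g₁'}
    {h₂ : ∃ c : M.compl f ⟶ M.compl f₂, c ≫ M.incl f₂ = M.incl f ≫ g₂}
    {h₂' : ∃ c : M.compl f₂ ⟶ M.compl f', c ≫ M.incl f' = M.incl f₂ ≫ g₂'} :
    M.lift f f₁ g₁ h₁ ≫ M.lift f₁ f' g₁' h₁' = M.lift f f₂ g₂ h₂ ≫ M.lift f₂ f' g₂' h₂' :=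
  hom_ext (by
    rw [Category.assoc, lift_incl, ← Category.assoc, lift_incl, Category.assoc, e,
      Category.assoc, lift_incl, ← Category.assoc (M.lift _ _ _ _), lift_incl, Category.assoc])

section

variable (A : HFun (Fin (n + 1)) M.squares)

lemma edge_sub {i j k : Fin (n + 1)} (h : i ≤ j) (h' : j ≤ k) :
    ∃ (a : M.compl (M.edge A h) ⟶ M.compl (M.edge A (h.trans h')))
      (b : M.compl (M.edge A h') ⟶ M.compl (M.edge A (h.trans h'))),
      a ≫ M.incl _ = M.incl _ ≫ (M.edge A h').1 ∧ b ≫ M.incl _ = M.incl _ ∧ B.W.sub a b := by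
  have h₁ := M.sub_incl (M.edge A (h.trans h'))
  rw [edge_trans A h h'] at h₁
  exact M.exists_sub_comp (M.sub_incl (M.edge A h)) (M.sub_incl (M.edge A h')) h₁

/-- The map factors through the complement for (b.i, a.j): first less is removed from the same
ambient object, then the ambient object grows. -/
lemma exists_lift {a b : ArTilde n} (h : a ≤ b) :
    ∃ c : M.compl (M.edge A a.le) ⟶ M.compl (M.edge A b.le),
      c ≫ M.incl _ = M.incl _ ≫ (M.edge A h.2).1 := by
  obtain ⟨-, c, -, hc, -⟩ := edge_sub A h.1 a.le
  obtain ⟨d, -, hd, -, -⟩ := edge_sub A (h.1.trans a.le) h.2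
  exact ⟨c ≫ d, by rw [Category.assoc, hd, ← Category.assoc, hc]⟩

/-- The diagram of complements of a horizontal functor. -/
def complDiagram : ArTilde n ⥤ B.C where
  obj a := M.compl (M.edge A a.le)
  map {a b} h := M.lift (M.edge A a.le) (M.edge A b.le) (M.edge A (leOfHom h).2).1
    (exists_lift A (leOfHom h))
  map_id a := lift_unique (by rw [edge_refl, Category.id_comp, Category.comp_id])
  map_comp f g := lift_unique (by
    rw [Category.assoc, lift_incl, ← Category.assoc, lift_incl, Category.assoc, ← edge_trans])

/-- The object of `S~_n` given by the complements of a horizontal functor. -/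
def complObj : STilde B n where
  fn := complDiagram A
  diag i := M.iso_O_of_sub_id (by
    have h := M.sub_incl (M.edge A (le_refl i))
    rw [edge_refl] at h
    exact h)
  sub {i j k} h h' := by
    obtain ⟨a, b, ha, hb, hab⟩ := edge_sub A h h'
    have h₁ : (complDiagram A).map (ArTilde.right h h') = a := lift_unique ha
    have h₂ : (complDiagram A).map (ArTilde.left h h') = b :=
      lift_unique (by rw [hb, edge_refl, Category.comp_id])
    rw [h₁, h₂]
    exact hab

end

lemma exists_lift_comp {A A' : HFun (Fin (n + 1)) M.squares} (α : A ⟶ A') (a : ArTilde n) :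
    ∃ c : M.compl (M.edge A a.le) ⟶ M.compl (M.edge A' a.le),
      c ≫ M.incl _ = M.incl _ ≫ M.comp α a.j := by
  obtain ⟨c, hc, -⟩ := M.exists_weq (comp_dist α a.le) (M.sub_incl _) (M.sub_incl _)
  exact ⟨c, hc⟩

lemma comp_naturality {A A' : HFun (Fin (n + 1)) M.squares} (α : A ⟶ A') {i j : Fin (n + 1)}
    (h : i ≤ j) : (M.edge A h).1 ≫ M.comp α j = M.comp α i ≫ (M.edge A' h).1 :=
  M.dist_comm (comp_dist α h)

/-- The map of complements induced by a vertical transformation. -/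
def complMap {A A' : HFun (Fin (n + 1)) M.squares} (α : A ⟶ A') :
    complObj A ⟶ complObj A' where
  nat :=
    { app := fun a => M.lift (M.edge A a.le) (M.edge A' a.le) (M.comp α a.j) (exists_lift_comp α a)
      naturality := fun a b h => lift_square (comp_naturality α (leOfHom h).2) }
  weq a := by
    obtain ⟨c, hc, hw⟩ := M.exists_weq (comp_dist α a.le) (M.sub_incl _) (M.sub_incl _)
    change B.W.weq (M.lift _ _ _ _)
    rw [lift_unique hc]
    exact hw

variable (M) in
/-- The functor that takes complements. -/
def complFunctor (n : ℕ) : HFun (Fin (n + 1)) M.squares ⥤ STilde B n where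
  obj A := complObj A
  map α := complMap α
  map_id _ := STilde.Hom.ext (NatTrans.ext (funext fun _ => lift_id _))
  map_comp _ _ := STilde.Hom.ext (NatTrans.ext (funext fun _ => (lift_comp _ _ _).symm))

variable (M) in
/-- Taking complements, as a map of simplicial categories. -/
def complTrans : simplicialT M.squares ⟶ simplicialS B where
  app k := (M.complFunctor k.unop.len).toCatHom
  -- A complement depends only on the edge at (i, j), and reindexing merely selects edges, so
  -- simplicial operators are respected strictly.
  naturality _ _ _ := rfl

variable (M) in
-- `compl_O` gives equality on objects, and morphisms agree because their source is initial.
lemma const_complObj :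
    complObj (⟨(Functor.const _).obj M.squares.horO⟩ : HFun (Fin (0 + 1)) M.squares) =
      STilde.base B := by
  obtain ⟨I⟩ := M.initial
  have h : complDiagram (⟨(Functor.const _).obj M.squares.horO⟩ : HFun (Fin (0 + 1)) M.squares) =
      (Functor.const (ArTilde 0)).obj B.W.O := by
    refine CategoryTheory.Functor.ext (fun _ => M.compl_O) (fun a b f => ?_)
    have h : ∀ {X : B.C} (_ : X = B.W.O) {Y : B.C} (f g : X ⟶ Y), f = g := by
      rintro X rfl Y f g
      exact I.hom_ext f g
    exact h M.compl_O _ _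
  have h' : ∀ X Y : STilde B 0, X.fn = Y.fn → X = Y := by
    rintro ⟨_, _, _⟩ ⟨_, _, _⟩ rfl
    rfl
  exact h' _ _ h

variable (M) in
/-- Taking complements, as a map of pointed simplicial sets. -/
def complSSet : pointedT.obj M.squares ⟶ pointedS.obj B where
  map := diagNerve.map M.complTrans
  map_pt := ComposableArrows.ext₀ M.const_complObj

end ComplementModel

/-! ## Homotopies from natural transformations -/

section Glue

variable {k : ℕ} {D : Type u} [Category.{v} D]

/-- The functor that follows the source of a natural transformation on the first part of `[k]`
and its target on the second part. -/
def glue (K : ComposableArrows (Fin (k + 1) ⥤ D) 1) (χ : Fin (k + 1) →o Fin 2) :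
    Fin (k + 1) ⥤ D :=
  Functor.prod' χ.monotone.functor (𝟭 _) ⋙ Functor.uncurry.obj K

lemma glue_const (K : ComposableArrows (Fin (k + 1) ⥤ D) 1) (i : Fin 2) :
    glue K (OrderHom.const _ i) = K.obj i := by
  refine Functor.hext (fun _ => rfl) (fun a b h => heq_of_eq ?_)
  have : (K.map (𝟙 i)).app a = 𝟙 ((K.obj i).obj a) :=
    congrArg (fun α => NatTrans.app α a) (K.map_id i)
  exact (congrArg (fun f => f ≫ (K.obj i).map h) this).trans (Category.id_comp _)

/-- Restriction and postcomposition of a natural transformation. -/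
def transport {l : ℕ} {D' : Type u} [Category.{v} D'] (θ : Fin (l + 1) ⥤ Fin (k + 1)) (P : D ⥤ D') :
    (Fin (k + 1) ⥤ D) ⥤ (Fin (l + 1) ⥤ D') :=
  (Functor.whiskeringLeft _ _ _).obj θ ⋙ (Functor.whiskeringRight _ _ _).obj P

lemma glue_transport {l : ℕ} {D' : Type u} [Category.{v} D']
    (K : ComposableArrows (Fin (k + 1) ⥤ D) 1) (χ : Fin (k + 1) →o Fin 2)
    (θ : Fin (l + 1) →o Fin (k + 1)) (P : D ⥤ D') :
    θ.monotone.functor ⋙ glue K χ ⋙ P = glue (K ⋙ transport θ.monotone.functor P) (χ.comp θ) := by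
  exact Functor.hext (fun _ => rfl) (fun _ _ _ => heq_of_eq (P.map_comp _ _))

end Glue

/-- A homotopy between maps to the diagonal of a nerve, given by natural transformations. -/
def homotopyOfTrans {Z : SSet.{max u v}} {𝒳 : SimplexCategoryᵒᵖ ⥤ Cat.{v, u}}
    (f g : Z ⟶ diagNerve.obj 𝒳)
    (K : ∀ {n : SimplexCategory}, Z.obj (op n) →
      ComposableArrows (Fin (n.len + 1) ⥤ 𝒳.obj (op n)) 1)
    (hK : ∀ {m n : SimplexCategory} (θ : m ⟶ n) (z : Z.obj (op n)),
      K (Z.map θ.op z) = K z ⋙ transport (ordFunctor θ) (𝒳.map θ.op).toFunctor)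
    (hf : ∀ {n : SimplexCategory} (z : Z.obj (op n)), (K z).obj 0 = f.app (op n) z)
    (hg : ∀ {n : SimplexCategory} (z : Z.obj (op n)), (K z).obj 1 = g.app (op n) z) :
    SHomotopy f g where
  h z χ := glue (K z) χ
  nat θ z χ := by
    refine (glue_transport (K z) χ θ.toOrderHom (𝒳.map θ.op).toFunctor).trans ?_
    rw [hK]
  zero z := (glue_const _ _).trans (hf z)
  one z := (glue_const _ _).trans (hg z)

section

variable {J : Type} [Preorder J] {C : Type u} [Category.{v} C] {F G : J ⥤ C} (N : F ⟶ G)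

lemma natTrans_square {p q s : J} (f : p ⟶ q) (g : q ⟶ s) (h : p ⟶ s) :
    F.map f ≫ N.app q ≫ G.map g = N.app p ≫ G.map h := by
  rw [← Category.assoc, N.naturality, Category.assoc, ← G.map_comp, Subsingleton.elim (f ≫ g) h]

lemma natTrans_square' {p q r : J} (h : p ⟶ r) (f : p ⟶ q) (g : q ⟶ r) :
    N.app p ≫ G.map h = (N.app p ≫ G.map f) ≫ G.map g := by
  rw [Category.assoc, ← G.map_comp, Subsingleton.elim (f ≫ g) h]

end

/-! ## Windows -/

/-- Nested intervals in `[m]`, indexed by `[k]`, with a common point. -/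
@[ext]
structure Window (k m : ℕ) where
  left : Fin (k + 1) → Fin (m + 1)
  right : Fin (k + 1) → Fin (m + 1)
  left_anti : ∀ {a b}, a ≤ b → left b ≤ left a
  right_mono : ∀ {a b}, a ≤ b → right a ≤ right b
  left_le : ∀ a b, left a ≤ right b

namespace Window

/-- Restriction of a window. -/
def pre {k l m : ℕ} (w : Window l m) (θ : Fin (k + 1) →o Fin (l + 1)) : Window k m where
  left a := w.left (θ a)
  right a := w.right (θ a)
  left_anti h := w.left_anti (θ.monotone h)
  right_mono h := w.right_mono (θ.monotone h)
  left_le _ _ := w.left_le _ _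

/-- The image of a window. -/
def post {k m n : ℕ} (w : Window k m) (θ : Fin (m + 1) →o Fin (n + 1)) : Window k n where
  left a := θ (w.left a)
  right a := θ (w.right a)
  left_anti h := θ.monotone (w.left_anti h)
  right_mono h := θ.monotone (w.right_mono h)
  left_le _ _ := θ.monotone (w.left_le _ _)

/-- The window in `[2k+1]` that consists of the intervals that are symmetric about the centre. -/
def centre (k : ℕ) : Window k (2 * k + 1) where
  left := lo
  right := hi
  left_anti := lo_antitone
  right_mono := hi_monotone
  left_le := lo_le_hi

/-- This identity is responsible for the naturality of everything built from windows: the operators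
of the subdivision act on the centred window by restriction of its rows and columns. -/
lemma centre_post {k l : ℕ} (θ : Fin (k + 1) →o Fin (l + 1)) :
    (centre k).post (doubleHom θ) = (centre l).pre θ :=
  Window.ext (funext fun a => doubleHom_lo θ a) (funext fun a => doubleHom_hi θ a)

end Window

/-! ### The map from the subdivision of S~ to T -/

namespace ComplementModel

open SquaresCategory

variable {B : BundledSW.{v, u}} {M : ComplementModel B} {k m : ℕ}

section Back

variable (X : Fin (m + 1) ⥤ STilde B m) (w : Window k m)

variable (M) in
/-- The horizontal functor given by the `a`-th row of a window. -/
def windowObj (a : Fin (k + 1)) : HFun (Fin (k + 1)) M.squares where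
  fn :=
    { obj := fun i => (X.obj (w.right a)).fn.obj ⟨w.left a, w.right i, w.left_le a i⟩
      map := fun h => ⟨(X.obj (w.right a)).fn.map
        (ArTilde.right (w.left_le a _) (w.right_mono (leOfHom h))),
        M.sub_cof ((X.obj (w.right a)).sub _ _)⟩
      map_id := fun _ => Subtype.ext ((X.obj (w.right a)).fn.map_id _)
      map_comp := fun f g => Subtype.ext ((X.obj (w.right a)).fn.map_comp
        (ArTilde.right (w.left_le a _) (w.right_mono (leOfHom f)))
        (ArTilde.right (w.left_le a _) (w.right_mono (leOfHom g)))) }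

/-- The inclusion of intervals with the same right endpoint. -/
def windowLe {a b : Fin (k + 1)} (h : a ≤ b) (i : Fin (k + 1)) :
    (⟨w.left a, w.right i, w.left_le a i⟩ : ArTilde m) ⟶ ⟨w.left b, w.right i, w.left_le b i⟩ :=
  ArTilde.left (w.left_anti h) (w.left_le a i)

/-- The vertical maps between the rows of a window. -/
def windowApp {a b : Fin (k + 1)} (h : a ≤ b) (i : Fin (k + 1)) :
    (X.obj (w.right a)).fn.obj ⟨w.left a, w.right i, w.left_le a i⟩ ⟶
      (X.obj (w.right b)).fn.obj ⟨w.left b, w.right i, w.left_le b i⟩ :=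
  (STilde.Hom.nat (X.map (homOfLE (w.right_mono h)))).app ⟨w.left a, w.right i, w.left_le a i⟩ ≫
    (X.obj (w.right b)).fn.map (windowLe w h i)

variable (M) in
/-- The vertical transformation between two rows of a window. -/
def windowMap {a b : Fin (k + 1)} (h : a ⟶ b) : M.windowObj X w a ⟶ M.windowObj X w b where
  app i := windowApp X w (leOfHom h) i
  dist {i j} f := by
    -- The complement of (left a, right i) in (left a, right j) is (right i, right j), whatever the
    -- row. The induced map of complements is therefore a component of a morphism of wS~, hence a
    -- weak equivalence.
    refine M.dist_of_sub
      (j := (X.obj (w.right a)).fn.map (ArTilde.left (w.left_le a i) (w.right_mono (leOfHom f))))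
      (j' := (X.obj (w.right b)).fn.map (ArTilde.left (w.left_le b i) (w.right_mono (leOfHom f))))
      (c := (STilde.Hom.nat (X.map (homOfLE (w.right_mono (leOfHom h))))).app
        ⟨w.right i, w.right j, w.right_mono (leOfHom f)⟩)
      ((X.obj (w.right a)).sub _ _) ((X.obj (w.right b)).sub _ _) ?_ ?_
      (STilde.Hom.weq _ _)
    · let e : (⟨w.left a, w.right i, w.left_le a i⟩ : ArTilde m) ⟶
          ⟨w.left b, w.right j, w.left_le b j⟩ :=
        homOfLE ⟨w.left_anti (leOfHom h), w.right_mono (leOfHom f)⟩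
      exact (natTrans_square _ _ _ e).trans (natTrans_square' _ e _ _)
    · exact (natTrans_square _ _ _ _).symm

variable (M) in
/-- The vertical chain of horizontal functors given by a window. -/
def window : Fin (k + 1) ⥤ HFun (Fin (k + 1)) M.squares where
  obj a := M.windowObj X w a
  map h := M.windowMap X w h
  map_id a := VertTrans.ext (funext fun i => by
    have h : STilde.Hom.nat (X.map (𝟙 (w.right a))) = 𝟙 _ :=
      congrArg STilde.Hom.nat (X.map_id (w.right a))
    have h' : (X.obj (w.right a)).fn.map (windowLe w (le_refl a) i) = 𝟙 _ :=
      (X.obj (w.right a)).fn.map_id _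
    exact (congrArg₂ (fun (p : (X.obj (w.right a)).fn ⟶ (X.obj (w.right a)).fn) q =>
      p.app ⟨w.left a, w.right i, w.left_le a i⟩ ≫ q) h h').trans (Category.id_comp _))
  map_comp {a b c} f g := VertTrans.ext (funext fun i => by
    have h : STilde.Hom.nat (X.map (homOfLE (w.right_mono (leOfHom (f ≫ g))))) =
        STilde.Hom.nat (X.map (homOfLE (w.right_mono (leOfHom f)))) ≫
          STilde.Hom.nat (X.map (homOfLE (w.right_mono (leOfHom g)))) :=
      congrArg STilde.Hom.nat (X.map_comp (homOfLE (w.right_mono (leOfHom f)))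
        (homOfLE (w.right_mono (leOfHom g))))
    change windowApp X w (leOfHom (f ≫ g)) i =
      windowApp X w (leOfHom f) i ≫ windowApp X w (leOfHom g) i
    rw [windowApp, h, windowApp, windowApp, NatTrans.comp_app, Category.assoc, Category.assoc]
    exact congrArg (fun x => _ ≫ x) (natTrans_square _ _ _ _).symm)

end Back

variable (M) in
/-- The map from the edgewise subdivision of `S~` back to `T`. -/
def windowSSet : subdivision (diagNerve.obj (simplicialS B)) ⟶
    diagNerve.obj (simplicialT M.squares) where
  app n := TypeCat.ofHom fun X => M.window (m := 2 * n.unop.len + 1) X (Window.centre n.unop.len)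
  naturality n l θ := by
    ext X
    change (M.window _ ((Window.centre l.unop.len).post (doubleHom θ.unop.toOrderHom)) :
      Fin (l.unop.len + 1) ⥤ HFun (Fin (l.unop.len + 1)) M.squares) = _
    rw [Window.centre_post]
    rfl

end ComplementModel

/-! ### The two comparison homotopies -/

lemma mk₁_map {C D : Type u} [Category.{v} C] [Category.{v} D] (T : C ⥤ D) {X Y : C} (f : X ⟶ Y) :
    ComposableArrows.mk₁ (T.map f) = ComposableArrows.mk₁ f ⋙ T :=
  ComposableArrows.ext₁ rfl rfl ((Category.id_comp _).trans (Category.comp_id _)).symm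

namespace ComplementModel

open SquaresCategory

variable {B : BundledSW.{v, u}} {M : ComplementModel B} {k m : ℕ}

/-- The identity square of a cofibration is distinguished, so `exists_weq` compares any two of its
complements. -/
lemma exists_toCompl {X Y U : B.C} (f : { f : X ⟶ Y // B.W.cof f }) {j : U ⟶ Y}
    (h : B.W.sub f.1 j) : ∃ c : U ⟶ M.compl f, c ≫ M.incl f = j ∧ B.W.weq c := by
  obtain ⟨c, hc, hw⟩ := M.exists_weq (M.dist_vid f.2) h (M.sub_incl f)
  exact ⟨c, hc.trans (Category.comp_id _), hw⟩

variable (M) in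
/-- The comparison of a complement with the chosen complement. -/
def toCompl {X Y U : B.C} (f : { f : X ⟶ Y // B.W.cof f }) {j : U ⟶ Y} (h : B.W.sub f.1 j) :
    U ⟶ M.compl f :=
  (exists_toCompl f h).choose

lemma toCompl_incl {X Y U : B.C} (f : { f : X ⟶ Y // B.W.cof f }) {j : U ⟶ Y}
    (h : B.W.sub f.1 j) : M.toCompl f h ≫ M.incl f = j :=
  (exists_toCompl f h).choose_spec.1

lemma weq_toCompl {X Y U : B.C} (f : { f : X ⟶ Y // B.W.cof f }) {j : U ⟶ Y}
    (h : B.W.sub f.1 j) : B.W.weq (M.toCompl f h) :=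
  (exists_toCompl f h).choose_spec.2

lemma toCompl_naturality {X Y U X' Y' U' : B.C} {f : { f : X ⟶ Y // B.W.cof f }}
    {f' : { f : X' ⟶ Y' // B.W.cof f }} {j : U ⟶ Y} {j' : U' ⟶ Y'} {h : B.W.sub f.1 j}
    {h' : B.W.sub f'.1 j'} {p : U ⟶ U'} {g : Y ⟶ Y'} (e : p ≫ j' = j ≫ g)
    {hl : ∃ c : M.compl f ⟶ M.compl f', c ≫ M.incl f' = M.incl f ≫ g} :
    p ≫ M.toCompl f' h' = M.toCompl f h ≫ M.lift f f' g hl :=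
  hom_ext (by
    rw [Category.assoc, toCompl_incl, Category.assoc, lift_incl, ← Category.assoc, toCompl_incl, e])

/-- The right endpoints of a window. -/
def _root_.SquaresK.Window.rightHom (w : Window k m) : Fin (k + 1) →o Fin (m + 1) :=
  ⟨w.right, fun _ _ h => w.right_mono h⟩

section

variable (X : Fin (m + 1) ⥤ STilde B m) (w : Window k m)

/-- The restriction of a simplex to the right endpoints of a window. -/
def restrictS : Fin (k + 1) ⥤ STilde B k :=
  (transport (ordFunctor (ordHom (m := ⦋k⦌) (n := ⦋m⦌) w.rightHom))
    ((simplicialS B).map (ordHom (m := ⦋k⦌) (n := ⦋m⦌) w.rightHom).op).toFunctor).obj X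

variable (M) in
-- The restriction of X to the right endpoints thus consists of complements of the maps in the rows,
-- possibly different from the chosen ones.
lemma window_sub (a : Fin (k + 1)) (i : ArTilde k) :
    B.W.sub (M.edge (M.windowObj X w a) i.le).1
      ((X.obj (w.right a)).fn.map (ArTilde.left (w.left_le a i.i) (w.right_mono i.le))) :=
  (X.obj (w.right a)).sub _ _

variable (M) in
/-- The comparison of a restriction with the complements of a window. -/
def unitApp (a : Fin (k + 1)) : (restrictS X w).obj a ⟶ complObj (M.windowObj X w a) where
  nat :=
    { app := fun i => M.toCompl _ (window_sub M X w a i)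
      naturality := fun i j h => by
        have e : ((restrictS X w).obj a).fn.map h ≫ (X.obj (w.right a)).fn.map
            (ArTilde.left (w.left_le a j.i) (w.right_mono j.le)) =
            (X.obj (w.right a)).fn.map (ArTilde.left (w.left_le a i.i) (w.right_mono i.le)) ≫
              (M.edge (M.windowObj X w a) (leOfHom h).2).1 :=
          ((X.obj (w.right a)).fn.map_comp _ _).symm.trans ((X.obj (w.right a)).fn.map_comp
            (ArTilde.left (w.left_le a i.i) (w.right_mono i.le))
            (ArTilde.right (w.left_le a i.j) (w.right_mono (leOfHom h).2)))
        exact toCompl_naturality (h := window_sub M X w a i) (h' := window_sub M X w a j) e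
          (hl := exists_lift (M.windowObj X w a) (leOfHom h)) }
  weq i := weq_toCompl _ (window_sub M X w a i)

variable (M) in
/-- The comparison of a restriction with the complements of a window, as a transformation. -/
def unitTrans : restrictS X w ⟶ M.window X w ⋙ M.complFunctor k where
  app a := unitApp M X w a
  naturality a b h := STilde.Hom.ext (NatTrans.ext (funext fun i => toCompl_naturality (M := M)
      (f := M.edge (M.windowObj X w a) i.le) (f' := M.edge (M.windowObj X w b) i.le)
      (h := window_sub M X w a i) (h' := window_sub M X w b i)
    (natTrans_square (STilde.Hom.nat (X.map (homOfLE (w.right_mono (leOfHom h)))))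
      (ArTilde.left (w.left_le a i.i) (w.right_mono i.le)) (windowLe w (leOfHom h) i.j)
      (ArTilde.left (w.left_le b i.i) (w.right_mono i.le))).symm
    (hl := exists_lift_comp (M.windowMap X w h) i)))

variable (M) in
/-- The comparison homotopy on `S~`. -/
def unitHomotopy : SHomotopy (lastVertex (diagNerve.obj (simplicialS B)))
    (M.windowSSet ≫ diagNerve.map M.complTrans) :=
  homotopyOfTrans _ _
    (fun {n} X => ComposableArrows.mk₁ (unitTrans M (m := 2 * n.len + 1) X (Window.centre n.len)))
    (fun {k l} θ X => by
      -- Acting on the simplex first is definitionally the same as using the image of the small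
      -- centred window, which `Window.centre_post` turns into a restriction of the large one.
      refine Eq.trans (b := ComposableArrows.mk₁ (unitTrans M (m := 2 * l.len + 1) X
        ((Window.centre k.len).post (doubleHom θ.toOrderHom)))) rfl ?_
      rw [Window.centre_post]
      exact mk₁_map (transport (ordFunctor θ) ((simplicialS B).map θ.op).toFunctor)
        (unitTrans M (m := 2 * l.len + 1) X (Window.centre l.len)))
    (fun X => rfl)
    (fun X => rfl)

end

section

variable (A : Fin (m + 1) ⥤ HFun (Fin (m + 1)) M.squares) (w : Window k m)

/-- The restriction of a simplex to the right endpoints of a window. -/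
def restrictT : Fin (k + 1) ⥤ HFun (Fin (k + 1)) M.squares :=
  (transport (ordFunctor (ordHom (m := ⦋k⦌) (n := ⦋m⦌) w.rightHom))
    ((simplicialT M.squares).map (ordHom (m := ⦋k⦌) (n := ⦋m⦌) w.rightHom).op).toFunctor).obj A

/-- The inclusions of complements. -/
def counitApp (a : Fin (k + 1)) :
    M.windowObj (A ⋙ M.complFunctor m) w a ⟶ (restrictT A w).obj a where
  app i := M.incl (M.edge (A.obj (w.right a)) (w.left_le a i))
  dist {i j} h := by
    -- Removing a common part does not change the difference: both horizontal maps have the chosen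
    -- complement of the edge from right i to right j, so the map of complements is an identity.
    refine M.dist_of_sub (c := 𝟙 _)
      (STilde.sub (complObj (A.obj (w.right a))) (w.left_le a i) (w.right_mono (leOfHom h)))
      (M.sub_incl (M.edge (A.obj (w.right a)) (w.right_mono (leOfHom h)))) ?_ ?_
      (B.W.weq_mul.id_mem _)
    · exact M.lift_incl _ _ _ _
    · refine (Category.id_comp _).trans (Eq.symm ((M.lift_incl _ _ _ _).trans ?_))
      exact (congrArg (fun x => _ ≫ x) (edge_refl (A.obj (w.right a)) (w.right j))).trans
        (Category.comp_id _)

/-- The inclusions of complements, as a natural transformation. -/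
def counitTrans : M.window (A ⋙ M.complFunctor m) w ⟶ restrictT A w where
  app a := counitApp A w a
  naturality a b h := VertTrans.ext (funext fun i => by
    change (windowApp (A ⋙ M.complFunctor m) w (leOfHom h) i) ≫
      M.incl (M.edge (A.obj (w.right b)) (w.left_le b i)) =
      M.incl (M.edge (A.obj (w.right a)) (w.left_le a i)) ≫
        M.comp (A.map (homOfLE (w.right_mono (leOfHom h)))) (w.right i)
    refine (Category.assoc _ _ _).trans ?_
    refine (congrArg (fun x => _ ≫ x) (M.lift_incl _ _ _ _)).trans ?_
    refine (congrArg (fun x => _ ≫ _ ≫ x) (edge_refl (A.obj (w.right b)) (w.right i))).trans ?_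
    refine (congrArg (fun x => _ ≫ x) (Category.comp_id _)).trans ?_
    exact M.lift_incl _ _ _ _)

variable (M) in
/-- The comparison homotopy on `T`. -/
def counitHomotopy : SHomotopy (subdivisionMap (diagNerve.map M.complTrans) ≫ M.windowSSet)
    (lastVertex (diagNerve.obj (simplicialT M.squares))) :=
  homotopyOfTrans _ _
    (fun {n} A => ComposableArrows.mk₁ (counitTrans (M := M) (m := 2 * n.len + 1) A
      (Window.centre n.len)))
    (fun {k l} θ A => by
      refine Eq.trans (b := ComposableArrows.mk₁ (counitTrans (M := M) (m := 2 * l.len + 1) A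
        ((Window.centre k.len).post (doubleHom θ.toOrderHom)))) rfl ?_
      rw [Window.centre_post]
      exact mk₁_map (transport (ordFunctor θ) ((simplicialT M.squares).map θ.op).toFunctor)
        (counitTrans (M := M) (m := 2 * l.len + 1) A
        (Window.centre l.len)))
    (fun A => rfl)
    (fun A => rfl)

end

variable (M)

/-- Both twofold composites in |sd T| → |sd S~| → |T| → |S~| are homotopic to realized last vertex
maps. Two-out-of-six makes the middle map an equivalence, and then the last one. -/
lemma isHEquiv_complTrans : IsHEquiv (SSet.toTop.map (diagNerve.map M.complTrans)).hom := by
  have h₁ := (isHEquiv_lastVertex (diagNerve.obj (simplicialS B))).of_homotopic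
    M.unitHomotopy.homotopic
  have h₂ := (isHEquiv_lastVertex (diagNerve.obj (simplicialT M.squares))).of_homotopic
    M.counitHomotopy.homotopic.symm
  rw [Functor.map_comp, TopCat.hom_comp] at h₁ h₂
  exact (h₂.two_of_six h₁).of_comp_right h₁

end ComplementModel

/-! ## Loop spaces of realizations -/

lemma IsHEquiv.loop_of_apply_eq {X Y : Type*} [TopologicalSpace X] [TopologicalSpace Y]
    {f : C(X, Y)} (hf : IsHEquiv f) {x : X} {y : Y} (h : y = f x) (g : C(Path x x, Path y y))
    (hg : ∀ p t, g p t = f (p t)) : IsHEquiv g := by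
  subst h
  have : g = SquaresK.loopMap f x := ContinuousMap.ext fun p => Path.ext (funext fun t => hg p t)
  rw [this]
  exact hf.loopMap x

lemma isHEquiv_loopRealization {X Y : PointedSSet.{u}} (f : X ⟶ Y)
    (hf : IsHEquiv (SSet.toTop.map (PointedSSet.Hom.map f)).hom) :
    IsHEquiv (loopRealization.map f).hom :=
  hf.loop_of_apply_eq
    (by
      rw [← PointedSSet.Hom.map_pt f]
      exact (realizationPoint_map (PointedSSet.Hom.map f) X.pt).symm)
    _ (fun _ _ => rfl)

/-- The comparison map between the two versions of `K`-theory. -/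
def ComplementModel.kMap {B : BundledSW.{v, u}} (M : ComplementModel B) :
    squaresK.obj M.squares ⟶ swK.obj B :=
  loopRealization.map M.complSSet

lemma ComplementModel.isHEquiv_kMap {B : BundledSW.{v, u}} (M : ComplementModel B) :
    IsHEquiv M.kMap.hom :=
  isHEquiv_loopRealization _ M.isHEquiv_complTrans

/-! ### Complement models of an SW-category and of its sum diagrams -/

namespace SWData

variable {C : Type u} [Category.{v} C] {W : SWData C}

lemma Dist.exists_weq (hW : W.IsSW) {X Y U X' Y' U' : C} {i : X ⟶ Y} {j : U ⟶ Y}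
    {i' : X' ⟶ Y'} {j' : U' ⟶ Y'} {g : X ⟶ X'} {g' : Y ⟶ Y'} (h : W.Dist i i' g g')
    (hj : W.sub i j) (hj' : W.sub i' j') : ∃ c : U ⟶ U', c ≫ j' = j ≫ g' ∧ W.weq c := by
  obtain ⟨-, -, V, V', k, k', c, hk, hk', hc, hw⟩ := h
  obtain ⟨e, he, -⟩ := hW.sub_unique hj hk
  obtain ⟨e', he', -⟩ := hW.sub_unique hk' hj'
  exact ⟨e.hom ≫ c ≫ e'.hom, by simp [he', hc, reassoc_of% he],
    weq_comp W (weq_of_isIso hW _) (weq_comp W hw (weq_of_isIso hW _))⟩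

/-- The condition on the pullback is automatic. The complement of X → Y ×_{Y'} X' maps compatibly to
X' and, through c, to U'. These are disjoint in Y', so the complement is initial and the map is an
isomorphism. -/
lemma Dist.of_sub (hW : W.IsSW) (hm : W.MonoCof) {X Y U X' Y' U' : C} {i : X ⟶ Y} {j : U ⟶ Y}
    {i' : X' ⟶ Y'} {j' : U' ⟶ Y'} {g : X ⟶ X'} {g' : Y ⟶ Y'} {c : U ⟶ U'} (hj : W.sub i j)
    (hj' : W.sub i' j') (w : i ≫ g' = g ≫ i') (hc : c ≫ j' = j ≫ g') (hw : W.weq c) :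
    W.Dist i i' g g' := by
  have hS := hW.toIsSubtractive
  have := hW.cof_hasPullback i' g' (hW.sub_cof hj')
  have hP := IsPullback.of_hasPullback g' i'
  refine ⟨w, ⟨_, _, _, hP, ?_⟩, U, U', j, j', c, hj, hj', hc, hw⟩
  have hp : W.cof (pullback.fst g' i') :=
    hW.cof_baseChange.of_isPullback hP.flip (hW.sub_cof hj')
  have := hm _ hp
  set p := pullback.fst g' i'
  set q := pullback.snd g' i'
  set a := hP.lift i g w
  have hap : a ≫ p = i := hP.lift_fst _ _ _
  have := hW.fib_hasPullback j p (hW.sub_fib hj)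
  -- Base change of (i, j) along p: the pullback of X is X itself because p is a monomorphism.
  have hsub : W.sub a (pullback.fst p j) := by
    refine hW.sub_baseChange (p := 𝟙 X) (f := p) hj ?_ (IsPullback.of_hasPullback p j).flip
    refine IsPullback.of_isLimit' ⟨by simp [hap]⟩ (PullbackCone.IsLimit.mk _
      (fun s => s.fst) (fun s => by simp) (fun s => ?_) (fun s m h1 _ => by simpa using h1))
    rw [← cancel_mono p, Category.assoc, hap]
    exact s.condition
  have hd : pullback.fst p j ≫ p ≫ g' = pullback.snd p j ≫ c ≫ j' := by
    rw [hc, ← Category.assoc, pullback.condition, Category.assoc]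
  obtain ⟨e⟩ := disjoint_of_sub hS hm hj' (p := pullback.fst p j ≫ q)
    (q := pullback.snd p j ≫ c) (by rw [Category.assoc, ← hP.w, hd, Category.assoc])
  have : IsIso a := isIso_of_sub_initial' hS hsub e
  exact weq_of_isIso hW a

/-- The sequence is the base change of (g, l) along k. Here Y ×_Z K is a complement of f, since f ≫
g pulls back to f along the monomorphism g. Also V ×_Z K = V, since V is disjoint from Y and hence
from X. -/
lemma exists_sub_comp (hS : W.IsSubtractive) (hm : W.MonoCof) {X Y Z U V K : C} {f : X ⟶ Y}
    {g : Y ⟶ Z} {j : U ⟶ Y} {l : V ⟶ Z} {k : K ⟶ Z} (hj : W.sub f j) (hl : W.sub g l)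
    (hk : W.sub (f ≫ g) k) :
    ∃ (a : U ⟶ K) (b : V ⟶ K), a ≫ k = j ≫ g ∧ b ≫ k = l ∧ W.sub a b := by
  have hgm := hm g (hS.sub_cof hl)
  have := hS.fib_hasPullback k g (hS.sub_fib hk)
  have := hS.fib_hasPullback k l (hS.sub_fib hk)
  have hV := IsPullback.of_hasPullback g k
  have hV' : W.sub f (pullback.fst g k) := by
    refine hS.sub_baseChange (p := 𝟙 X) hk ?_ hV.flip
    refine IsPullback.of_isLimit' ⟨by simp⟩ (PullbackCone.IsLimit.mk _
      (fun s => s.fst) (fun s => by simp) (fun s => ?_) (fun s m h1 _ => by simpa using h1))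
    rw [← cancel_mono g, Category.assoc]
    exact s.condition
  have hT := IsPullback.of_hasPullback l k
  have hT' : IsIso (pullback.fst l k) := by
    have := hS.cof_hasPullback (f ≫ g) l (hS.sub_cof hk)
    have h0 : W.sub (pullback.fst l (f ≫ g)) (pullback.fst l k) :=
      hS.sub_baseChange hk (IsPullback.of_hasPullback l (f ≫ g)).flip hT.flip
    obtain ⟨e⟩ := disjoint_of_sub hS hm hl (p := pullback.snd l (f ≫ g) ≫ f)
      (q := pullback.fst l (f ≫ g)) (by rw [pullback.condition, Category.assoc])
    exact isIso_of_sub_initial hS h0 e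
  have hsub : W.sub (pullback.snd g k) (pullback.snd l k) := hS.sub_baseChange hl hV hT
  obtain ⟨e, he, -⟩ := hS.sub_unique hj hV'
  refine ⟨e.hom ≫ pullback.snd g k, inv (pullback.fst l k) ≫ pullback.snd l k, ?_, ?_, ?_⟩
  · rw [Category.assoc, ← pullback.condition, ← Category.assoc, he]
  · rw [Category.assoc, ← pullback.condition, IsIso.inv_hom_id_assoc]
  · exact sub_iso hS hsub e (asIso (pullback.fst l k)).symm

/-- A chosen complement of a cofibration, which is `O` if possible. -/
def chosen (hS : W.IsSubtractive) {X Y : C} (f : { f : X ⟶ Y // W.cof f }) :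
    Σ' (U : C) (j : U ⟶ Y), W.sub f.1 j :=
  open scoped Classical in
  if h : W.sub f.1 (hS.initial.some.to Y) then ⟨W.O, _, h⟩
  else ⟨_, _, (hS.exists_sub f.1 f.2).choose_spec.choose_spec⟩

lemma chosen_id_O (hS : W.IsSubtractive) (h : W.cof (𝟙 W.O)) :
    (chosen hS ⟨𝟙 W.O, h⟩).1 = W.O := by
  rw [chosen, dif_pos (hS.sub_id _)]

/-- The maps between chosen complements. -/
def chosenLift (hS : W.IsSubtractive) {X Y X' Y' : C} (f : { f : X ⟶ Y // W.cof f })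
    (f' : { f : X' ⟶ Y' // W.cof f }) (g : Y ⟶ Y')
    (h : ∃ c : (chosen hS f).1 ⟶ (chosen hS f').1,
      c ≫ (chosen hS f').2.1 = (chosen hS f).2.1 ≫ g) :
    (chosen hS f).1 ⟶ (chosen hS f').1 :=
  h.choose

lemma chosenLift_incl (hS : W.IsSubtractive) {X Y X' Y' : C} (f : { f : X ⟶ Y // W.cof f })
    (f' : { f : X' ⟶ Y' // W.cof f }) (g : Y ⟶ Y')
    (h : ∃ c : (chosen hS f).1 ⟶ (chosen hS f').1,
      c ≫ (chosen hS f').2.1 = (chosen hS f).2.1 ≫ g) :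
    chosenLift hS f f' g h ≫ (chosen hS f').2.1 = (chosen hS f).2.1 ≫ g :=
  h.choose_spec

/-- The complement model of an SW-category. -/
def model (W : SWData C) (hW : W.IsSW) (hm : W.MonoCof) (hs : W.Star) :
    ComplementModel (⟨C, inferInstance, W⟩ : BundledSW.{v, u}) where
  dist := W.Dist
  dist_vcomp := Dist.vcomp hW hm
  dist_hcomp := Dist.hcomp hW hm hs
  dist_comm h := h.1
  dist_vid := Dist.vid hW
  dist_hid := Dist.hid hW
  initial := hW.initial
  cof_initial f := hW.sub_cof (hW.sub_initial f)
  sub_cof := hW.sub_cof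
  mono_of_sub := mono_of_sub hW.toIsSubtractive hm
  compl f := (chosen hW.toIsSubtractive f).1
  incl f := (chosen hW.toIsSubtractive f).2.1
  sub_incl f := (chosen hW.toIsSubtractive f).2.2
  lift := chosenLift hW.toIsSubtractive
  lift_incl := chosenLift_incl hW.toIsSubtractive
  compl_O := chosen_id_O hW.toIsSubtractive _
  iso_O_of_sub_id h := iso_O_of_sub_isIso hW.toIsSubtractive h
  exists_weq h := h.exists_weq hW
  dist_of_sub := Dist.of_sub hW hm
  exists_sub_comp := exists_sub_comp hW.toIsSubtractive hm

/-- Maps out of the initial object are cofibrations, so the coproduct is a pushout of cofibrations.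
-/
lemma exists_coproduct (hS : W.IsSubtractive) (X Y : C) :
    ∃ (T : C) (a : X ⟶ T) (b : Y ⟶ T), Nonempty (IsColimit (BinaryCofan.mk a b)) := by
  obtain ⟨I⟩ := hS.initial
  have := hS.cof_hasPushout (I.to X) (I.to Y) (hS.sub_cof (hS.sub_initial _))
    (hS.sub_cof (hS.sub_initial _))
  have hP := IsPushout.of_hasPushout (I.to X) (I.to Y)
  exact ⟨_, pushout.inl (I.to X) (I.to Y), pushout.inr (I.to X) (I.to Y),
    ⟨BinaryCofan.isColimitMk (fun s => hP.desc s.inl s.inr (I.hom_ext _ _))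
      (fun s => hP.inl_desc _ _ _) (fun s => hP.inr_desc _ _ _)
      (fun s m h₁ h₂ => hP.hom_ext (h₁.trans (hP.inl_desc _ _ _).symm)
        (h₂.trans (hP.inr_desc _ _ _).symm))⟩⟩

/-- The complement of a coproduct is the coproduct of the complements. -/
lemma exists_coproduct_compl (hS : W.IsSubtractive) (hc : W.SumsSubtractive)
    {X₁ X₂ X Y₁ Y₂ Y U₁ U₂ U : C} {x₁ : X₁ ⟶ X} {x₂ : X₂ ⟶ X} {y₁ : Y₁ ⟶ Y} {y₂ : Y₂ ⟶ Y}
    {i₁ : X₁ ⟶ Y₁} {i₂ : X₂ ⟶ Y₂} {i : X ⟶ Y} {j₁ : U₁ ⟶ Y₁} {j₂ : U₂ ⟶ Y₂} {j : U ⟶ Y}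
    (hx : Nonempty (IsColimit (BinaryCofan.mk x₁ x₂)))
    (hy : Nonempty (IsColimit (BinaryCofan.mk y₁ y₂))) (h₁ : i₁ ≫ y₁ = x₁ ≫ i)
    (h₂ : i₂ ≫ y₂ = x₂ ≫ i) (hj₁ : W.sub i₁ j₁) (hj₂ : W.sub i₂ j₂) (hj : W.sub i j) :
    ∃ (u₁ : U₁ ⟶ U) (u₂ : U₂ ⟶ U), u₁ ≫ j = j₁ ≫ y₁ ∧ u₂ ≫ j = j₂ ≫ y₂ ∧
      Nonempty (IsColimit (BinaryCofan.mk u₁ u₂)) := by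
  obtain ⟨T, t₁, t₂, ⟨hT⟩⟩ := exists_coproduct hS U₁ U₂
  obtain ⟨k, hk₁, hk₂⟩ : ∃ k : T ⟶ Y, t₁ ≫ k = j₁ ≫ y₁ ∧ t₂ ≫ k = j₂ ≫ y₂ := by
    obtain ⟨k, hk₁, hk₂⟩ := BinaryCofan.IsColimit.desc' hT (j₁ ≫ y₁) (j₂ ≫ y₂)
    exact ⟨k, hk₁, hk₂⟩
  -- By `SumsSubtractive` the coproduct of the complements is a complement of i; uniqueness of
  -- complements transports the universal property to U.
  have hk : W.sub i k := hc hx hy ⟨hT⟩ h₁ h₂ hk₁.symm hk₂.symm hj₁ hj₂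
  obtain ⟨e, he, -⟩ := hS.sub_unique hk hj
  refine ⟨t₁ ≫ e.hom, t₂ ≫ e.hom, by rw [Category.assoc, he, hk₁], by rw [Category.assoc, he, hk₂],
    ⟨IsColimit.ofIsoColimit hT (BinaryCofan.ext e rfl rfl)⟩⟩

section

variable {S : Type} {A A' : SumDiag C S}

lemma sumDiag_comm (f : A ⟶ A') {U V : Set S} (h : U ≤ V) :
    SumDiag.app f U ≫ A'.fn.map (homOfLE h) = A.fn.map (homOfLE h) ≫ SumDiag.app f V :=
  (NatTrans.naturality f (homOfLE h)).symm

/-- A component of a pointwise cofibration. -/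
abbrev cofApp (W : SWData C) (f : { f : A ⟶ A' // ∀ U, W.cof (SumDiag.app f U) }) (U : Set S) :
    { f : A.fn.obj U ⟶ A'.fn.obj U // W.cof f } :=
  ⟨SumDiag.app f.1 U, f.2 U⟩

lemma chosen_hom_ext (hS : W.IsSubtractive) (hm : W.MonoCof) {X Y Z : C}
    {f : { f : X ⟶ Y // W.cof f }} {a b : Z ⟶ (chosen hS f).1}
    (h : a ≫ (chosen hS f).2.1 = b ≫ (chosen hS f).2.1) : a = b := by
  have := mono_of_sub hS hm (chosen hS f).2.2
  exact (cancel_mono _).1 h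

lemma chosenLift_comp (hS : W.IsSubtractive) (hm : W.MonoCof) {X Y X' Y' X'' Y'' : C}
    {f : { f : X ⟶ Y // W.cof f }} {f' : { f : X' ⟶ Y' // W.cof f }}
    {f'' : { f : X'' ⟶ Y'' // W.cof f }} {g : Y ⟶ Y'} {g' : Y' ⟶ Y''} {k : Y ⟶ Y''}
    (e : g ≫ g' = k)
    {h : ∃ c : (chosen hS f).1 ⟶ (chosen hS f').1,
      c ≫ (chosen hS f').2.1 = (chosen hS f).2.1 ≫ g}
    {h' : ∃ c : (chosen hS f').1 ⟶ (chosen hS f'').1,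
      c ≫ (chosen hS f'').2.1 = (chosen hS f').2.1 ≫ g'}
    {h'' : ∃ c : (chosen hS f).1 ⟶ (chosen hS f'').1,
      c ≫ (chosen hS f'').2.1 = (chosen hS f).2.1 ≫ k} :
    chosenLift hS f f' g h ≫ chosenLift hS f' f'' g' h' = chosenLift hS f f'' k h'' :=
  chosen_hom_ext hS hm (by
    rw [Category.assoc, chosenLift_incl, ← Category.assoc, chosenLift_incl, chosenLift_incl,
      Category.assoc, e])

lemma exists_sum_compl (hS : W.IsSubtractive) (hc : W.SumsSubtractive)
    (f : { f : A ⟶ A' // ∀ U, W.cof (SumDiag.app f U) }) {U V X : Set S}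
    (hU : U ≤ X) (hV : V ≤ X) (h : Disjoint U V) (h' : U ∪ V = X) :
    ∃ (u : (chosen hS (cofApp W f U)).1 ⟶ (chosen hS (cofApp W f X)).1)
      (v : (chosen hS (cofApp W f V)).1 ⟶ (chosen hS (cofApp W f X)).1),
      u ≫ (chosen hS (cofApp W f X)).2.1 =
        (chosen hS (cofApp W f U)).2.1 ≫ A'.fn.map (homOfLE hU) ∧
      v ≫ (chosen hS (cofApp W f X)).2.1 =
        (chosen hS (cofApp W f V)).2.1 ≫ A'.fn.map (homOfLE hV) ∧
      Nonempty (IsColimit (BinaryCofan.mk u v)) :=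
  exists_coproduct_compl hS hc (A.sum hU hV h h') (A'.sum hU hV h h') (sumDiag_comm f.1 hU)
    (sumDiag_comm f.1 hV) (chosen hS (cofApp W f U)).2.2 (chosen hS (cofApp W f V)).2.2
    (chosen hS (cofApp W f X)).2.2

/-- Every inclusion of subsets is the inclusion of a summand, with other summand X ∖ U, so the map
comes from the coproduct decomposition of complements. -/
lemma exists_compl_map (hS : W.IsSubtractive) (hc : W.SumsSubtractive)
    (f : { f : A ⟶ A' // ∀ U, W.cof (SumDiag.app f U) }) {U X : Set S} (hU : U ≤ X) :
    ∃ u : (chosen hS (cofApp W f U)).1 ⟶ (chosen hS (cofApp W f X)).1,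
      u ≫ (chosen hS (cofApp W f X)).2.1 =
        (chosen hS (cofApp W f U)).2.1 ≫ A'.fn.map (homOfLE hU) := by
  obtain ⟨u, -, hu, -⟩ := exists_sum_compl hS hc f hU (Set.sdiff_subset (t := U))
    Set.disjoint_sdiff_right (Set.union_sdiff_cancel hU)
  exact ⟨u, hu⟩

variable (hS : W.IsSubtractive) (hm : W.MonoCof) (hc : W.SumsSubtractive)
  (f : { f : A ⟶ A' // ∀ U, W.cof (SumDiag.app f U) })

/-- The pointwise complement of a pointwise cofibration of sum diagrams. -/
def sumCompl : SumDiag C S where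
  fn :=
    { obj := fun U => (chosen hS (cofApp W f U)).1
      map := fun {U V} h => chosenLift hS (cofApp W f U) (cofApp W f V) (A'.fn.map h)
        (exists_compl_map hS hc f (leOfHom h))
      map_id := fun U => chosen_hom_ext hS hm (by
        rw [chosenLift_incl, A'.fn.map_id, Category.id_comp, Category.comp_id])
      map_comp := fun g h => (chosenLift_comp hS hm (A'.fn.map_comp g h).symm).symm }
  empty {U} hU := by
    obtain ⟨I⟩ := hS.initial
    obtain ⟨J⟩ := A'.empty hU
    -- The complement maps to an initial object, and the initial object is strict.
    obtain ⟨e⟩ := iso_O_of_hom hS ((chosen hS (cofApp W f U)).2.1 ≫ J.to W.O)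
    exact ⟨I.ofIso e.symm⟩
  sum {U V X} hU hV h h' := by
    obtain ⟨u, v, hu, hv, hc'⟩ := exists_sum_compl hS hc f hU hV h h'
    have h₁ : chosenLift hS (cofApp W f U) (cofApp W f X) (A'.fn.map (homOfLE hU))
        (exists_compl_map hS hc f hU) = u :=
      chosen_hom_ext hS hm (by rw [chosenLift_incl, hu])
    have h₂ : chosenLift hS (cofApp W f V) (cofApp W f X) (A'.fn.map (homOfLE hV))
        (exists_compl_map hS hc f hV) = v :=
      chosen_hom_ext hS hm (by rw [chosenLift_incl, hv])
    subst h₁ h₂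
    exact hc'

/-- The inclusion of the pointwise complement. -/
def sumIncl : sumCompl hS hm hc f ⟶ A' where
  app U := (chosen hS (cofApp W f U)).2.1
  naturality _ _ _ := chosenLift_incl hS _ _ _ _

end

section

variable {S : Type}

lemma sumDiag_mono {A B : SumDiag C S} (f : A ⟶ B) (h : ∀ U, Mono (SumDiag.app f U)) : Mono f where
  right_cancellation _ _ e := NatTrans.ext (funext fun U =>
    (h U).right_cancellation _ _ (congrArg (fun a => SumDiag.app a U) e))

lemma sumDiag_ext {A B : SumDiag C S} (h : A.fn = B.fn) : A = B := by
  obtain ⟨_, _, _⟩ := A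
  obtain ⟨_, _, _⟩ := B
  obtain rfl := h
  rfl

/-- Pointwise factorizations through a pointwise monomorphism are natural. -/
lemma exists_sumDiag_lift {A B D : SumDiag C S} (f : A ⟶ D) (g : B ⟶ D)
    (hg : ∀ U, Mono (SumDiag.app g U)) (P : ∀ U, (A.fn.obj U ⟶ B.fn.obj U) → Prop)
    (h : ∀ U, ∃ c : A.fn.obj U ⟶ B.fn.obj U, c ≫ SumDiag.app g U = SumDiag.app f U ∧ P U c) :
    ∃ c : A ⟶ B, c ≫ g = f ∧ ∀ U, P U (SumDiag.app c U) := by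
  choose c hc hP using h
  refine ⟨{ app := c, naturality := fun U V e => (hg V).right_cancellation _ _ ?_ },
    NatTrans.ext (funext hc), hP⟩
  rw [Category.assoc, hc, Category.assoc]
  exact (NatTrans.naturality f e).trans ((congrArg (fun a => a ≫ D.fn.map e) (hc U).symm).trans
    ((Category.assoc _ _ _).trans
      (congrArg (fun a => c U ≫ a) (NatTrans.naturality g e).symm)))

lemma sumDiag_nonempty_iso_const {hO : Nonempty (IsInitial W.O)} {A : SumDiag C S}
    (h : ∀ U, Nonempty (A.fn.obj U ≅ W.O)) : Nonempty (A ≅ SumDiag.const S W.O hO) := by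
  obtain ⟨I⟩ := hO
  have J : ∀ U, IsInitial (A.fn.obj U) := fun U => I.ofIso (h U).some.symm
  exact ⟨{
    hom := { app := fun U => (J U).to W.O
             naturality := fun _ _ _ => (J _).hom_ext _ _ }
    inv := { app := fun U => I.to (A.fn.obj U)
             naturality := fun _ _ _ => I.hom_ext _ _ }
    hom_inv_id := NatTrans.ext (funext fun U => (J U).hom_ext _ _)
    inv_hom_id := NatTrans.ext (funext fun U => I.hom_ext _ _) }⟩

/-- The complement model of the category of sum diagrams. -/
def sumModel (W : SWData C) (hW : W.IsSW) (hm : W.MonoCof) (hs : W.Star) (hc : W.SumsSubtractive)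
    (S : Type) : ComplementModel (W.sums hW.initial S) where
  dist f f' g g' := ∀ U, W.Dist (SumDiag.app f U) (SumDiag.app f' U) (SumDiag.app g U)
    (SumDiag.app g' U)
  dist_vcomp h₁ h₂ U := Dist.vcomp hW hm (h₁ U) (h₂ U)
  dist_hcomp h₁ h₂ U := Dist.hcomp hW hm hs (h₁ U) (h₂ U)
  dist_comm h := NatTrans.ext (funext fun U => (h U).1)
  dist_vid hf U := Dist.vid hW (hf U)
  dist_hid g U := Dist.hid hW (SumDiag.app g U)
  initial := by
    obtain ⟨I⟩ := hW.initial
    exact ⟨IsInitial.ofUniqueHom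
      (fun A => { app := fun U => I.to (A.fn.obj U), naturality := fun _ _ _ => I.hom_ext _ _ })
      (fun A f => NatTrans.ext (funext fun U => I.hom_ext _ _))⟩
  cof_initial f U := hW.sub_cof (hW.sub_initial (SumDiag.app f U))
  sub_cof h U := hW.sub_cof (h U)
  mono_of_sub h := sumDiag_mono _ fun U => mono_of_sub hW.toIsSubtractive hm (h U)
  compl f := sumCompl hW.toIsSubtractive hm hc f
  incl f := sumIncl hW.toIsSubtractive hm hc f
  sub_incl f U := (chosen hW.toIsSubtractive (cofApp W f U)).2.2
  -- The chosen transformation `h.choose` enters only into a proof of existence at U. The component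
  -- itself depends only on the data at U.
  lift f f' g h :=
    { app := fun U => chosenLift hW.toIsSubtractive (cofApp W f U) (cofApp W f' U)
        (SumDiag.app g U) ⟨SumDiag.app h.choose U,
          congrArg (fun a => SumDiag.app a U) h.choose_spec⟩
      naturality := fun U V e => ComplementModel.lift_square (M := W.model hW hm hs)
        (f := cofApp W f U) (f₁ := cofApp W f V) (f₂ := cofApp W f' U) (f' := cofApp W f' V)
        (NatTrans.naturality g e) }
  lift_incl f f' g h := NatTrans.ext (funext fun U => chosenLift_incl _ _ _ _ _)
  compl_O := sumDiag_ext (CategoryTheory.Functor.ext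
    (fun U => chosen_id_O hW.toIsSubtractive (W.cof_mul.id_mem _)) (fun U V e => by
      obtain ⟨I⟩ := hW.initial
      have h : ∀ {X : C} (_ : X = W.O) {Y : C} (f g : X ⟶ Y), f = g := by
        rintro X rfl Y f g
        exact I.hom_ext f g
      exact h (chosen_id_O hW.toIsSubtractive (W.cof_mul.id_mem _)) _ _))
  iso_O_of_sub_id {X U j} h := sumDiag_nonempty_iso_const fun V =>
    iso_O_of_sub_isIso (i := 𝟙 (X.fn.obj V)) hW.toIsSubtractive (h V)
  exists_weq {X Y U X' Y' U' i j i' j' g g'} h hj hj' := exists_sumDiag_lift (j ≫ g') j'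
    (fun U => mono_of_sub hW.toIsSubtractive hm (hj' U)) (fun U c => W.weq c)
    (fun U => (h U).exists_weq hW (hj U) (hj' U))
  dist_of_sub hj hj' w hc hw U := Dist.of_sub hW hm (hj U) (hj' U)
    (congrArg (fun a => SumDiag.app a U) w) (congrArg (fun a => SumDiag.app a U) hc) (hw U)
  exists_sub_comp {X Y Z U V K f g j l k} hj hl hk := by
    have hmono := fun S => mono_of_sub hW.toIsSubtractive hm (hk S)
    have h := fun S => exists_sub_comp hW.toIsSubtractive hm (hj S) (hl S) (hk S)
    -- Naturality of a and b is obtained separately. The subtraction property is carried along with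
    -- an unspecified second map, which is later identified with b because k is a pointwise
    -- monomorphism.
    obtain ⟨a, ha, ha'⟩ := exists_sumDiag_lift (j ≫ g) k hmono
      (fun S c => ∃ b, b ≫ SumDiag.app k S = SumDiag.app l S ∧ W.sub c b) (fun S => by
        obtain ⟨a, b, h₁, h₂⟩ := h S
        exact ⟨a, h₁, b, h₂⟩)
    obtain ⟨b, hb, -⟩ := exists_sumDiag_lift l k hmono (fun _ _ => True) (fun S => by
      obtain ⟨a, b, -, h₂, -⟩ := h S
      exact ⟨b, h₂, trivial⟩)
    refine ⟨a, b, ha, hb, fun S => ?_⟩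
    obtain ⟨b', hb', hs⟩ := ha' S
    have : SumDiag.app b S = b' := (hmono S).right_cancellation _ _
      ((congrArg (fun a => SumDiag.app a S) hb).trans hb'.symm)
    rw [this]
    exact hs

end

end SWData

namespace SWData

variable {C : Type u} [Category.{v} C] (W : SWData C) (hW : W.IsSW) (hm : W.MonoCof)
  (hs : W.Star) (hc : W.SumsSubtractive)

/-- Complements and their lifts are chosen pointwise in C, so reindexing the subsets commutes with
these choices definitionally. -/
lemma complSSet_naturality {S T : Type} (m : SetMap S T) :
    pointedT.map (W.sumSquaresMap hW hm hs m) ≫ (W.sumModel hW hm hs hc T).complSSet =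
      (W.sumModel hW hm hs hc S).complSSet ≫ pointedS.map (W.sumsMap hW.initial m) :=
  rfl

/-- The comparison map of `Γ`-spaces. -/
def kGammaMap : W.squaresKGamma hW hm hs ⟶ W.swKGamma hW.initial where
  app S := (W.sumModel hW hm hs hc S.obj).kMap
  naturality _ _ φ := (loopRealization.map_comp _ _).symm.trans
    ((congrArg (fun f => loopRealization.map f)
      (W.complSSet_naturality hW hm hs hc (SetMap.ofPFun φ.hom))).trans
      (loopRealization.map_comp _ _))

end SWData

end SquaresK
end

theorem mainTheorem7 {C : Type u} [CategoryTheory.Category.{v} C] (W : SquaresK.SWData C)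
    (hW : W.IsSW) (hm : W.MonoCof) (hs : W.Star) :
    Nonempty (W.K ≃ₕ SquaresK.squaresK.obj (W.squares hW hm hs)) ∧
    (W.SumsSubtractive →
      SquaresK.GammaEquiv (W.swKGamma hW.initial) (W.squaresKGamma hW hm hs)) := by
  constructor
  -- The squares category of the complement model is definitionally the associated squares category,
  -- and likewise pointwise for sum diagrams below.
  · obtain ⟨e, -⟩ := (W.model hW hm hs).isHEquiv_kMap
    exact ⟨e.symm⟩
  · intro hc
    exact Relation.EqvGen.symm _ _ (Relation.EqvGen.rel _ _
      ⟨W.kGammaMap hW hm hs hc, fun S => (W.sumModel hW hm hs hc S.obj).isHEquiv_kMap⟩)
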